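/- Let $R=\mathbb{Z}[a^{\pm1},b^{\pm1},c^{\pm1}]$, and let $B_n$ be the braid group on $n$ strands with Artin generators $s_1,\dots,s_{n-1}$. Let $\mathrm{Q}_n$ be the quotient of the group algebra $RB_n$ by the relations $(s_i-a)(s_i-b)(s_i-c)=0$ for $1\le i\le n-1$ and, if $n\ge 3$, the relation $$ \begin{aligned} s_1^{-1}s_2s_1 ={}& s_1s_2s_1^{-1}-a^{-1}s_1s_2+a\,s_1s_2^{-1}+a\,s_1^{-1}s_2-a^3s_1^{-1}s_2^{-1}+a^{-1}s_2s_1-a\,s_2s_1^{-1}\\ &-a\,s_2^{-1}s_1+a^3s_2^{-1}s_1^{-1}+a^2s_1^{-1}s_2^{-1}s_1-a^2s_1s_2^{-1}s_1^{-1}. \end{aligned} $$ For $n\ge 1$, inside $\mathrm{Q}_{n+1}$ write again $\mathrm{Q}_n$ for the image of the natural morphism $\mathrm{Q}_n\to\mathrm{Q}_{n+1}$, $s_i\mapsto s_i$, and put $u_n=R+Rs_n+Rs_n^2$. Let $$\mathrm{Q}_{n+1}^{(k)}=\mathrm{Q}_nu_n\mathrm{Q}_nu_n\cdots u_n\mathrm{Q}_n\qquad(k+1\text{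 factors }\mathrm{Q}_n,\ k\text{ factors }u_n),$$ where a product of $R$-submodules of $\mathrm{Q}_{n+1}$ denotes the $R$-span of the products of their elements. **Theorem.** $\mathrm{Q}_5$ is a finitely generated $R$-module, and $\mathrm{Q}_5=\mathrm{Q}_5^{(3)}=\mathrm{Q}_4u_4\mathrm{Q}_4u_4\mathrm{Q}_4u_4\mathrm{Q}_4$. -/

import Mathlib

noncomputable section

namespace CubicQuotient

/-- The Laurent polynomial ring `R = ℤ[a^{±1}, b^{±1}, c^{±1}]`, as the group ring of `ℤ³`. -/
abbrev R : Type := AddMonoidAlgebra ℤ (Fin 3 →₀ ℤ)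

/-- The three variables of `R`, as units. -/
def var (i : Fin 3) : Rˣ :=
  Units.map (AddMonoidAlgebra.of ℤ (Fin 3 →₀ ℤ))
    (toUnits (Multiplicative.ofAdd (Finsupp.single i (1 : ℤ))))

def a : Rˣ := var 0

def b : Rˣ := var 1

def c : Rˣ := var 2

/-- Indices of the Artin generators `s_1, …, s_{n-1}` of the braid group on `n` strands. -/
abbrev Index (n : ℕ) : Type := {i : ℕ // 1 ≤ i ∧ i < n}

/-- Artin's relations: `s_i s_{i+1} s_i = s_{i+1} s_i s_{i+1}`, and `s_i s_j = s_j s_i` for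
`|i - j| ≥ 2`. -/
inductive ArtinRel (n : ℕ) : FreeGroup (Index n) → Prop
  | braid (i j : Index n) (h : i.1 + 1 = j.1) :
      ArtinRel n (FreeGroup.of i * FreeGroup.of j * FreeGroup.of i *
        (FreeGroup.of j * FreeGroup.of i * FreeGroup.of j)⁻¹)
  | comm (i j : Index n) (h : i.1 + 2 ≤ j.1) :
      ArtinRel n (FreeGroup.of i * FreeGroup.of j * (FreeGroup.of j * FreeGroup.of i)⁻¹)

/-- The braid group `B_n` on `n` strands. -/
abbrev BraidGroup (n : ℕ) : Type := PresentedGroup {r | ArtinRel n r}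

/-- The Artin generator `s_i` of `B_n`. -/
def artin {n : ℕ} (i : Index n) : BraidGroup n := PresentedGroup.of i

/-- The group algebra `R B_n`. -/
abbrev BraidAlgebra (n : ℕ) : Type := MonoidAlgebra R (BraidGroup n)

/-- A braid, as an element of `R B_n`. -/
def br {n : ℕ} (g : BraidGroup n) : BraidAlgebra n := MonoidAlgebra.of R (BraidGroup n) g

/-- The defining relations of `Q_n` in `R B_n`: the cubic relation
`(s_i - a)(s_i - b)(s_i - c) = 0` for all `i` and, if `n ≥ 3`, the relation expressing
`s_1⁻¹ s_2 s_1`. -/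
inductive QRel (n : ℕ) : BraidAlgebra n → BraidAlgebra n → Prop
  | cubic (i : Index n) :
      QRel n
        ((br (artin i) - algebraMap R (BraidAlgebra n) a) *
          (br (artin i) - algebraMap R (BraidAlgebra n) b) *
          (br (artin i) - algebraMap R (BraidAlgebra n) c)) 0
  | skein (s₁ s₂ : BraidGroup n) (h₁ : ∃ h, s₁ = artin ⟨1, h⟩) (h₂ : ∃ h, s₂ = artin ⟨2, h⟩) :
      QRel n
        (br (s₁⁻¹ * s₂ * s₁))
        (br (s₁ * s₂ * s₁⁻¹)
          - ((a⁻¹ : Rˣ) : R) • br (s₁ * s₂)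
          + (a : R) • br (s₁ * s₂⁻¹)
          + (a : R) • br (s₁⁻¹ * s₂)
          - (a : R) ^ 3 • br (s₁⁻¹ * s₂⁻¹)
          + ((a⁻¹ : Rˣ) : R) • br (s₂ * s₁)
          - (a : R) • br (s₂ * s₁⁻¹)
          - (a : R) • br (s₂⁻¹ * s₁)
          + (a : R) ^ 3 • br (s₂⁻¹ * s₁⁻¹)
          + (a : R) ^ 2 • br (s₁⁻¹ * s₂⁻¹ * s₁)
          - (a : R) ^ 2 • br (s₁ * s₂⁻¹ * s₁⁻¹))

/-- The `R`-algebra `Q_n`: the quotient of `R B_n` by the two-sided ideal generated by the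
defining relations. -/
abbrev Q (n : ℕ) : Type := RingQuot (QRel n)

/-- The quotient map `R B_n → Q_n`. -/
def toQ (n : ℕ) : BraidAlgebra n →ₐ[R] Q n := RingQuot.mkAlgHom R (QRel n)

/-- The image of the Artin generator `s_i` in `Q_n`. -/
def s {n : ℕ} (i : Index n) : Q n := toQ n (br (artin i))

/-- `B_n → B_{n+1}`, `s_i ↦ s_i` (adding a strand on the right). -/
def braidIncl (n : ℕ) : BraidGroup n →* BraidGroup (n + 1) :=
  PresentedGroup.toGroup (f := fun i => artin ⟨i.1, i.2.1, Nat.lt_succ_of_lt i.2.2⟩) (by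
    rintro r (⟨i, j, h⟩ | ⟨i, j, h⟩)
    · simpa [artin, PresentedGroup.of] using
        PresentedGroup.one_of_mem (rels := {r | ArtinRel (n + 1) r})
          (ArtinRel.braid ⟨i.1, i.2.1, Nat.lt_succ_of_lt i.2.2⟩
            ⟨j.1, j.2.1, Nat.lt_succ_of_lt j.2.2⟩ h)
    · simpa [artin, PresentedGroup.of] using
        PresentedGroup.one_of_mem (rels := {r | ArtinRel (n + 1) r})
          (ArtinRel.comm ⟨i.1, i.2.1, Nat.lt_succ_of_lt i.2.2⟩
            ⟨j.1, j.2.1, Nat.lt_succ_of_lt j.2.2⟩ h))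

theorem braidIncl_artin {n : ℕ} (i : Index n) :
    braidIncl n (artin i) = artin ⟨i.1, i.2.1, Nat.lt_succ_of_lt i.2.2⟩ := by
  simp [braidIncl, artin]

/-- `R B_n → R B_{n+1}`. -/
def braidAlgebraIncl (n : ℕ) : BraidAlgebra n →ₐ[R] BraidAlgebra (n + 1) :=
  MonoidAlgebra.mapDomainAlgHom R R (braidIncl n)

theorem braidAlgebraIncl_br {n : ℕ} (g : BraidGroup n) :
    braidAlgebraIncl n (br g) = br (braidIncl n g) := by
  simp [braidAlgebraIncl, br]

theorem braidAlgebraIncl_rel {n : ℕ} {x y : BraidAlgebra n} (h : QRel n x y) :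
    QRel (n + 1) (braidAlgebraIncl n x) (braidAlgebraIncl n y) := by
  cases h with
  | cubic i =>
    simp only [map_mul, map_sub, map_zero, AlgHom.commutes, braidAlgebraIncl_br, braidIncl_artin]
    exact QRel.cubic _
  | skein s₁ s₂ h₁ h₂ =>
    simp only [map_mul, map_sub, map_add, map_smul, map_inv, braidAlgebraIncl_br]
    refine QRel.skein _ _ ?_ ?_
    · obtain ⟨h, rfl⟩ := h₁
      exact ⟨_, braidIncl_artin _⟩
    · obtain ⟨h, rfl⟩ := h₂
      exact ⟨_, braidIncl_artin _⟩

/-- The natural morphism `Q_n → Q_{n+1}`, `s_i ↦ s_i`. -/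
def incl (n : ℕ) : Q n →ₐ[R] Q (n + 1) :=
  RingQuot.liftAlgHom R ⟨(toQ (n + 1)).comp (braidAlgebraIncl n), fun _ _ h =>
    RingQuot.mkAlgHom_rel R (braidAlgebraIncl_rel h)⟩

theorem incl_s {n : ℕ} (i : Index n) :
    incl n (s i) = s ⟨i.1, i.2.1, Nat.lt_succ_of_lt i.2.2⟩ := by
  simp [incl, s, toQ, braidAlgebraIncl_br, braidIncl_artin]

/-- The image of `Q_n` in `Q_{n+1}`, as an `R`-submodule. -/
def sub (n : ℕ) : Submodule R (Q (n + 1)) := LinearMap.range (incl n).toLinearMap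

/-- `u_i = R + R s_i + R s_i²`. -/
def u {n : ℕ} (i : Index n) : Submodule R (Q n) := Submodule.span R {1, s i, s i ^ 2}

/-- `Q_{n+1}^{(k)} = Q_n u_n Q_n ⋯ u_n Q_n` with `k + 1` factors `Q_n` and `k` factors `u_n`.
Products are products of `R`-submodules of the algebra `Q_{n+1}`, i.e. `R`-spans of products. -/
def filt (n : ℕ) (hn : 1 ≤ n) : ℕ → Submodule R (Q (n + 1))
  | 0 => sub n
  | k + 1 => filt n hn k * u ⟨n, hn, Nat.lt_succ_self n⟩ * sub n

end CubicQuotient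

end

/-!
The algebra `Q₅` is generated by four units `r`, `s`, `t`, `w`: neighbours satisfy the relations of
`Q₃`, because consecutive pairs of Artin generators are conjugate, and the others commute. Modulo
shorter words the relation of `Q₃` makes the alternating words proportional, up to units of `R`, to
`t s² t`, so `Q₃` and `Q₄` have normal forms in terms of the Jucys–Murphy elements
`murphy₃ s t = t s² t` and `murphy₄ r s t = t (murphy₃ r s) t`, which commute with the preceding
generators.

Count the letters `w^{±1}`. Modulo words of degree at most two in `w`, a product
`x y (murphy₄ s t w)` with `x = w^{±1}` and `y` in the algebra of `r`, `s`, `t` reduces to right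
multiples of the single word `w (t⁻¹ s t⁻¹) (r s⁻¹ r) (murphy₄ s t w)`. Moving `r` through this word
turns it into `t`, and left multiplication by `s` or `t` is controlled by the normal form of `Q₃`;
so the words of degree at most two, the right multiples of this word and those of its image under
inverting the generators span a submodule stable under left multiplication by `r`, `s` and `t`. The
normal form of `Q₄` shows that it is also stable under `w^{±1}`. Since it contains `1`, it is the
whole algebra, and it lies in degree three. The passages to the inverse generators and to the
opposite algebra preserve all relations and remove most of the case distinctions.
-/

namespace SkeinAlgebra

open Submodule MulOpposite

section BraidRelation

variable {G : Type*} [Group G] {s t : G}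

theorem braid_conj (h : s * t * s = t * s * t) : s * t * s⁻¹ = t⁻¹ * s * t := by
  rw [mul_inv_eq_iff_eq_mul, mul_assoc, mul_assoc, eq_inv_mul_iff_mul_eq]
  simpa only [mul_assoc] using h.symm

theorem braid_inv (h : s * t * s = t * s * t) : s⁻¹ * t⁻¹ * s⁻¹ = t⁻¹ * s⁻¹ * t⁻¹ := by
  simpa only [mul_inv_rev, mul_assoc] using congrArg (·⁻¹) h

theorem braid_conj_inv (h : s * t * s = t * s * t) : s * t⁻¹ * s⁻¹ = t⁻¹ * s⁻¹ * t := by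
  simpa only [mul_inv_rev, inv_inv, mul_assoc] using congrArg (·⁻¹) (braid_conj h)

theorem braid_inv_conj (h : s * t * s = t * s * t) : s⁻¹ * t * s = t * s * t⁻¹ :=
  (braid_conj h.symm).symm

theorem braid_inv_conj_inv (h : s * t * s = t * s * t) : s⁻¹ * t⁻¹ * s = t * s⁻¹ * t⁻¹ :=
  (braid_conj_inv h.symm).symm

end BraidRelation

section Between

variable {k A : Type*} [CommRing k] [Ring A] [Algebra k A] {P Q : Submodule k A} {x y z : A}

theorem mul_mul_le {L M N : Submodule k A} :
    L * M * N ≤ P ↔ ∀ x ∈ L, ∀ y ∈ M, ∀ z ∈ N, x * y * z ∈ P := by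
  refine ⟨fun h x hx y hy z hz => h (mul_mem_mul (mul_mem_mul hx hy) hz), fun h => ?_⟩
  refine mul_le.2 fun w hw z hz => ?_
  induction hw using Submodule.mul_induction_on' with
  | mem_mul_mem x hx y hy => exact h x hx y hy z hz
  | add v _ w _ hv hw => rw [add_mul]; exact add_mem hv hw

/-- The two-sided transporter of `P`: the submodule of all `y` such that `x * y * z` lies in `P`.
It turns a membership statement about products into an inclusion, provable on generators. -/
def between (P : Submodule k A) (x z : A) : Submodule k A :=
  P.comap (LinearMap.mulRight k z ∘ₗ LinearMap.mulLeft k x)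

theorem mem_between : y ∈ between P x z ↔ x * y * z ∈ P := Iff.rfl

theorem mem_between_one_right : y ∈ between P x 1 ↔ x * y ∈ P := by rw [mem_between, mul_one]

theorem mem_between_one_left : y ∈ between P 1 z ↔ y * z ∈ P := by rw [mem_between, one_mul]

theorem between_mono (h : P ≤ Q) : between P x z ≤ between Q x z := fun _ hy => h hy

end Between

section UnitCongr

variable {k A : Type*} [CommRing k] [Ring A] [Algebra k A] {P Q : Submodule k A} {x y z : A}

/-- Congruence modulo `P` up to an invertible scalar. Congruent elements are interchangeable in
questions of membership in submodules containing `P`; the scalar itself never matters. -/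
def UnitCongr (P : Submodule k A) (x y : A) : Prop := ∃ c : kˣ, x - (c : k) • y ∈ P

namespace UnitCongr

theorem symm (h : UnitCongr P x y) : UnitCongr P y x := by
  obtain ⟨c, hc⟩ := h
  refine ⟨c⁻¹, ?_⟩
  convert smul_mem P (-(↑c⁻¹ : k)) hc using 1
  rw [smul_sub, smul_smul, neg_mul, Units.inv_mul]
  module

theorem trans (hxy : UnitCongr P x y) (hyz : UnitCongr P y z) : UnitCongr P x z := by
  obtain ⟨c, hc⟩ := hxy
  obtain ⟨d, hd⟩ := hyz
  refine ⟨c * d, ?_⟩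
  convert add_mem hc (smul_mem P (c : k) hd) using 1
  rw [Units.val_mul]
  module

theorem mem_iff (h : UnitCongr P x y) (hPQ : P ≤ Q) : x ∈ Q ↔ y ∈ Q := by
  suffices ∀ {x y}, UnitCongr P x y → y ∈ Q → x ∈ Q from ⟨this h.symm, this h⟩
  rintro x y ⟨c, hc⟩ hy
  simpa using add_mem (hPQ hc) (smul_mem Q (c : k) hy)

theorem mul_mul (h : UnitCongr Q x y) {a b : A} (hQ : Q ≤ between P a b) :
    UnitCongr P (a * x * b) (a * y * b) := by
  obtain ⟨c, hc⟩ := h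
  refine ⟨c, ?_⟩
  simpa only [mem_between, mul_sub, sub_mul, mul_smul_comm, smul_mul_assoc] using hQ hc

theorem mul_left (h : UnitCongr Q x y) {a : A} (hQ : ∀ z ∈ Q, a * z ∈ P) :
    UnitCongr P (a * x) (a * y) := by
  simpa only [mul_one] using h.mul_mul fun z hz => mem_between_one_right.2 (hQ z hz)

theorem mul_right (h : UnitCongr Q x y) {b : A} (hQ : ∀ z ∈ Q, z * b ∈ P) :
    UnitCongr P (x * b) (y * b) := by
  simpa only [one_mul] using h.mul_mul fun z hz => mem_between_one_left.2 (hQ z hz)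

theorem inv_mul {g : Aˣ} (h : UnitCongr P (g * x) x)
    (hg : ∀ y ∈ P, (↑g⁻¹ : A) * y ∈ P) : UnitCongr P ((↑g⁻¹ : A) * x) x := by
  simpa only [Units.inv_mul_cancel_left] using (h.mul_left hg).symm

end UnitCongr

end UnitCongr

section CubicSpan

/-- The span of `1`, `s` and `s⁻¹`. -/
def cubicSpan (k : Type*) {A : Type*} [CommRing k] [Ring A] [Algebra k A] (s : Aˣ) :
    Submodule k A :=
  span k {1, (s : A), (↑s⁻¹ : A)}

variable {k A : Type*} [CommRing k] [Ring A] [Algebra k A] {s : Aˣ} {e : kˣ} {e₁ e₂ : k}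

theorem one_mem_cubicSpan (s : Aˣ) : (1 : A) ∈ cubicSpan k s := subset_span (by simp)

theorem mem_cubicSpan (s : Aˣ) : (s : A) ∈ cubicSpan k s := subset_span (by simp)

theorem inv_mem_cubicSpan (s : Aˣ) : (↑s⁻¹ : A) ∈ cubicSpan k s := subset_span (by simp)

theorem cubicSpan_le {P : Submodule k A} :
    cubicSpan k s ≤ P ↔ (1 : A) ∈ P ∧ (s : A) ∈ P ∧ (↑s⁻¹ : A) ∈ P := by
  simp [cubicSpan, span_le, Set.insert_subset_iff]

theorem fg_cubicSpan (s : Aˣ) : (cubicSpan k s).FG := fg_span (by simp)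

theorem cubicSpan_inv (s : Aˣ) : cubicSpan k s⁻¹ = cubicSpan k s := by
  rw [cubicSpan, cubicSpan, inv_inv, Set.pair_comm]

theorem cubicSpan_mul_mul_cubicSpan_le {P X : Submodule k A} (h₀ : X ≤ P)
    (hr : ∀ y ∈ X, y * s ∈ P) (hr' : ∀ y ∈ X, y * (↑s⁻¹ : A) ∈ P)
    (hl : ∀ y ∈ X, s * y ∈ P) (hl' : ∀ y ∈ X, (↑s⁻¹ : A) * y ∈ P)
    (hlr : X ≤ between P s s) (hlr' : X ≤ between P s (↑s⁻¹ : A))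
    (hl'r : X ≤ between P (↑s⁻¹ : A) s) (hl'r' : X ≤ between P (↑s⁻¹ : A) (↑s⁻¹ : A)) :
    cubicSpan k s * X * cubicSpan k s ≤ P := by
  refine mul_mul_le.2 fun x hx y hy z hz => ?_
  have right : ∀ a : A, a * y ∈ P → a * y * s ∈ P → a * y * (↑s⁻¹ : A) ∈ P → a * y * z ∈ P :=
    fun a h₁ h₂ h₃ => mem_between_one_right.1
      (cubicSpan_le.2 ⟨by rwa [mem_between, mul_one, mul_one], by rwa [mem_between, mul_one],
        by rwa [mem_between, mul_one]⟩ hz)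
  suffices cubicSpan k s ≤ between P 1 (y * z) by
    simpa only [mem_between, one_mul, mul_assoc] using this hx
  refine cubicSpan_le.2 ⟨?_, ?_, ?_⟩ <;> rw [mem_between_one_left, ← mul_assoc]
  · exact right 1 (by rw [one_mul]; exact h₀ hy) (by rw [one_mul]; exact hr y hy)
      (by rw [one_mul]; exact hr' y hy)
  · exact right s (hl y hy) (hlr hy) (hlr' hy)
  · exact right _ (hl' y hy) (hl'r hy) (hl'r' hy)

/-- The cubic relation, in the form `s² = e₁ s - e₂ + e s⁻¹` that it takes for a unit `s`. -/
def IsCubic (e : kˣ) (e₁ e₂ : k) (s : Aˣ) : Prop :=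
  ((s * s : Aˣ) : A) = e₁ • (s : A) - e₂ • 1 + (e : k) • (↑s⁻¹ : A)

theorem isCubic_of_mul_eq_zero {α β γ : kˣ}
    (h : ((s : A) - algebraMap k A α) * (s - algebraMap k A β) * (s - algebraMap k A γ) = 0) :
    IsCubic (α * β * γ) (α + β + γ : k) (α * β + α * γ + β * γ : k) s := by
  have expanded := congrArg (· * (↑s⁻¹ : A)) h
  simp only [Algebra.algebraMap_eq_smul_one, sub_mul, mul_sub, smul_mul_assoc, mul_smul_comm,
    one_mul, mul_one, zero_mul, mul_assoc, Units.mul_inv, smul_sub, smul_smul] at expanded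
  rw [IsCubic, ← sub_eq_zero, ← expanded, Units.val_mul, Units.val_mul, Units.val_mul]
  module

namespace IsCubic

theorem inv (h : IsCubic e e₁ e₂ s) : IsCubic e⁻¹ (↑e⁻¹ * e₂) (↑e⁻¹ * e₁) s⁻¹ := by
  have h' := congrArg (fun x => (↑e⁻¹ : k) • (x * (↑s⁻¹ : A))) h
  simp only [add_mul, sub_mul, smul_mul_assoc, one_mul, ← Units.val_mul, mul_assoc,
    mul_inv_cancel, mul_one, smul_add, smul_sub, smul_smul, inv_mul_cancel, one_smul,
    Units.val_one] at h'
  rw [IsCubic, inv_inv, h']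
  abel

theorem conj (h : IsCubic e e₁ e₂ s) (g : Aˣ) : IsCubic e e₁ e₂ (g * s * g⁻¹) := by
  have h' := congrArg (fun x => (g : A) * x * (↑g⁻¹ : A)) h
  simp only [mul_add, add_mul, mul_sub, sub_mul, mul_smul_comm, smul_mul_assoc, mul_one,
    ← Units.val_mul, mul_inv_cancel, Units.val_one] at h'
  simpa only [IsCubic, mul_inv_rev, inv_inv, mul_assoc, inv_mul_cancel_left] using h'

theorem sq_mem_cubicSpan (h : IsCubic e e₁ e₂ s) : (s : A) * s ∈ cubicSpan k s := by
  rw [← Units.val_mul, h]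
  exact add_mem (sub_mem (smul_mem _ _ (mem_cubicSpan s)) (smul_mem _ _ (one_mem_cubicSpan s)))
    (smul_mem _ _ (inv_mem_cubicSpan s))

theorem cubicSpan_mul_self_le (h : IsCubic e e₁ e₂ s) :
    cubicSpan k s * cubicSpan k s ≤ cubicSpan k s := by
  have hinv := h.inv.sq_mem_cubicSpan
  rw [cubicSpan_inv] at hinv
  rw [cubicSpan, span_mul_span, span_le]
  rintro _ ⟨x, hx, y, hy, rfl⟩
  change x * y ∈ cubicSpan k s
  simp only [Set.mem_insert_iff, Set.mem_singleton_iff] at hx hy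
  rcases hx with rfl | rfl | rfl <;> rcases hy with rfl | rfl | rfl <;>
    simp [one_mem_cubicSpan, mem_cubicSpan, inv_mem_cubicSpan, h.sq_mem_cubicSpan, hinv]

theorem mul_mem_cubicSpan (h : IsCubic e e₁ e₂ s) {x y : A} (hx : x ∈ cubicSpan k s)
    (hy : y ∈ cubicSpan k s) : x * y ∈ cubicSpan k s :=
  h.cubicSpan_mul_self_le (mul_mem_mul hx hy)

theorem zpow_mem_cubicSpan (h : IsCubic e e₁ e₂ s) (n : ℤ) :
    ((s ^ n : Aˣ) : A) ∈ cubicSpan k s := by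
  induction n with
  | zero => simpa using one_mem_cubicSpan s
  | succ n ih => simpa [zpow_add] using h.mul_mem_cubicSpan ih (mem_cubicSpan s)
  | pred n ih =>
    rw [sub_eq_add_neg, zpow_add, zpow_neg_one, Units.val_mul]
    exact h.mul_mem_cubicSpan ih (inv_mem_cubicSpan s)

theorem cubicSpan_le_span_pow (h : IsCubic e e₁ e₂ s) :
    cubicSpan k s ≤ span k {1, (s : A), (s : A) ^ 2} := by
  have one_mem : (1 : A) ∈ span k {1, (s : A), (s : A) ^ 2} := subset_span (by simp)
  have gen_mem : (s : A) ∈ span k {1, (s : A), (s : A) ^ 2} := subset_span (by simp)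
  have sq_mem : ((s * s : Aˣ) : A) ∈ span k {1, (s : A), (s : A) ^ 2} :=
    subset_span (by simp [pow_two])
  rw [h] at sq_mem
  have inv_mem := smul_mem _ (↑e⁻¹ : k)
    (sub_mem sq_mem (sub_mem (smul_mem _ e₁ gen_mem) (smul_mem _ e₂ one_mem)))
  rw [add_sub_cancel_left, smul_smul, Units.inv_mul, one_smul] at inv_mem
  exact cubicSpan_le.2 ⟨one_mem, gen_mem, inv_mem⟩

end IsCubic

end CubicSpan

section UnitAdjoin

/-- The subalgebra generated by a set of units and their inverses. -/
def unitAdjoin (k : Type*) {A : Type*} [CommRing k] [Ring A] [Algebra k A] (S : Set Aˣ) :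
    Subalgebra k A :=
  Algebra.adjoin k (Units.val '' (S ∪ S⁻¹))

variable {k A : Type*} [CommRing k] [Ring A] [Algebra k A] {S T : Set Aˣ} {g : Aˣ} {x y z : A}

theorem unitAdjoin_mono (h : S ⊆ T) : unitAdjoin k S ≤ unitAdjoin k T :=
  Algebra.adjoin_mono (Set.image_mono (Set.union_subset_union h (Set.inv_subset_inv.2 h)))

theorem unitAdjoin_inv (S : Set Aˣ) : unitAdjoin k S⁻¹ = unitAdjoin k S := by
  rw [unitAdjoin, unitAdjoin, inv_inv, Set.union_comm]

@[simp]
theorem coe_mem_unitAdjoin (h : g ∈ S) : (g : A) ∈ unitAdjoin k S :=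
  Algebra.subset_adjoin ⟨g, Or.inl h, rfl⟩

@[simp]
theorem inv_mem_unitAdjoin (h : g ∈ S) : (↑g⁻¹ : A) ∈ unitAdjoin k S :=
  Algebra.subset_adjoin ⟨g⁻¹, Or.inr (Set.inv_mem_inv.2 h), rfl⟩

theorem coe_mem_unitAdjoin_of_mem_closure (h : g ∈ Subgroup.closure S) :
    (g : A) ∈ unitAdjoin k S := by
  rw [← Subgroup.mem_toSubmonoid, Subgroup.closure_toSubmonoid] at h
  induction h using Submonoid.closure_induction with
  | mem x hx => exact Algebra.subset_adjoin ⟨x, hx, rfl⟩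
  | one => exact one_mem _
  | mul x y _ _ hx hy => exact mul_mem hx hy

theorem cubicSpan_le_unitAdjoin (h : g ∈ S) : cubicSpan k g ≤ (unitAdjoin k S).toSubmodule :=
  cubicSpan_le.2 ⟨(unitAdjoin k S).one_mem, coe_mem_unitAdjoin h, inv_mem_unitAdjoin h⟩

theorem mul_le_toSubmodule {T : Subalgebra k A} {L M : Submodule k A} (hL : L ≤ T.toSubmodule)
    (hM : M ≤ T.toSubmodule) : L * M ≤ T.toSubmodule :=
  (mul_le_mul' hL hM).trans_eq T.isIdempotentElem_toSubmodule.eq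

theorem cubicSpan_mul_mul_le_unitAdjoin {s t : Aˣ} (hs : s ∈ S) (ht : t ∈ S) :
    cubicSpan k s * cubicSpan k t * cubicSpan k s ≤ (unitAdjoin k S).toSubmodule :=
  mul_le_toSubmodule (mul_le_toSubmodule (cubicSpan_le_unitAdjoin hs) (cubicSpan_le_unitAdjoin ht))
    (cubicSpan_le_unitAdjoin hs)

theorem mul_mem_of_left_stable {P : Submodule k A}
    (h : ∀ g ∈ S, ∀ x ∈ P, (g : A) * x ∈ P ∧ (↑g⁻¹ : A) * x ∈ P)
    (hy : y ∈ unitAdjoin k S) (hx : x ∈ P) : y * x ∈ P := by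
  induction hy using Algebra.adjoin_induction generalizing x with
  | mem z hz =>
    obtain ⟨g, hg | hg, rfl⟩ := hz
    · exact (h g hg x hx).1
    · simpa only [inv_inv] using (h g⁻¹ hg x hx).2
  | algebraMap c => rw [← Algebra.smul_def]; exact smul_mem _ _ hx
  | add y z _ _ hy hz => rw [add_mul]; exact add_mem (hy hx) (hz hx)
  | mul y z _ _ hy hz => rw [mul_assoc]; exact hy (hz hx)

theorem IsCubic.toSubmodule_unitAdjoin_le {e : kˣ} {e₁ e₂ : k} (h : IsCubic e e₁ e₂ g) :
    (unitAdjoin k {g}).toSubmodule ≤ cubicSpan k g := by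
  intro y hy
  rw [← mul_one y]
  refine mul_mem_of_left_stable ?_ hy (one_mem_cubicSpan g)
  rintro _ rfl x hx
  exact ⟨h.mul_mem_cubicSpan (mem_cubicSpan _) hx, h.mul_mem_cubicSpan (inv_mem_cubicSpan _) hx⟩

theorem commute_of_mem_unitAdjoin (h : ∀ g ∈ S, Commute (g : A) z) (hy : y ∈ unitAdjoin k S) :
    Commute y z := by
  refine ((Subalgebra.mem_centralizer_iff k).1 (?_ : y ∈ Subalgebra.centralizer k {z}) z rfl).symm
  refine Algebra.adjoin_le ?_ hy
  rintro _ ⟨g, hg | hg, rfl⟩ _ rfl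
  · exact (h g hg).eq.symm
  · simpa only [inv_inv] using (h g⁻¹ hg).units_inv_left.eq.symm

theorem commute_of_mem_cubicSpan (h : Commute (g : A) z) (hy : y ∈ cubicSpan k g) :
    Commute y z :=
  commute_of_mem_unitAdjoin (S := {g}) (by simpa using h)
    (cubicSpan_le_unitAdjoin (Set.mem_singleton g) hy)

/-- Left stability of `B + v R` under a group of units need only be tested on `v`. -/
theorem mul_mem_sup_span_mul {R : Subalgebra k A} {B : Submodule k A} {v : A}
    (hS : ∀ x ∈ unitAdjoin k S, ∀ b ∈ B, x * b ∈ B) (hR : ∀ b ∈ B, ∀ y ∈ R, b * y ∈ B)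
    (hv : ∀ g ∈ S, (g : A) * v ∈ B ⊔ span k {v} * R.toSubmodule ∧
      (↑g⁻¹ : A) * v ∈ B ⊔ span k {v} * R.toSubmodule)
    (hx : x ∈ unitAdjoin k S) (hy : y ∈ B ⊔ span k {v} * R.toSubmodule) :
    x * y ∈ B ⊔ span k {v} * R.toSubmodule := by
  have right : ∀ z ∈ B ⊔ span k {v} * R.toSubmodule, ∀ y ∈ R,
      z * y ∈ B ⊔ span k {v} * R.toSubmodule := by
    intro z hz y hy
    obtain ⟨b, hb, u, hu, rfl⟩ := mem_sup.1 hz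
    obtain ⟨c, hc, rfl⟩ := mem_span_singleton_mul.1 hu
    rw [add_mul, mul_assoc]
    exact add_mem (mem_sup_left (hR b hb y hy))
      (mem_sup_right (mem_span_singleton_mul.2 ⟨c * y, R.mul_mem hc hy, rfl⟩))
  have left : ∀ z ∈ unitAdjoin k S, z * v ∈ B ⊔ span k {v} * R.toSubmodule →
      ∀ y ∈ B ⊔ span k {v} * R.toSubmodule, z * y ∈ B ⊔ span k {v} * R.toSubmodule := by
    intro z hz hzv y hy
    obtain ⟨b, hb, u, hu, rfl⟩ := mem_sup.1 hy
    obtain ⟨c, hc, rfl⟩ := mem_span_singleton_mul.1 hu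
    rw [mul_add, ← mul_assoc]
    exact add_mem (mem_sup_left (hS z hz b hb)) (right _ hzv c hc)
  exact mul_mem_of_left_stable (fun g hg y hy =>
    ⟨left g (coe_mem_unitAdjoin hg) (hv g hg).1 y hy,
      left _ (inv_mem_unitAdjoin hg) (hv g hg).2 y hy⟩) hx hy

theorem mul_mem_sup_span_of_unitCongr {B : Submodule k A} {v : A}
    (hS : ∀ x ∈ unitAdjoin k S, ∀ b ∈ B, x * b ∈ B) (hv : ∀ g ∈ S, UnitCongr B (g * v) v)
    (hx : x ∈ unitAdjoin k S) (hy : y ∈ B ⊔ span k {v}) : x * y ∈ B ⊔ span k {v} := by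
  have hvB : v ∈ B ⊔ span k {v} := mem_sup_right (mem_span_singleton_self v)
  have bot : B ⊔ span k {v} * (⊥ : Subalgebra k A).toSubmodule = B ⊔ span k {v} := by
    rw [Algebra.toSubmodule_bot, mul_one]
  rw [← bot] at hy ⊢
  refine mul_mem_sup_span_mul hS ?_ (fun g hg => ?_) hx hy
  · rintro b hb _ ⟨c, rfl⟩
    change b * algebraMap k A c ∈ B
    rw [← Algebra.commutes, ← Algebra.smul_def]
    exact smul_mem B c hb
  · rw [bot]
    have inv := (hv g hg).inv_mul (hS _ (inv_mem_unitAdjoin hg))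
    exact ⟨((hv g hg).mem_iff le_sup_left).2 hvB, (inv.mem_iff le_sup_left).2 hvB⟩

end UnitAdjoin

section WordFilt

variable {k A : Type*} [CommRing k] [Ring A] [Algebra k A] {S : Subalgebra k A} {t : Aˣ}
  {m n : ℕ} {x y : A}

/-- The span of the words having at most `n` letters `t` or `t⁻¹` and all others in `S`. -/
def wordFilt (S : Subalgebra k A) (t : Aˣ) (n : ℕ) : Submodule k A :=
  S.toSubmodule * (cubicSpan k t * S.toSubmodule) ^ n

@[simp]
theorem wordFilt_zero : wordFilt S t 0 = S.toSubmodule := by rw [wordFilt, pow_zero, mul_one]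

theorem wordFilt_mul_toSubmodule : wordFilt S t n * S.toSubmodule = wordFilt S t n := by
  cases n with
  | zero => simp only [wordFilt_zero, S.isIdempotentElem_toSubmodule.eq]
  | succ n => simp only [wordFilt, pow_succ, mul_assoc, S.isIdempotentElem_toSubmodule.eq]

theorem wordFilt_mul : wordFilt S t m * wordFilt S t n = wordFilt S t (m + n) := by
  rw [wordFilt.eq_1 S t n, ← mul_assoc, wordFilt_mul_toSubmodule, wordFilt, wordFilt, pow_add,
    mul_assoc]

theorem wordFilt_succ :
    wordFilt S t (n + 1) = wordFilt S t n * cubicSpan k t * S.toSubmodule := by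
  simp only [wordFilt, pow_succ, mul_assoc]

theorem wordFilt_one :
    wordFilt S t 1 = S.toSubmodule * cubicSpan k t * S.toSubmodule := by
  rw [wordFilt_succ, wordFilt_zero]

theorem fg_wordFilt (h : S.toSubmodule.FG) (n : ℕ) : (wordFilt S t n).FG := by
  induction n with
  | zero => rwa [wordFilt_zero]
  | succ n ih => rw [wordFilt_succ]; exact (ih.mul (fg_cubicSpan t)).mul h

theorem wordFilt_inv : wordFilt S t⁻¹ n = wordFilt S t n := by
  rw [wordFilt, wordFilt, cubicSpan_inv]

theorem mul_mem_wordFilt (hx : x ∈ wordFilt S t m) (hy : y ∈ wordFilt S t n) :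
    x * y ∈ wordFilt S t (m + n) :=
  wordFilt_mul.le (mul_mem_mul hx hy)

theorem left_mul_mem_wordFilt (hx : x ∈ S) (hy : y ∈ wordFilt S t n) :
    x * y ∈ wordFilt S t n := by
  simpa only [zero_add] using mul_mem_wordFilt (m := 0) (wordFilt_zero.ge hx) hy

theorem right_mul_mem_wordFilt (hx : x ∈ wordFilt S t n) (hy : y ∈ S) :
    x * y ∈ wordFilt S t n :=
  wordFilt_mul_toSubmodule.le (mul_mem_mul hx hy)

theorem cubicSpan_le_wordFilt : cubicSpan k t ≤ wordFilt S t 1 := fun x hx => by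
  simpa only [one_mul, mul_one, wordFilt_one] using
    mul_mem_mul (mul_mem_mul (M := S.toSubmodule) S.one_mem hx) (N := S.toSubmodule) S.one_mem

theorem wordFilt_le_succ : wordFilt S t n ≤ wordFilt S t (n + 1) := fun x hx => by
  simpa only [mul_one] using
    mul_mem_wordFilt hx (cubicSpan_le_wordFilt (S := S) (one_mem_cubicSpan t))

end WordFilt

section Opposite

variable {k A : Type*} [CommRing k] [Ring A] [Algebra k A]

/-- A unit, viewed in the opposite ring. -/
def opUnit (s : Aˣ) : Aᵐᵒᵖˣ := Units.opEquiv.symm (op s)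

@[simp] theorem val_opUnit (s : Aˣ) : ((opUnit s : Aᵐᵒᵖˣ) : Aᵐᵒᵖ) = op (s : A) := rfl

theorem opUnit_mul (s t : Aˣ) : opUnit (s * t) = opUnit t * opUnit s := rfl

theorem opUnit_inv (s : Aˣ) : opUnit s⁻¹ = (opUnit s)⁻¹ := rfl

/-- A submodule, viewed in the opposite ring. -/
def opSubmodule (P : Submodule k A) : Submodule k Aᵐᵒᵖ :=
  P.map (opLinearEquiv k : A ≃ₗ[k] Aᵐᵒᵖ).toLinearMap

variable {P X : Submodule k A} {x y z : A}

theorem op_mem_opSubmodule : op x ∈ opSubmodule P ↔ x ∈ P :=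
  mem_map_equiv P (e := opLinearEquiv k)

theorem opSubmodule_mul (M N : Submodule k A) :
    opSubmodule (M * N) = opSubmodule N * opSubmodule M :=
  map_op_mul M N

theorem opSubmodule_pow (M : Submodule k A) (n : ℕ) :
    opSubmodule (M ^ n) = opSubmodule M ^ n :=
  map_op_pow M n

theorem opSubmodule_le_between :
    opSubmodule X ≤ between (opSubmodule P) (op z) (op x) ↔ X ≤ between P x z := by
  simp only [opSubmodule, map_le_iff_le_comap]
  refine forall₂_congr fun y _ => ?_
  change op z * op y * op x ∈ opSubmodule P ↔ _
  rw [← op_mul, ← op_mul, op_mem_opSubmodule, mem_between, mul_assoc]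

theorem unitCongr_op : UnitCongr (opSubmodule P) (op x) (op y) ↔ UnitCongr P x y := by
  simp only [UnitCongr, ← op_smul, ← op_sub, op_mem_opSubmodule]

theorem opSubmodule_cubicSpan (s : Aˣ) :
    opSubmodule (cubicSpan k s) = cubicSpan k (opUnit s) := by
  rw [opSubmodule, cubicSpan, cubicSpan, map_span]
  simp [Set.image_insert_eq, ← opUnit_inv]

theorem op_unitAdjoin (S : Set Aˣ) : (unitAdjoin k S).op = unitAdjoin k (opUnit '' S) := by
  rw [unitAdjoin, unitAdjoin, Subalgebra.op_adjoin]
  congr 1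
  ext x
  simp only [Set.mem_preimage, Set.mem_image, Set.mem_union, Set.mem_inv]
  constructor
  · rintro ⟨g, hg, hgx⟩
    refine ⟨opUnit g, hg.imp (fun h => ⟨g, h, rfl⟩) (fun h => ⟨g⁻¹, h, rfl⟩), ?_⟩
    rw [val_opUnit, hgx, op_unop]
  · rintro ⟨w, ⟨g, hg, rfl⟩ | ⟨g, hg, hgw⟩, rfl⟩
    · exact ⟨g, Or.inl hg, rfl⟩
    · obtain rfl : w = (opUnit g)⁻¹ := by rw [hgw, inv_inv]
      exact ⟨g⁻¹, Or.inr (by rwa [inv_inv]), rfl⟩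

theorem opSubmodule_toSubmodule (S : Subalgebra k A) :
    opSubmodule S.toSubmodule = S.op.toSubmodule := by
  ext x
  obtain ⟨x, rfl⟩ := op_surjective x
  rw [op_mem_opSubmodule]
  rfl

theorem opSubmodule_wordFilt (S : Subalgebra k A) (t : Aˣ) (n : ℕ) :
    opSubmodule (wordFilt S t n) = wordFilt S.op (opUnit t) n := by
  simp only [wordFilt, opSubmodule_mul, opSubmodule_pow, opSubmodule_toSubmodule,
    opSubmodule_cubicSpan, mul_pow_mul]

theorem IsCubic.op {e : kˣ} {e₁ e₂ : k} {s : Aˣ} (h : IsCubic e e₁ e₂ s) :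
    IsCubic e e₁ e₂ (opUnit s) := by
  simpa only [IsCubic, ← opUnit_inv, ← opUnit_mul, val_opUnit, op_add, op_sub, op_smul, op_one]
    using congrArg MulOpposite.op h

end Opposite

/-- Two units satisfying the braid relation, the cubic relation and the relation of `Q₃`, the
latter with `q` in place of `a`. -/
structure SkeinPair {k A : Type*} [CommRing k] [Ring A] [Algebra k A] (q e : kˣ) (e₁ e₂ : k)
    (s t : Aˣ) : Prop where
  braid : s * t * s = t * s * t
  cubic_left : IsCubic e e₁ e₂ s
  cubic_right : IsCubic e e₁ e₂ t
  skein : ((s⁻¹ * t * s : Aˣ) : A) =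
    ((s * t * s⁻¹ : Aˣ) : A) - (↑q⁻¹ : k) • ((s * t : Aˣ) : A) + (q : k) • ((s * t⁻¹ : Aˣ) : A)
      + (q : k) • ((s⁻¹ * t : Aˣ) : A) - (q : k) ^ 3 • ((s⁻¹ * t⁻¹ : Aˣ) : A)
      + (↑q⁻¹ : k) • ((t * s : Aˣ) : A) - (q : k) • ((t * s⁻¹ : Aˣ) : A)
      - (q : k) • ((t⁻¹ * s : Aˣ) : A) + (q : k) ^ 3 • ((t⁻¹ * s⁻¹ : Aˣ) : A)
      + (q : k) ^ 2 • ((s⁻¹ * t⁻¹ * s : Aˣ) : A) - (q : k) ^ 2 • ((s * t⁻¹ * s⁻¹ : Aˣ) : A)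

/-- The element `t s² t`. For Artin generators `s = s₁` and `t = s₂` it is the Jucys–Murphy
element of the braid group on three strands. -/
def murphy₃ {A : Type*} [Monoid A] (s t : Aˣ) : Aˣ := t * s * s * t

theorem murphy₃_inv {A : Type*} [Monoid A] (s t : Aˣ) : murphy₃ s⁻¹ t⁻¹ = (murphy₃ s t)⁻¹ := by
  simp only [murphy₃, mul_inv_rev, mul_assoc]

section Spans

variable {k A : Type*} [CommRing k] [Ring A] [Algebra k A] {P : Submodule k A} {s t : Aˣ}

theorem murphy₃_op (s t : Aˣ) : murphy₃ (opUnit s) (opUnit t) = opUnit (murphy₃ s t) := by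
  simp only [murphy₃, ← opUnit_mul, mul_assoc]

@[simp]
theorem murphy₃_mem_unitAdjoin {S : Set Aˣ} (hs : s ∈ S) (ht : t ∈ S) :
    (murphy₃ s t : A) ∈ unitAdjoin k S := by
  simp only [murphy₃, Units.val_mul]
  exact mul_mem (mul_mem (mul_mem (coe_mem_unitAdjoin ht) (coe_mem_unitAdjoin hs))
    (coe_mem_unitAdjoin hs)) (coe_mem_unitAdjoin ht)

@[simp]
theorem murphy₃_inv_mem_unitAdjoin {S : Set Aˣ} (hs : s ∈ S) (ht : t ∈ S) :
    (↑(murphy₃ s t)⁻¹ : A) ∈ unitAdjoin k S := by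
  rw [← murphy₃_inv, ← unitAdjoin_inv]
  exact murphy₃_mem_unitAdjoin (Set.inv_mem_inv.2 hs) (Set.inv_mem_inv.2 ht)

/-- The span of the words `s ^ i * t ^ j * s ^ l`. -/
def wordSpan (k : Type*) {A : Type*} [CommRing k] [Ring A] [Algebra k A] (s t : Aˣ) :
    Submodule k A :=
  cubicSpan k s * cubicSpan k t * cubicSpan k s

/-- The span of the words `s ^ i * t ^ j * s ^ l` and of `t s² t`. It is the whole algebra
generated by a skein pair. -/
def pairSpan (k : Type*) {A : Type*} [CommRing k] [Ring A] [Algebra k A] (s t : Aˣ) :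
    Submodule k A :=
  wordSpan k s t ⊔ span k {(murphy₃ s t : A)}

theorem wordSpan_inv (s t : Aˣ) : wordSpan k s⁻¹ t⁻¹ = wordSpan k s t := by
  simp only [wordSpan, cubicSpan_inv]

theorem opSubmodule_wordSpan (s t : Aˣ) :
    opSubmodule (wordSpan k s t) = wordSpan k (opUnit s) (opUnit t) := by
  simp only [wordSpan, opSubmodule_mul, opSubmodule_cubicSpan, mul_assoc]

theorem mul_mem_wordSpan_left {x y : A} (hx : x ∈ cubicSpan k s) (hy : y ∈ cubicSpan k t) :
    x * y ∈ wordSpan k s t := by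
  simpa only [wordSpan, mul_one] using mul_mem_mul (mul_mem_mul hx hy) (one_mem_cubicSpan s)

theorem mul_mem_wordSpan_right {x y : A} (hy : y ∈ cubicSpan k t) (hx : x ∈ cubicSpan k s) :
    y * x ∈ wordSpan k s t := by
  simpa only [wordSpan, one_mul] using mul_mem_mul (mul_mem_mul (one_mem_cubicSpan s) hy) hx

theorem wordSpan_le_pairSpan : wordSpan k s t ≤ pairSpan k s t := le_sup_left

theorem murphy₃_mem_pairSpan : (murphy₃ s t : A) ∈ pairSpan k s t :=
  mem_sup_right (mem_span_singleton_self _)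

theorem pairSpan_le (h : wordSpan k s t ≤ P) (h' : (murphy₃ s t : A) ∈ P) :
    pairSpan k s t ≤ P :=
  sup_le h ((span_singleton_le_iff_mem _ _).2 h')

end Spans

namespace SkeinPair

variable {k A : Type*} [CommRing k] [Ring A] [Algebra k A] {q e : kˣ} {e₁ e₂ : k} {s t : Aˣ}
  {x y : A}

theorem conj (h : SkeinPair q e e₁ e₂ s t) (g : Aˣ) :
    SkeinPair q e e₁ e₂ (g * s * g⁻¹) (g * t * g⁻¹) := by
  refine ⟨?_, h.cubic_left.conj g, h.cubic_right.conj g, ?_⟩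
  · simpa only [mul_assoc, inv_mul_cancel_left] using congrArg (fun x => g * x * g⁻¹) h.braid
  · have h' := congrArg (fun x => (g : A) * x * (↑g⁻¹ : A)) h.skein
    simp only [mul_add, add_mul, mul_sub, sub_mul, mul_smul_comm, smul_mul_assoc,
      ← Units.val_mul] at h'
    simpa only [mul_inv_rev, inv_inv, mul_assoc, inv_mul_cancel_left] using h'

/-- The braid `r * s * t` conjugates `r` and `s` to `s` and `t`. -/
theorem shift {r : Aˣ} (h : SkeinPair q e e₁ e₂ r s) (b : s * t * s = t * s * t)
    (c : Commute r t) : SkeinPair q e e₁ e₂ s t := by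
  have conj_left : r * s * t * r * (r * s * t)⁻¹ = s := by
    rw [mul_inv_eq_iff_eq_mul, mul_assoc _ t r, ← c.eq, ← mul_assoc, h.braid]
    simp only [mul_assoc]
  have conj_right : r * s * t * s * (r * s * t)⁻¹ = t := by
    rw [mul_inv_eq_iff_eq_mul, mul_assoc r, mul_assoc r, b, ← mul_assoc, ← mul_assoc, c.eq]
    simp only [mul_assoc]
  simpa only [conj_left, conj_right] using h.conj (r * s * t)

theorem symm (h : SkeinPair q e e₁ e₂ s t) : SkeinPair q e e₁ e₂ t s := by
  have conj_left : s * t * s * s * (s * t * s)⁻¹ = t := by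
    rw [mul_inv_eq_iff_eq_mul]
    nth_rw 1 [h.braid]
    simp only [mul_assoc]
  have conj_right : s * t * s * t * (s * t * s)⁻¹ = s := by
    rw [mul_inv_eq_iff_eq_mul]
    nth_rw 2 [h.braid]
    simp only [mul_assoc]
  simpa only [conj_left, conj_right] using h.conj (s * t * s)

theorem inv (h : SkeinPair q e e₁ e₂ s t) :
    SkeinPair q⁻¹ e⁻¹ (↑e⁻¹ * e₂) (↑e⁻¹ * e₁) s⁻¹ t⁻¹ := by
  refine ⟨braid_inv h.braid, h.cubic_left.inv, h.cubic_right.inv, ?_⟩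
  have scaled := congrArg (fun x => (↑q⁻¹ : k) ^ 2 • x) h.skein
  have q₁ : (↑q⁻¹ : k) ^ 2 * q = ↑q⁻¹ := by rw [pow_two, mul_assoc, Units.inv_mul, mul_one]
  have q₂ : (↑q⁻¹ : k) ^ 2 * q ^ 2 = 1 := by rw [← mul_pow, Units.inv_mul, one_pow]
  have q₃ : (↑q⁻¹ : k) ^ 2 * q ^ 3 = q := by rw [pow_succ (q : k) 2, ← mul_assoc, q₂, one_mul]
  have q₄ : (↑q⁻¹ : k) ^ 2 * ↑q⁻¹ = ↑q⁻¹ ^ 3 := (pow_succ _ 2).symm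
  simp only [smul_add, smul_sub, smul_smul, q₁, q₂, q₃, q₄, one_smul] at scaled
  simp only [inv_inv]
  rw [← sub_eq_zero] at scaled ⊢
  rw [← scaled]
  abel

theorem op (h : SkeinPair q e e₁ e₂ s t) : SkeinPair q e e₁ e₂ (opUnit s) (opUnit t) := by
  refine ⟨by simp only [← opUnit_mul, ← mul_assoc, h.braid], h.cubic_left.op,
    h.cubic_right.op, ?_⟩
  have h' := congrArg MulOpposite.op h.skein
  simp only [op_add, op_sub, op_smul] at h'
  simp only [← opUnit_inv, ← opUnit_mul, val_opUnit, ← mul_assoc]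
  rw [← sub_eq_zero] at h' ⊢
  rw [← neg_eq_zero, ← h']
  abel

theorem mem_wordSpan (h : SkeinPair q e e₁ e₂ s t) {g : Aˣ} (i j l : ℤ)
    (hg : g = s ^ i * t ^ j * s ^ l) : (g : A) ∈ wordSpan k s t := by
  rw [hg, Units.val_mul, Units.val_mul]
  exact mul_mem_mul (mul_mem_mul (h.cubic_left.zpow_mem_cubicSpan i)
    (h.cubic_right.zpow_mem_cubicSpan j)) (h.cubic_left.zpow_mem_cubicSpan l)

theorem mul_mem_wordSpan (h : SkeinPair q e e₁ e₂ s t) (hx : x ∈ cubicSpan k s)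
    (hy : y ∈ wordSpan k s t) : x * y ∈ wordSpan k s t := by
  suffices cubicSpan k s * wordSpan k s t ≤ wordSpan k s t from this (mul_mem_mul hx hy)
  rw [wordSpan, ← mul_assoc, ← mul_assoc]
  gcongr
  exact h.cubic_left.cubicSpan_mul_self_le

theorem wordSpan_mul_mem (h : SkeinPair q e e₁ e₂ s t) (hx : x ∈ wordSpan k s t)
    (hy : y ∈ cubicSpan k s) : x * y ∈ wordSpan k s t := by
  suffices wordSpan k s t * cubicSpan k s ≤ wordSpan k s t from this (mul_mem_mul hx hy)
  rw [wordSpan, mul_assoc]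
  gcongr
  exact h.cubic_left.cubicSpan_mul_self_le

/-- Multiply the skein relation by `t` on the left: by the braid relation all terms other than
`t s⁻¹ t s` and `t s⁻¹ t` become words `s ^ i * t ^ j * s ^ l`. -/
theorem unitCongr_word_mul (h : SkeinPair q e e₁ e₂ s t) :
    UnitCongr (wordSpan k s t) ((t * s⁻¹ * t * s : Aˣ) : A) ((t * s⁻¹ * t : Aˣ) : A) := by
  refine ⟨q, ?_⟩
  have b := h.braid
  have w₁ := h.mem_wordSpan (g := t * (s * t * s⁻¹)) 1 1 0 (by
    rw [← mul_assoc, ← mul_assoc, ← b]; group)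
  have w₂ := h.mem_wordSpan (g := t * (s * t)) 1 1 1 (by rw [← mul_assoc, ← b]; group)
  have w₃ := h.mem_wordSpan (g := t * (s * t⁻¹)) (-1) 1 1 (by
    rw [← mul_assoc, ← braid_inv_conj b]; group)
  have w₅ := h.mem_wordSpan (g := t * (s⁻¹ * t⁻¹)) (-1) (-1) 1 (by
    rw [← mul_assoc, ← braid_inv_conj_inv b]; group)
  have w₆ := h.mem_wordSpan (g := t * (t * s)) 0 2 1 (by simp [mul_assoc, pow_two, zpow_ofNat])
  have w₇ := h.mem_wordSpan (g := t * (t * s⁻¹)) 0 2 (-1) (by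
    simp [mul_assoc, pow_two, zpow_ofNat])
  have w₈ := h.mem_wordSpan (g := t * (t⁻¹ * s)) 0 0 1 (by group)
  have w₉ := h.mem_wordSpan (g := t * (t⁻¹ * s⁻¹)) 0 0 (-1) (by group)
  have w₁₀ := h.mem_wordSpan (g := t * (s⁻¹ * t⁻¹ * s)) (-1) (-1) 2 (by
    rw [← mul_assoc, ← mul_assoc, ← braid_inv_conj_inv b]; simp [mul_assoc, pow_two, zpow_ofNat])
  have w₁₁ := h.mem_wordSpan (g := t * (s * t⁻¹ * s⁻¹)) (-1) 1 0 (by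
    rw [← mul_assoc, ← mul_assoc, ← braid_inv_conj b]; group)
  have skein := congrArg (fun x => (t : A) * x) h.skein
  simp only [mul_add, mul_sub, mul_smul_comm, ← Units.val_mul] at skein
  rw [show t * s⁻¹ * t * s = t * (s⁻¹ * t * s) by group,
    show t * s⁻¹ * t = t * (s⁻¹ * t) by group, skein]
  convert sub_mem (add_mem (add_mem (sub_mem (sub_mem (add_mem (sub_mem (add_mem (sub_mem w₁
    (smul_mem _ (↑q⁻¹ : k) w₂)) (smul_mem _ (q : k) w₃)) (smul_mem _ ((q : k) ^ 3) w₅))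
    (smul_mem _ (↑q⁻¹ : k) w₆)) (smul_mem _ (q : k) w₇)) (smul_mem _ (q : k) w₈))
    (smul_mem _ ((q : k) ^ 3) w₉)) (smul_mem _ ((q : k) ^ 2) w₁₀))
    (smul_mem _ ((q : k) ^ 2) w₁₁) using 1
  abel

theorem unitCongr_murphy₃_word (h : SkeinPair q e e₁ e₂ s t) :
    UnitCongr (wordSpan k s t) (murphy₃ s t : A) ((t * s⁻¹ * t : Aˣ) : A) := by
  have cubic := congrArg (fun x => (t : A) * x * t) h.cubic_left
  simp only [mul_add, mul_sub, mul_smul_comm, add_mul, sub_mul, smul_mul_assoc, mul_one,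
    ← Units.val_mul] at cubic
  rw [← mul_assoc] at cubic
  refine ⟨e, ?_⟩
  rw [murphy₃, cubic]
  have w₁ := h.mem_wordSpan (g := t * s * t) 1 1 1 (by rw [← h.braid]; group)
  have w₂ := h.mem_wordSpan (g := t * t) 0 2 0 (by simp [pow_two, zpow_ofNat])
  convert sub_mem (smul_mem _ e₁ w₁) (smul_mem _ e₂ w₂) using 1
  abel

theorem unitCongr_inv_word (h : SkeinPair q e e₁ e₂ s t) :
    UnitCongr (wordSpan k s t) ((t⁻¹ * s * t⁻¹ : Aˣ) : A) (murphy₃ s t : A) := by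
  refine .trans ?_ h.unitCongr_murphy₃_word.symm
  refine .trans (.symm ⟨e, ?_⟩) h.unitCongr_word_mul
  have cubic := congrArg (fun x => (x * (s : A) * (↑t⁻¹ : A))) h.cubic_right
  simp only [add_mul, sub_mul, smul_mul_assoc, one_mul, ← Units.val_mul] at cubic
  have shift : t * t * s * t⁻¹ = t * s⁻¹ * t * s := by
    rw [mul_assoc, mul_assoc, ← mul_assoc t s, ← braid_inv_conj h.braid]; group
  have w₁ := h.mem_wordSpan (g := t * s * t⁻¹) (-1) 1 1 (by rw [← braid_inv_conj h.braid]; group)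
  have w₂ := h.mem_wordSpan (g := s * t⁻¹) 1 (-1) 0 (by group)
  rw [← shift, cubic]
  convert sub_mem (smul_mem _ e₁ w₁) (smul_mem _ e₂ w₂) using 1
  abel

theorem unitCongr_murphy₃_mul (h : SkeinPair q e e₁ e₂ s t) :
    UnitCongr (wordSpan k s t) ((murphy₃ s t : A) * s) (murphy₃ s t) := by
  have word := h.unitCongr_word_mul
  rw [Units.val_mul] at word
  exact ((h.unitCongr_murphy₃_word.mul_right fun z hz => h.wordSpan_mul_mem hz
    (mem_cubicSpan s)).trans word).trans h.unitCongr_murphy₃_word.symm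

theorem unitCongr_murphy₃_mul_inv (h : SkeinPair q e e₁ e₂ s t) :
    UnitCongr (wordSpan k s t) ((murphy₃ s t : A) * (↑s⁻¹ : A)) (murphy₃ s t) := by
  simpa only [Units.mul_inv_cancel_right] using
    (h.unitCongr_murphy₃_mul.mul_right fun z hz => h.wordSpan_mul_mem hz
      (inv_mem_cubicSpan s)).symm

theorem unitCongr_mul_murphy₃ (h : SkeinPair q e e₁ e₂ s t) :
    UnitCongr (wordSpan k s t) ((s : A) * murphy₃ s t) (murphy₃ s t) := by
  have dual := h.op.unitCongr_murphy₃_mul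
  rwa [murphy₃_op, ← opSubmodule_wordSpan, val_opUnit, val_opUnit, ← op_mul, unitCongr_op] at dual

theorem unitCongr_murphy₃_inv (h : SkeinPair q e e₁ e₂ s t) :
    UnitCongr (wordSpan k s t) (↑(murphy₃ s t)⁻¹ : A) (murphy₃ s t) := by
  have inv := h.inv.unitCongr_murphy₃_word
  rw [wordSpan_inv, murphy₃_inv, inv_inv] at inv
  exact inv.trans h.unitCongr_inv_word

theorem pairSpan_inv (h : SkeinPair q e e₁ e₂ s t) : pairSpan k s⁻¹ t⁻¹ = pairSpan k s t := by
  have le : ∀ {s t : Aˣ} {q e : kˣ} {e₁ e₂ : k}, SkeinPair q e e₁ e₂ s t →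
      pairSpan k s⁻¹ t⁻¹ ≤ pairSpan k s t := fun h => by
    refine pairSpan_le ((wordSpan_inv _ _).trans_le wordSpan_le_pairSpan) ?_
    rw [murphy₃_inv]
    exact (h.unitCongr_murphy₃_inv.mem_iff wordSpan_le_pairSpan).2 murphy₃_mem_pairSpan
  exact le_antisymm (le h) (by simpa only [inv_inv] using le h.inv)

theorem mul_mem_pairSpan (h : SkeinPair q e e₁ e₂ s t) (hx : x ∈ cubicSpan k s)
    (hy : y ∈ pairSpan k s t) : x * y ∈ pairSpan k s t :=
  mul_mem_sup_span_of_unitCongr (S := {s})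
    (fun _ hx _ hy => h.mul_mem_wordSpan (h.cubic_left.toSubmodule_unitAdjoin_le hx) hy)
    (by rintro _ rfl; exact h.unitCongr_mul_murphy₃)
    (cubicSpan_le_unitAdjoin (Set.mem_singleton s) hx) hy

theorem opSubmodule_pairSpan (s t : Aˣ) :
    opSubmodule (pairSpan k s t) = pairSpan k (opUnit s) (opUnit t) := by
  rw [pairSpan, pairSpan, ← opSubmodule_wordSpan, murphy₃_op, opSubmodule, Submodule.map_sup,
    map_span, Set.image_singleton]
  rfl

theorem pairSpan_mul_mem (h : SkeinPair q e e₁ e₂ s t) (hx : x ∈ pairSpan k s t)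
    (hy : y ∈ cubicSpan k s) : x * y ∈ pairSpan k s t := by
  rw [← op_mem_opSubmodule] at hx hy ⊢
  rw [opSubmodule_pairSpan] at hx ⊢
  rw [opSubmodule_cubicSpan] at hy
  exact h.op.mul_mem_pairSpan hy hx

theorem cubicSpan_le_between_inv (h : SkeinPair q e e₁ e₂ s t) :
    cubicSpan k s ≤ between (wordSpan k s t) (↑t⁻¹ : A) t := by
  refine cubicSpan_le.2 ⟨?_, ?_, ?_⟩ <;> rw [mem_between]
  · exact h.mem_wordSpan (g := t⁻¹ * 1 * t) 0 0 0 (by group)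
  · exact h.mem_wordSpan (g := t⁻¹ * s * t) 1 1 (-1) (by
      rw [← braid_conj h.braid]; group)
  · exact h.mem_wordSpan (g := t⁻¹ * s⁻¹ * t) 1 (-1) (-1) (by
      rw [← braid_conj_inv h.braid]; group)

theorem cubicSpan_le_between (h : SkeinPair q e e₁ e₂ s t) :
    cubicSpan k s ≤ between (pairSpan k s t) t t := by
  refine cubicSpan_le.2 ⟨?_, ?_, ?_⟩ <;> rw [mem_between]
  · exact wordSpan_le_pairSpan (h.mem_wordSpan (g := t * 1 * t) 0 2 0 (by
      simp [pow_two, zpow_ofNat]))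
  · exact wordSpan_le_pairSpan (h.mem_wordSpan (g := t * s * t) 1 1 1 (by
      rw [← h.braid]; group))
  · exact (h.unitCongr_murphy₃_word.mem_iff wordSpan_le_pairSpan).1 murphy₃_mem_pairSpan

theorem alternating_le_pairSpan (h : SkeinPair q e e₁ e₂ s t) :
    cubicSpan k t * cubicSpan k s * cubicSpan k t ≤ pairSpan k s t := by
  have inv_between : cubicSpan k s ≤ between (wordSpan k s t) t (↑t⁻¹ : A) := by
    simpa only [wordSpan_inv, cubicSpan_inv, inv_inv] using h.inv.cubicSpan_le_between_inv
  have inv_between_inv : cubicSpan k s ≤ between (pairSpan k s t) (↑t⁻¹ : A) (↑t⁻¹ : A) := by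
    simpa only [h.pairSpan_inv, cubicSpan_inv] using h.inv.cubicSpan_le_between
  have right : ∀ z ∈ cubicSpan k t, ∀ y ∈ cubicSpan k s, y * z ∈ pairSpan k s t :=
    fun _ hz _ hy => wordSpan_le_pairSpan (mul_mem_wordSpan_left hy hz)
  have left : ∀ z ∈ cubicSpan k t, ∀ y ∈ cubicSpan k s, z * y ∈ pairSpan k s t :=
    fun _ hz _ hy => wordSpan_le_pairSpan (mul_mem_wordSpan_right hz hy)
  exact cubicSpan_mul_mul_cubicSpan_le
    (fun y hy => by simpa only [mul_one] using right 1 (one_mem_cubicSpan t) y hy)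
    (right _ (mem_cubicSpan t)) (right _ (inv_mem_cubicSpan t))
    (left _ (mem_cubicSpan t)) (left _ (inv_mem_cubicSpan t))
    h.cubicSpan_le_between (fun y hy => wordSpan_le_pairSpan (inv_between hy))
    (fun y hy => wordSpan_le_pairSpan (h.cubicSpan_le_between_inv hy)) inv_between_inv

theorem murphy₃_mem_alternating (h : SkeinPair q e e₁ e₂ s t) :
    (murphy₃ s t : A) ∈ cubicSpan k t * cubicSpan k s * cubicSpan k t := by
  simp only [murphy₃, Units.val_mul]
  rw [mul_assoc (t : A)]
  exact mul_mem_mul (mul_mem_mul (mem_cubicSpan t) h.cubic_left.sq_mem_cubicSpan)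
    (mem_cubicSpan t)

theorem right_gen_mul_mem_pairSpan (h : SkeinPair q e e₁ e₂ s t) (hx : x ∈ cubicSpan k t)
    (hy : y ∈ pairSpan k s t) : x * y ∈ pairSpan k s t := by
  suffices pairSpan k s t ≤ between (pairSpan k s t) x 1 from mem_between_one_right.1 (this hy)
  refine pairSpan_le (mul_mul_le.2 fun a ha b hb c hc => ?_) ?_ <;> rw [mem_between_one_right]
  · rw [← mul_assoc, ← mul_assoc]
    exact h.pairSpan_mul_mem (h.alternating_le_pairSpan (mul_mem_mul (mul_mem_mul hx ha) hb)) hc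
  · have : cubicSpan k t * (cubicSpan k t * cubicSpan k s * cubicSpan k t) ≤ pairSpan k s t := by
      rw [← mul_assoc, ← mul_assoc]
      refine le_trans ?_ h.alternating_le_pairSpan
      gcongr
      exact h.cubic_right.cubicSpan_mul_self_le
    exact this (mul_mem_mul hx h.murphy₃_mem_alternating)

theorem unitAdjoin_le_pairSpan (h : SkeinPair q e e₁ e₂ s t) :
    (unitAdjoin k {s, t}).toSubmodule ≤ pairSpan k s t := by
  intro y hy
  rw [← mul_one y]
  refine mul_mem_of_left_stable ?_ hy
    (wordSpan_le_pairSpan (h.mem_wordSpan (g := 1) 0 0 0 (by group)))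
  rintro g (rfl | rfl) x hx
  · exact ⟨h.mul_mem_pairSpan (mem_cubicSpan _) hx, h.mul_mem_pairSpan (inv_mem_cubicSpan _) hx⟩
  · exact ⟨h.right_gen_mul_mem_pairSpan (mem_cubicSpan _) hx,
      h.right_gen_mul_mem_pairSpan (inv_mem_cubicSpan _) hx⟩

theorem unitAdjoin_eq_pairSpan (h : SkeinPair q e e₁ e₂ s t) :
    (unitAdjoin k {s, t}).toSubmodule = pairSpan k s t :=
  le_antisymm h.unitAdjoin_le_pairSpan
    (pairSpan_le (cubicSpan_mul_mul_le_unitAdjoin (by simp) (by simp)) (by simp))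

theorem fg_unitAdjoin (h : SkeinPair q e e₁ e₂ s t) :
    (unitAdjoin k {s, t}).toSubmodule.FG := by
  rw [h.unitAdjoin_eq_pairSpan]
  exact (((fg_cubicSpan s).mul (fg_cubicSpan t)).mul (fg_cubicSpan s)).sup (fg_span_singleton _)

end SkeinPair

/-- The element `t s r² s t`, the next Jucys–Murphy element after `murphy₃ r s`. -/
def murphy₄ {A : Type*} [Monoid A] (r s t : Aˣ) : Aˣ := t * murphy₃ r s * t

section Murphy

variable {A : Type*} [Monoid A] {r s t : Aˣ}

theorem murphy₄_inv (r s t : Aˣ) : murphy₄ r⁻¹ s⁻¹ t⁻¹ = (murphy₄ r s t)⁻¹ := by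
  simp only [murphy₄, murphy₃_inv, mul_inv_rev, mul_assoc]

theorem commute_left_murphy₃ (h : r * s * r = s * r * s) : Commute r (murphy₃ r s) := by
  change r * (s * r * r * s) = s * r * r * s * r
  calc r * (s * r * r * s) = r * s * r * (r * s) := by simp only [mul_assoc]
    _ = s * r * (s * r * s) := by rw [h]; simp only [mul_assoc]
    _ = s * r * r * s * r := by rw [← h]; simp only [mul_assoc]

theorem commute_left_murphy₄ (h : r * s * r = s * r * s) (c : Commute r t) :
    Commute r (murphy₄ r s t) :=
  (c.mul_right (commute_left_murphy₃ h)).mul_right c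

theorem commute_sandwich_sandwich (h : s * t * s = t * s * t) (c : Commute r t) :
    Commute s (t * (s * r * s) * t) := by
  calc s * (t * (s * r * s) * t) = s * t * s * (r * s * t) := by simp only [mul_assoc]
    _ = t * s * (r * t) * s * t := by rw [h, c.eq]; simp only [mul_assoc]
    _ = t * s * r * (s * t * s) := by rw [h]; simp only [mul_assoc]
    _ = t * (s * r * s) * t * s := by simp only [mul_assoc]

theorem commute_middle_murphy₄ (h : s * t * s = t * s * t) (c : Commute r t) :
    Commute s (murphy₄ r s t) := by
  simpa only [murphy₄, murphy₃, mul_assoc] using commute_sandwich_sandwich h (c.mul_left c)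

theorem murphy₃_conj (h : r * s * r = s * r * s) (h' : s * t * s = t * s * t)
    (c : Commute r t) : t * murphy₃ r s * t⁻¹ = s⁻¹ * r⁻¹ * murphy₃ s t * (r * s) := by
  have c₂ : t * (r * r) * t⁻¹ = r * r := by
    rw [mul_inv_eq_iff_eq_mul, (c.symm.mul_right c.symm).eq]
  calc t * (s * r * r * s) * t⁻¹ = t * s * t⁻¹ * (t * (r * r) * t⁻¹) * (t * s * t⁻¹) := by
        group
    _ = s⁻¹ * t * (s * r * s⁻¹) * (s * r * s⁻¹) * t * s := by
        rw [c₂, ← braid_inv_conj h']; group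
    _ = s⁻¹ * (t * r⁻¹) * s * s * (r * t) * s := by
        rw [← braid_inv_conj h]; group
    _ = s⁻¹ * r⁻¹ * (t * s * s * t) * (r * s) := by
        rw [c.eq, ← c.inv_left.eq]; simp only [mul_assoc]

end Murphy

section Spans

variable {k A : Type*} [CommRing k] [Ring A] [Algebra k A] {r s t : Aˣ} {x y : A}

theorem murphy₄_op (r s t : Aˣ) :
    murphy₄ (opUnit r) (opUnit s) (opUnit t) = opUnit (murphy₄ r s t) := by
  simp only [murphy₄, murphy₃_op, ← opUnit_mul, mul_assoc]

theorem unitAdjoin_pair_inv (r s : Aˣ) : unitAdjoin k {r⁻¹, s⁻¹} = unitAdjoin k {r, s} := by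
  rw [← unitAdjoin_inv, Set.inv_insert, Set.inv_singleton, inv_inv, inv_inv]

theorem op_unitAdjoin_pair (r s : Aˣ) :
    (unitAdjoin k {r, s}).op = unitAdjoin k {opUnit r, opUnit s} := by
  rw [op_unitAdjoin, Set.image_pair]

theorem wordSpan_le_wordFilt {S : Set Aˣ} (hs : s ∈ S) :
    wordSpan k s t ≤ wordFilt (unitAdjoin k S) t 1 := by
  rw [wordSpan, wordFilt_one]
  gcongr <;> exact cubicSpan_le_unitAdjoin hs

/-- The bimodule over the algebra generated by `r` and `s` that is generated by the words
`t ^ i * s ^ j * t ^ l`. -/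
def alternatingSpan (k : Type*) {A : Type*} [CommRing k] [Ring A] [Algebra k A] (r s t : Aˣ) :
    Submodule k A :=
  (unitAdjoin k {r, s}).toSubmodule * (cubicSpan k t * cubicSpan k s * cubicSpan k t) *
    (unitAdjoin k {r, s}).toSubmodule

/-- The sum of the bimodule `alternatingSpan k r s t` and the ones generated by the Jucys–Murphy
element `murphy₄ r s t` and its inverse. It is the whole algebra generated by a skein triple. -/
def tripleSpan (k : Type*) {A : Type*} [CommRing k] [Ring A] [Algebra k A] (r s t : Aˣ) :
    Submodule k A :=
  alternatingSpan k r s t ⊔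
    span k {(murphy₄ r s t : A), (↑(murphy₄ r s t)⁻¹ : A)} * (unitAdjoin k {r, s}).toSubmodule

theorem alternatingSpan_inv (r s t : Aˣ) :
    alternatingSpan k r⁻¹ s⁻¹ t⁻¹ = alternatingSpan k r s t := by
  simp only [alternatingSpan, cubicSpan_inv, unitAdjoin_pair_inv]

theorem tripleSpan_inv (r s t : Aˣ) : tripleSpan k r⁻¹ s⁻¹ t⁻¹ = tripleSpan k r s t := by
  rw [tripleSpan, tripleSpan, alternatingSpan_inv, unitAdjoin_pair_inv, murphy₄_inv, inv_inv,
    Set.pair_comm]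

theorem left_mul_mem_alternatingSpan (hx : x ∈ unitAdjoin k {r, s})
    (hy : y ∈ alternatingSpan k r s t) : x * y ∈ alternatingSpan k r s t := by
  simpa only [alternatingSpan, ← mul_assoc, Subalgebra.isIdempotentElem_toSubmodule _ |>.eq]
    using mul_mem_mul (M := (unitAdjoin k {r, s}).toSubmodule) hx hy

theorem right_mul_mem_alternatingSpan (hx : x ∈ alternatingSpan k r s t)
    (hy : y ∈ unitAdjoin k {r, s}) : x * y ∈ alternatingSpan k r s t := by
  simpa only [alternatingSpan, mul_assoc, Subalgebra.isIdempotentElem_toSubmodule _ |>.eq]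
    using mul_mem_mul (N := (unitAdjoin k {r, s}).toSubmodule) hx hy

theorem wordFilt_le_alternatingSpan :
    wordFilt (unitAdjoin k {r, s}) t 1 ≤ alternatingSpan k r s t := by
  rw [wordFilt_one, alternatingSpan]
  gcongr
  intro x hx
  simpa only [mul_one] using mul_mem_mul (mul_mem_mul hx (one_mem_cubicSpan s))
    (one_mem_cubicSpan t)

theorem alternatingSpan_le_tripleSpan : alternatingSpan k r s t ≤ tripleSpan k r s t :=
  le_sup_left

theorem murphy₄_mem_tripleSpan : (murphy₄ r s t : A) ∈ tripleSpan k r s t := by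
  refine mem_sup_right ?_
  simpa only [mul_one] using mul_mem_mul (N := (unitAdjoin k {r, s}).toSubmodule)
    (subset_span (Set.mem_insert _ _)) (one_mem (unitAdjoin k {r, s}))

theorem right_mul_mem_tripleSpan (hx : x ∈ tripleSpan k r s t) (hy : y ∈ unitAdjoin k {r, s}) :
    x * y ∈ tripleSpan k r s t := by
  obtain ⟨u, hu, v, hv, rfl⟩ := mem_sup.1 hx
  rw [add_mul]
  refine add_mem (mem_sup_left (right_mul_mem_alternatingSpan hu hy)) (mem_sup_right ?_)
  simpa only [mul_assoc, Subalgebra.isIdempotentElem_toSubmodule _ |>.eq]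
    using mul_mem_mul (N := (unitAdjoin k {r, s}).toSubmodule) hv hy

end Spans

/-- Three units satisfying the relations of the generators of `Q₄`, with `q` in place of `a`. -/
structure SkeinTriple {k A : Type*} [CommRing k] [Ring A] [Algebra k A] (q e : kˣ) (e₁ e₂ : k)
    (r s t : Aˣ) : Prop where
  left : SkeinPair q e e₁ e₂ r s
  right : SkeinPair q e e₁ e₂ s t
  comm : Commute r t

namespace SkeinTriple

variable {k A : Type*} [CommRing k] [Ring A] [Algebra k A] {q e : kˣ} {e₁ e₂ : k} {r s t : Aˣ}
  {x y a b : A}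

theorem inv (h : SkeinTriple q e e₁ e₂ r s t) :
    SkeinTriple q⁻¹ e⁻¹ (↑e⁻¹ * e₂) (↑e⁻¹ * e₁) r⁻¹ s⁻¹ t⁻¹ :=
  ⟨h.left.inv, h.right.inv, h.comm.inv_inv⟩

theorem op (h : SkeinTriple q e e₁ e₂ r s t) :
    SkeinTriple q e e₁ e₂ (opUnit r) (opUnit s) (opUnit t) :=
  ⟨h.left.op, h.right.op, congrArg opUnit h.comm.symm.eq⟩

theorem commute_murphy₄ (h : SkeinTriple q e e₁ e₂ r s t) (hy : y ∈ unitAdjoin k {r, s}) :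
    Commute y (murphy₄ r s t : A) := by
  refine commute_of_mem_unitAdjoin ?_ hy
  rintro g (rfl | rfl)
  · exact (commute_left_murphy₄ h.left.braid h.comm).units_val
  · exact (commute_middle_murphy₄ h.right.braid h.comm).units_val

theorem commute_murphy₄_inv (h : SkeinTriple q e e₁ e₂ r s t) (hy : y ∈ unitAdjoin k {r, s}) :
    Commute y (↑(murphy₄ r s t)⁻¹ : A) :=
  (h.commute_murphy₄ hy).units_inv_right

theorem left_mul_mem_tripleSpan (h : SkeinTriple q e e₁ e₂ r s t)
    (hx : x ∈ unitAdjoin k {r, s}) (hy : y ∈ tripleSpan k r s t) :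
    x * y ∈ tripleSpan k r s t := by
  obtain ⟨u, hu, v, hv, rfl⟩ := mem_sup.1 hy
  rw [mul_add]
  refine add_mem (mem_sup_left (left_mul_mem_alternatingSpan hx hu)) (mem_sup_right ?_)
  clear hy
  induction hv using Submodule.mul_induction_on' with
  | mem_mul_mem z hz w hw =>
    have comm : span k {(murphy₄ r s t : A), (↑(murphy₄ r s t)⁻¹ : A)} ≤
        Subalgebra.toSubmodule (Subalgebra.centralizer k {x}) := span_le.2 <| by
      rintro _ (rfl | rfl) _ rfl
      exacts [h.commute_murphy₄ hx, h.commute_murphy₄_inv hx]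
    rw [← mul_assoc, show x * z = z * x from comm hz x rfl, mul_assoc]
    exact mul_mem_mul hz ((unitAdjoin k {r, s}).mul_mem hx hw)
  | add v _ w _ hv hw => rw [mul_add]; exact add_mem hv hw

theorem commute_of_mem (h : SkeinTriple q e e₁ e₂ r s t) (hx : x ∈ cubicSpan k r)
    (hy : y ∈ cubicSpan k t) : Commute x y :=
  commute_of_mem_cubicSpan (commute_of_mem_cubicSpan h.comm.units_val.symm hy).symm hx

theorem wordSpan_le_between (h : SkeinTriple q e e₁ e₂ r s t) (ha : a ∈ cubicSpan k t)
    (hb : b ∈ cubicSpan k t) : wordSpan k r s ≤ between (alternatingSpan k r s t) a b := by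
  refine mul_mul_le.2 fun x hx y hy z hz => ?_
  have comm : a * (x * y * z) * b = x * (a * y * b) * z := by
    simp only [mul_assoc, (h.commute_of_mem hz hb).eq, (h.commute_of_mem hx ha).symm.left_comm]
  rw [mem_between, comm]
  exact mul_mem_mul (mul_mem_mul (cubicSpan_le_unitAdjoin (by simp) hx)
    (mul_mem_mul (mul_mem_mul ha hy) hb)) (cubicSpan_le_unitAdjoin (by simp) hz)

theorem unitAdjoin_pair_le_between (h : SkeinTriple q e e₁ e₂ r s t) :
    (unitAdjoin k {r, s}).toSubmodule ≤ between (tripleSpan k r s t) t t := by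
  refine h.left.unitAdjoin_le_pairSpan.trans (pairSpan_le ?_ ?_)
  · exact fun y hy => alternatingSpan_le_tripleSpan
      (h.wordSpan_le_between (mem_cubicSpan t) (mem_cubicSpan t) hy)
  · simpa only [mem_between, murphy₄, Units.val_mul] using murphy₄_mem_tripleSpan

theorem unitAdjoin_pair_le_between_inv (h : SkeinTriple q e e₁ e₂ r s t) :
    (unitAdjoin k {r, s}).toSubmodule ≤ between (alternatingSpan k r s t) t (↑t⁻¹ : A) := by
  refine h.left.unitAdjoin_le_pairSpan.trans (pairSpan_le
    (h.wordSpan_le_between (mem_cubicSpan t) (inv_mem_cubicSpan t)) ?_)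
  rw [mem_between, ← Units.val_mul, ← Units.val_mul,
    murphy₃_conj h.left.braid h.right.braid h.comm, Units.val_mul, Units.val_mul]
  exact mul_mem_mul (mul_mem_mul (by simp [mul_mem]) h.right.murphy₃_mem_alternating)
    (by simp [mul_mem])

theorem cubicSpan_mul_mul_cubicSpan_le_tripleSpan (h : SkeinTriple q e e₁ e₂ r s t) :
    cubicSpan k t * (unitAdjoin k {r, s}).toSubmodule * cubicSpan k t ≤ tripleSpan k r s t := by
  have filt : wordFilt (unitAdjoin k {r, s}) t 1 ≤ tripleSpan k r s t :=
    wordFilt_le_alternatingSpan.trans alternatingSpan_le_tripleSpan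
  have left : ∀ x ∈ cubicSpan k t, ∀ y ∈ unitAdjoin k {r, s}, x * y ∈ tripleSpan k r s t :=
    fun x hx y hy => filt (right_mul_mem_wordFilt (cubicSpan_le_wordFilt hx) hy)
  have right : ∀ x ∈ cubicSpan k t, ∀ y ∈ unitAdjoin k {r, s}, y * x ∈ tripleSpan k r s t :=
    fun x hx y hy => filt (left_mul_mem_wordFilt hy (cubicSpan_le_wordFilt hx))
  have inv_between := h.inv.unitAdjoin_pair_le_between
  have inv_between_inv := h.inv.unitAdjoin_pair_le_between_inv
  rw [tripleSpan_inv, unitAdjoin_pair_inv] at inv_between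
  rw [alternatingSpan_inv, unitAdjoin_pair_inv, inv_inv] at inv_between_inv
  exact cubicSpan_mul_mul_cubicSpan_le
    (fun y hy => by simpa only [one_mul] using left 1 (one_mem_cubicSpan t) y hy)
    (right _ (mem_cubicSpan t)) (right _ (inv_mem_cubicSpan t))
    (left _ (mem_cubicSpan t)) (left _ (inv_mem_cubicSpan t))
    h.unitAdjoin_pair_le_between
    (fun y hy => alternatingSpan_le_tripleSpan (h.unitAdjoin_pair_le_between_inv hy))
    (fun y hy => alternatingSpan_le_tripleSpan (inv_between_inv hy)) inv_between

theorem gen_mul_mem_tripleSpan_of_mem_wordFilt (h : SkeinTriple q e e₁ e₂ r s t)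
    (hx : x ∈ cubicSpan k t) (hy : y ∈ wordFilt (unitAdjoin k {r, s}) t 1) :
    x * y ∈ tripleSpan k r s t := by
  suffices wordFilt (unitAdjoin k {r, s}) t 1 ≤ between (tripleSpan k r s t) x 1 from
    mem_between_one_right.1 (this hy)
  rw [wordFilt_one]
  refine mul_mul_le.2 fun a ha b hb c hc => ?_
  rw [mem_between_one_right, ← mul_assoc, ← mul_assoc]
  exact right_mul_mem_tripleSpan (h.cubicSpan_mul_mul_cubicSpan_le_tripleSpan
    (mul_mem_mul (mul_mem_mul hx ha) hb)) hc

theorem mul_gen_mem_tripleSpan_of_mem_wordFilt (h : SkeinTriple q e e₁ e₂ r s t)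
    (hx : x ∈ wordFilt (unitAdjoin k {r, s}) t 1) (hy : y ∈ cubicSpan k t) :
    x * y ∈ tripleSpan k r s t := by
  suffices wordFilt (unitAdjoin k {r, s}) t 1 ≤ between (tripleSpan k r s t) 1 y from
    mem_between_one_left.1 (this hx)
  rw [wordFilt_one]
  refine mul_mul_le.2 fun a ha b hb c hc => ?_
  rw [mem_between_one_left, mul_assoc, mul_assoc, ← mul_assoc b]
  exact h.left_mul_mem_tripleSpan ha (h.cubicSpan_mul_mul_cubicSpan_le_tripleSpan
    (mul_mem_mul (mul_mem_mul hb hc) hy))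

/-- Up to lower terms `murphy₃ s t` is `t⁻¹ * s * t⁻¹`, whose first letter cancels the extra
letter `t` after commuting past `y`. -/
theorem gen_mul_mul_murphy₃_mem (h : SkeinTriple q e e₁ e₂ r s t) (hx : x ∈ cubicSpan k s)
    (hy : y ∈ cubicSpan k r) :
    (t : A) * (x * y) * (murphy₃ s t : A) ∈ tripleSpan k r s t := by
  have hxy : x * y ∈ unitAdjoin k {r, s} :=
    mul_mem (cubicSpan_le_unitAdjoin (by simp) hx) (cubicSpan_le_unitAdjoin (by simp) hy)
  have congr : UnitCongr (tripleSpan k r s t) ((t : A) * (x * y) * ((t⁻¹ * s * t⁻¹ : Aˣ) : A))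
      ((t : A) * (x * y) * (murphy₃ s t : A)) :=
    h.right.unitCongr_inv_word.mul_left fun n hn => by
      rw [mul_assoc]
      exact h.gen_mul_mem_tripleSpan_of_mem_wordFilt (mem_cubicSpan t)
        (left_mul_mem_wordFilt hxy (wordSpan_le_wordFilt (by simp) hn))
  refine (congr.mem_iff le_rfl).1 ?_
  have comm : (t : A) * (x * y) * ((t⁻¹ * s * t⁻¹ : Aˣ) : A) =
      (t : A) * x * (↑t⁻¹ : A) * (y * s) * (↑t⁻¹ : A) := by
    simp only [Units.val_mul, mul_assoc,
      (h.commute_of_mem hy (inv_mem_cubicSpan t)).left_comm]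
  have conj : (t : A) * x * (↑t⁻¹ : A) ∈ wordFilt (unitAdjoin k {r, s}) t 1 := by
    have := h.inv.right.cubicSpan_le_between_inv (by rwa [cubicSpan_inv] : x ∈ _)
    rw [mem_between, inv_inv, wordSpan_inv] at this
    exact wordSpan_le_wordFilt (by simp) this
  have hys : y * s ∈ unitAdjoin k {r, s} :=
    mul_mem (cubicSpan_le_unitAdjoin (by simp) hy) (by simp)
  rw [comm]
  exact h.mul_gen_mem_tripleSpan_of_mem_wordFilt (right_mul_mem_wordFilt conj hys)
    (inv_mem_cubicSpan t)

theorem gen_mul_mem_of_mem_alternating (h : SkeinTriple q e e₁ e₂ r s t)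
    (hx : x ∈ unitAdjoin k {r, s}) (hy : y ∈ cubicSpan k t * cubicSpan k s * cubicSpan k t) :
    (t : A) * x * y ∈ tripleSpan k r s t := by
  have low : ∀ z ∈ unitAdjoin k {r, s}, ∀ n ∈ wordSpan k s t,
      (t : A) * z * n ∈ tripleSpan k r s t := fun z hz n hn => by
    rw [mul_assoc]
    exact h.gen_mul_mem_tripleSpan_of_mem_wordFilt (mem_cubicSpan t)
      (left_mul_mem_wordFilt hz (wordSpan_le_wordFilt (by simp) hn))
  have high : pairSpan k s r ≤ between (tripleSpan k r s t) t (murphy₃ s t) := by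
    refine pairSpan_le (mul_mul_le.2 fun x hx y hy z hz => ?_) ?_ <;> rw [mem_between]
    · have hxy : x * y ∈ unitAdjoin k {r, s} :=
        mul_mem (cubicSpan_le_unitAdjoin (by simp) hx) (cubicSpan_le_unitAdjoin (by simp) hy)
      obtain ⟨n, hn, m, hm, hnm⟩ := mem_sup.1 (h.right.mul_mem_pairSpan hz murphy₃_mem_pairSpan)
      obtain ⟨c, rfl⟩ := mem_span_singleton.1 hm
      rw [← mul_assoc, mul_assoc, ← hnm, mul_add, mul_smul_comm]
      exact add_mem (low _ hxy n hn) (smul_mem _ c (h.gen_mul_mul_murphy₃_mem hx hy))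
    · have comm : (t : A) * (murphy₃ s r : A) * (murphy₃ s t : A) =
          r * ((t : A) * (s * s * r) * (murphy₃ s t : A)) := by
        rw [show (murphy₃ s r : A) = r * s * s * r from rfl]
        simp only [mul_assoc, h.comm.units_val.left_comm]
      rw [comm]
      exact h.left_mul_mem_tripleSpan (by simp)
        (h.gen_mul_mul_murphy₃_mem h.right.cubic_left.sq_mem_cubicSpan (mem_cubicSpan r))
  suffices pairSpan k s t ≤ between (tripleSpan k r s t) (t * x) 1 from
    mem_between_one_right.1 (this (h.right.alternating_le_pairSpan hy))
  refine pairSpan_le (fun n hn => ?_) ?_ <;> rw [mem_between_one_right]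
  · exact low x hx n hn
  · exact high (h.left.symm.unitAdjoin_le_pairSpan (by rwa [Set.pair_comm]))

theorem gen_mul_mem_tripleSpan (h : SkeinTriple q e e₁ e₂ r s t)
    (hx : x ∈ tripleSpan k r s t) : (t : A) * x ∈ tripleSpan k r s t := by
  have sandwich : ∀ z ∈ cubicSpan k t * (unitAdjoin k {r, s}).toSubmodule * cubicSpan k t,
      (t : A) * z ∈ tripleSpan k r s t := fun z hz => by
    refine h.cubicSpan_mul_mul_cubicSpan_le_tripleSpan
      (mul_le_mul_left (mul_le_mul_left h.right.cubic_right.cubicSpan_mul_self_le _) _ ?_)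
    rw [mul_assoc, mul_assoc, ← mul_assoc (cubicSpan k t) _ (cubicSpan k t)]
    exact mul_mem_mul (mem_cubicSpan t) hz
  suffices tripleSpan k r s t ≤ between (tripleSpan k r s t) t 1 from
    mem_between_one_right.1 (this hx)
  refine sup_le (mul_mul_le.2 fun a ha b hb c hc => ?_) (mul_le.2 fun a ha c hc => ?_) <;>
    rw [mem_between_one_right, ← mul_assoc]
  · rw [← mul_assoc]
    exact right_mul_mem_tripleSpan (h.gen_mul_mem_of_mem_alternating ha hb) hc
  · refine right_mul_mem_tripleSpan (mem_between_one_right.1 (span_le.2 ?_ ha)) hc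
    rintro _ (rfl | rfl) <;> refine mem_between_one_right.2 (sandwich _ ?_)
    · rw [murphy₄, Units.val_mul, Units.val_mul]
      exact mul_mem_mul (mul_mem_mul (mem_cubicSpan t) (by simp)) (mem_cubicSpan t)
    · rw [murphy₄, mul_inv_rev, mul_inv_rev, Units.val_mul, Units.val_mul, ← mul_assoc]
      exact mul_mem_mul (mul_mem_mul (inv_mem_cubicSpan t) (by simp)) (inv_mem_cubicSpan t)

theorem unitAdjoin_le_tripleSpan (h : SkeinTriple q e e₁ e₂ r s t) :
    (unitAdjoin k {r, s, t}).toSubmodule ≤ tripleSpan k r s t := by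
  intro y hy
  rw [← mul_one y]
  refine mul_mem_of_left_stable ?_ hy (alternatingSpan_le_tripleSpan
    (wordFilt_le_alternatingSpan (cubicSpan_le_wordFilt (one_mem_cubicSpan t))))
  rintro g (rfl | rfl | rfl) x hx
  · exact ⟨h.left_mul_mem_tripleSpan (by simp) hx, h.left_mul_mem_tripleSpan (by simp) hx⟩
  · exact ⟨h.left_mul_mem_tripleSpan (by simp) hx, h.left_mul_mem_tripleSpan (by simp) hx⟩
  · refine ⟨h.gen_mul_mem_tripleSpan hx, ?_⟩
    rw [← tripleSpan_inv] at hx ⊢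
    exact h.inv.gen_mul_mem_tripleSpan hx

end SkeinTriple

section Murphy

variable {A : Type*} [Monoid A] {r s t w : Aˣ}

theorem murphy₃_conj_inv (h : r * s * r = s * r * s) (h' : s * t * s = t * s * t)
    (c : Commute r t) : t⁻¹ * murphy₃ r s * t = s * r * murphy₃ s t * (r⁻¹ * s⁻¹) := by
  have inv := murphy₃_conj (r := r⁻¹) (s := s⁻¹) (t := t⁻¹) (braid_inv h) (braid_inv h') c.inv_inv
  rw [murphy₃_inv, murphy₃_inv] at inv
  simpa only [mul_inv_rev, inv_inv, mul_assoc] using congrArg (·⁻¹) inv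

theorem murphy₄_conj (h : r * s * r = s * r * s) (h' : s * t * s = t * s * t)
    (h'' : t * w * t = w * t * w) (c : Commute r t) (cr : Commute r w) (cs : Commute s w) :
    w * murphy₄ r s t * w⁻¹ = t⁻¹ * s⁻¹ * r⁻¹ * murphy₄ s t w * (r * s * t) := by
  have commute_murphy₃ : w * murphy₃ r s = murphy₃ r s * w :=
    (((cs.mul_left cr).mul_left cr).mul_left cs).symm.eq
  calc w * (t * murphy₃ r s * t) * w⁻¹
      = w * t * w⁻¹ * (w * murphy₃ r s) * t * w⁻¹ := by group
    _ = w * t * w⁻¹ * murphy₃ r s * (w * t * w⁻¹) := by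
        rw [commute_murphy₃]; simp only [mul_assoc]
    _ = t⁻¹ * w * (t * murphy₃ r s * t⁻¹) * w * t := by
        rw [← braid_inv_conj h'']; simp only [mul_assoc]
    _ = t⁻¹ * (w * (s⁻¹ * r⁻¹)) * murphy₃ s t * (r * s * w) * t := by
        rw [murphy₃_conj h h' c]; simp only [mul_assoc]
    _ = t⁻¹ * s⁻¹ * r⁻¹ * (w * murphy₃ s t * w) * (r * s * t) := by
        rw [(cr.mul_left cs).eq, ← (cs.inv_left.mul_left cr.inv_left).eq]
        simp only [mul_assoc]

theorem murphy₄_conj_inv (h : r * s * r = s * r * s) (h' : s * t * s = t * s * t)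
    (h'' : t * w * t = w * t * w) (c : Commute r t) (cr : Commute r w) (cs : Commute s w) :
    w⁻¹ * murphy₄ r s t * w = t * s * r * murphy₄ s t w * (r⁻¹ * s⁻¹ * t⁻¹) := by
  have inv := murphy₄_conj (r := r⁻¹) (s := s⁻¹) (t := t⁻¹) (w := w⁻¹) (braid_inv h)
    (braid_inv h') (braid_inv h'') c.inv_inv cr.inv_inv cs.inv_inv
  rw [murphy₄_inv, murphy₄_inv] at inv
  simpa only [mul_inv_rev, inv_inv, mul_assoc] using congrArg (·⁻¹) inv

end Murphy

section Filtration

variable {k A : Type*} [CommRing k] [Ring A] [Algebra k A] {S : Subalgebra k A} {T : Set Aˣ}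
  {r s t w : Aˣ} {P : Submodule k A} {x y z : A} {q e : kˣ} {e₁ e₂ : k}

theorem IsCubic.mul_mem_of_inv_mul_mem (h : IsCubic e e₁ e₂ s)
    (h₀ : x ∈ P) (h₁ : (↑s⁻¹ : A) * x ∈ P) (h₂ : (↑s⁻¹ : A) * ((↑s⁻¹ : A) * x) ∈ P) :
    (s : A) * x ∈ P := by
  have cubic : (s : A) * x = (e : k) • ((↑s⁻¹ : A) * ((↑s⁻¹ : A) * x)) -
      e₂ • ((↑s⁻¹ : A) * x) + e₁ • x := by
    have inv := congrArg (fun y => (e : k) • (y * x)) h.inv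
    simp only [add_mul, sub_mul, smul_mul_assoc, one_mul, inv_inv, smul_add, smul_sub, smul_smul,
      Units.val_mul, Units.mul_inv, Units.mul_inv_cancel_left, one_smul, mul_assoc] at inv
    rw [inv]
    abel
  rw [cubic]
  exact add_mem (sub_mem (smul_mem _ _ h₂) (smul_mem _ _ h₁)) (smul_mem _ _ h₀)

theorem mul_mul_mem_wordFilt_two (hx : x ∈ wordFilt S w 1) (hy : y ∈ S)
    (hz : z ∈ wordFilt S w 1) : x * y * z ∈ wordFilt S w 2 := by
  rw [← one_add_one_eq_two]
  exact mul_mem_wordFilt (right_mul_mem_wordFilt hx hy) hz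

theorem IsCubic.mul_gen_mul_gen_mul_mem_wordFilt (h : IsCubic e e₁ e₂ w)
    (hx : x ∈ cubicSpan k w) (hy : y ∈ S) (hz : z ∈ S) :
    x * (w * y * w) * z ∈ wordFilt S w 2 := by
  have mem := mul_mul_mem_wordFilt_two
    (cubicSpan_le_wordFilt (h.mul_mem_cubicSpan hx (mem_cubicSpan w))) hy
    (cubicSpan_le_wordFilt (mem_cubicSpan w))
  simpa only [mul_assoc] using right_mul_mem_wordFilt mem hz

theorem UnitCongr.mul_mul_mem_wordFilt_iff {p p' : A} (h : UnitCongr (wordSpan k t w) p p')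
    (ht : t ∈ T) (hx : x ∈ cubicSpan k w) (hy : y ∈ unitAdjoin k T) :
    x * y * p ∈ wordFilt (unitAdjoin k T) w 2 ↔ x * y * p' ∈ wordFilt (unitAdjoin k T) w 2 :=
  (h.mul_left fun _ hz => mul_mul_mem_wordFilt_two (cubicSpan_le_wordFilt hx) hy
    (wordSpan_le_wordFilt ht hz)).mem_iff le_rfl

theorem UnitCongr.mul_mul_mem_wordFilt_iff' {p p' : A} (h : UnitCongr (wordSpan k t w) p p')
    (ht : t ∈ T) (hx : x ∈ cubicSpan k w) (hy : y ∈ unitAdjoin k T) :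
    p * y * x ∈ wordFilt (unitAdjoin k T) w 2 ↔ p' * y * x ∈ wordFilt (unitAdjoin k T) w 2 := by
  simp only [mul_assoc]
  refine (h.mul_right fun _ hz => ?_).mem_iff le_rfl
  rw [← mul_assoc]
  exact mul_mul_mem_wordFilt_two (wordSpan_le_wordFilt ht hz) hy (cubicSpan_le_wordFilt hx)

theorem unitAdjoin_pair_le_triple : unitAdjoin k {r, s} ≤ unitAdjoin k {r, s, t} :=
  unitAdjoin_mono (by simp [Set.insert_subset_iff])

theorem murphy₄_mem_unitAdjoin {S : Set Aˣ} (hr : r ∈ S) (hs : s ∈ S) (ht : t ∈ S) :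
    (murphy₄ r s t : A) ∈ unitAdjoin k S := by
  simp only [murphy₄, Units.val_mul]
  exact mul_mem (mul_mem (coe_mem_unitAdjoin ht) (murphy₃_mem_unitAdjoin hr hs))
    (coe_mem_unitAdjoin ht)

theorem murphy₄_inv_mem_unitAdjoin {S : Set Aˣ} (hr : r ∈ S) (hs : s ∈ S) (ht : t ∈ S) :
    (↑(murphy₄ r s t)⁻¹ : A) ∈ unitAdjoin k S := by
  rw [← murphy₄_inv, ← unitAdjoin_inv]
  exact murphy₄_mem_unitAdjoin (Set.inv_mem_inv.2 hr) (Set.inv_mem_inv.2 hs)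
    (Set.inv_mem_inv.2 ht)

theorem unitAdjoin_triple_inv (r s t : Aˣ) :
    unitAdjoin k {r⁻¹, s⁻¹, t⁻¹} = unitAdjoin k {r, s, t} := by
  rw [← unitAdjoin_inv]
  simp only [Set.inv_insert, Set.inv_singleton, inv_inv]

theorem wordFilt_le_unitAdjoin :
    wordFilt (unitAdjoin k {r, s}) t 1 ≤ (unitAdjoin k {r, s, t}).toSubmodule := by
  rw [wordFilt_one]
  exact mul_le_toSubmodule (mul_le_toSubmodule unitAdjoin_pair_le_triple
    (cubicSpan_le_unitAdjoin (by simp))) unitAdjoin_pair_le_triple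

theorem alternatingSpan_le_unitAdjoin :
    alternatingSpan k r s t ≤ (unitAdjoin k {r, s, t}).toSubmodule :=
  mul_le_toSubmodule (mul_le_toSubmodule unitAdjoin_pair_le_triple
    (cubicSpan_mul_mul_le_unitAdjoin (by simp) (by simp))) unitAdjoin_pair_le_triple

theorem tripleSpan_le_unitAdjoin :
    tripleSpan k r s t ≤ (unitAdjoin k {r, s, t}).toSubmodule := by
  have murphy_le : span k {(murphy₄ r s t : A), (↑(murphy₄ r s t)⁻¹ : A)} ≤
      (unitAdjoin k {r, s, t}).toSubmodule := by
    refine span_le.2 ?_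
    rintro _ (rfl | rfl)
    · exact murphy₄_mem_unitAdjoin (by simp) (by simp) (by simp)
    · exact murphy₄_inv_mem_unitAdjoin (by simp) (by simp) (by simp)
  exact sup_le alternatingSpan_le_unitAdjoin
    (mul_le_toSubmodule murphy_le unitAdjoin_pair_le_triple)

theorem SkeinTriple.fg_unitAdjoin (h : SkeinTriple q e e₁ e₂ r s t) :
    (unitAdjoin k {r, s, t}).toSubmodule.FG := by
  have pair := h.left.fg_unitAdjoin
  have alternating := ((fg_cubicSpan (k := k) t).mul (fg_cubicSpan s)).mul (fg_cubicSpan t)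
  rw [le_antisymm h.unitAdjoin_le_tripleSpan tripleSpan_le_unitAdjoin]
  exact ((pair.mul alternating).mul pair).sup ((fg_span (by simp)).mul pair)

theorem left_mul_mem_between (hx : Commute x y) (hP : ∀ p ∈ P, x * p ∈ P) {m : A}
    (hm : m ∈ between P y z) : x * m ∈ between P y z := by
  have stable := hP _ (mem_between.1 hm)
  rwa [← mul_assoc, ← mul_assoc, hx.eq, mul_assoc y x m] at stable

theorem alternatingSpan_le_of_left_stable (hP : ∀ a ∈ unitAdjoin k {r, s}, ∀ p ∈ P, a * p ∈ P)
    (h : SkeinPair q e e₁ e₂ s t)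
    (h₁ : wordFilt (unitAdjoin k {r, s}) t 1 ≤ P)
    (h₂ : ∀ b ∈ unitAdjoin k {r, s}, (murphy₃ s t : A) * b ∈ P) :
    alternatingSpan k r s t ≤ P := by
  refine mul_mul_le.2 fun a ha m hm b hb => ?_
  have high : pairSpan k s t ≤ between P a b := pairSpan_le
    (fun n hn => h₁ (right_mul_mem_wordFilt
      (left_mul_mem_wordFilt ha (wordSpan_le_wordFilt (by simp) hn)) hb))
    (by rw [mem_between, mul_assoc]; exact hP a ha _ (h₂ b hb))
  exact high (h.alternating_le_pairSpan hm)

theorem SkeinTriple.unitAdjoin_le_of_left_stable (h : SkeinTriple q e e₁ e₂ r s t)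
    (hP : ∀ a ∈ unitAdjoin k {r, s}, ∀ p ∈ P, a * p ∈ P)
    (h₁ : wordFilt (unitAdjoin k {r, s}) t 1 ≤ P)
    (h₂ : ∀ b ∈ unitAdjoin k {r, s}, (murphy₃ s t : A) * b ∈ P)
    (h₃ : (murphy₄ r s t : A) ∈ P) (h₄ : (↑(murphy₄ r s t)⁻¹ : A) ∈ P) :
    (unitAdjoin k {r, s, t}).toSubmodule ≤ P := by
  refine h.unitAdjoin_le_tripleSpan.trans
    (sup_le (alternatingSpan_le_of_left_stable hP h.right h₁ h₂) (mul_le.2 fun x hx y hy => ?_))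
  suffices span k {(murphy₄ r s t : A), (↑(murphy₄ r s t)⁻¹ : A)} ≤ between P 1 y from
    mem_between_one_left.1 (this hx)
  refine span_le.2 ?_
  rintro _ (rfl | rfl) <;> refine mem_between_one_left.2 ?_
  · rw [← (h.commute_murphy₄ hy).eq]
    exact hP y hy _ h₃
  · rw [← (h.commute_murphy₄_inv hy).eq]
    exact hP y hy _ h₄

/-- The span of the words having at most `n` letters `w` or `w⁻¹` and all others among
`r`, `s`, `t` and their inverses. -/
abbrev quadFilt (k : Type*) {A : Type*} [CommRing k] [Ring A] [Algebra k A] (r s t w : Aˣ)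
    (n : ℕ) : Submodule k A :=
  wordFilt (unitAdjoin k {r, s, t}) w n

theorem quadFilt_inv (r s t w : Aˣ) (n : ℕ) :
    quadFilt k r⁻¹ s⁻¹ t⁻¹ w⁻¹ n = quadFilt k r s t w n := by
  rw [quadFilt, wordFilt_inv, unitAdjoin_triple_inv]

theorem opSubmodule_quadFilt (r s t w : Aˣ) (n : ℕ) :
    opSubmodule (quadFilt k r s t w n) =
      quadFilt k (opUnit r) (opUnit s) (opUnit t) (opUnit w) n := by
  rw [quadFilt, opSubmodule_wordFilt, op_unitAdjoin, Set.image_insert_eq, Set.image_pair]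

end Filtration

/-- Units `r`, `s`, `t`, `w` satisfying the relations of the Artin generators of the quotient on
five strands. -/
structure SkeinQuad {k A : Type*} [CommRing k] [Ring A] [Algebra k A] (q e : kˣ) (e₁ e₂ : k)
    (r s t w : Aˣ) : Prop where
  left : SkeinTriple q e e₁ e₂ r s t
  right : SkeinTriple q e e₁ e₂ s t w
  comm : Commute r w

namespace SkeinQuad

variable {k A : Type*} [CommRing k] [Ring A] [Algebra k A] {q e : kˣ} {e₁ e₂ : k}
  {r s t w : Aˣ} {x y z b : A}

theorem inv (h : SkeinQuad q e e₁ e₂ r s t w) :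
    SkeinQuad q⁻¹ e⁻¹ (↑e⁻¹ * e₂) (↑e⁻¹ * e₁) r⁻¹ s⁻¹ t⁻¹ w⁻¹ :=
  ⟨h.left.inv, h.right.inv, h.comm.inv_inv⟩

theorem op (h : SkeinQuad q e e₁ e₂ r s t w) :
    SkeinQuad q e e₁ e₂ (opUnit r) (opUnit s) (opUnit t) (opUnit w) :=
  ⟨h.left.op, h.right.op, by
    rw [commute_iff_eq, ← opUnit_mul, ← opUnit_mul, h.comm.eq]⟩

theorem commute_of_mem (h : SkeinQuad q e e₁ e₂ r s t w) (hy : y ∈ unitAdjoin k {r, s})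
    (hx : x ∈ cubicSpan k w) : Commute y x := by
  refine commute_of_mem_unitAdjoin ?_ hy
  rintro g (rfl | rfl)
  · exact (commute_of_mem_cubicSpan h.comm.symm.units_val hx).symm
  · exact (commute_of_mem_cubicSpan h.right.comm.symm.units_val hx).symm

theorem wordFilt_le_between_of_murphy₃ (h : SkeinQuad q e e₁ e₂ r s t w)
    (hx : x ∈ cubicSpan k w) (hz : z ∈ unitAdjoin k {r, s, t})
    (hb : ∀ b ∈ unitAdjoin k {r, s}, (murphy₃ t w : A) * (b * z) * w ∈ quadFilt k r s t w 2) :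
    wordFilt (unitAdjoin k {r, s}) t 1 ≤ between (quadFilt k r s t w 2) x (w * z * w) := by
  rw [wordFilt_one]
  refine mul_mul_le.2 fun a ha y hy b hb' => ?_
  have high : pairSpan k t w ≤ between (quadFilt k r s t w 2) 1 (b * z * w) := by
    refine pairSpan_le (fun n hn => mem_between_one_left.2 ?_) (mem_between_one_left.2 ?_)
    · rw [← mul_assoc]
      exact mul_mul_mem_wordFilt_two (wordSpan_le_wordFilt (by simp) hn)
        (mul_mem (unitAdjoin_pair_le_triple hb') hz) (cubicSpan_le_wordFilt (mem_cubicSpan w))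
    · simpa only [mul_assoc] using hb b hb'
  have middle := mem_between_one_left.1 (high (h.right.right.alternating_le_pairSpan
    (mul_mem_mul (mul_mem_mul hx hy) (mem_cubicSpan w))))
  have regroup : x * (a * y * b) * (w * z * w) = a * (x * y * w * (b * z * w)) := by
    simp only [mul_assoc, (h.commute_of_mem ha hx).symm.left_comm,
      (h.commute_of_mem hb' (mem_cubicSpan w)).left_comm]
  rw [mem_between, regroup]
  exact left_mul_mem_wordFilt (unitAdjoin_pair_le_triple ha) middle

theorem murphy₃_mul_inv_mul_mem (h : SkeinQuad q e e₁ e₂ r s t w)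
    (hb : b ∈ unitAdjoin k {r, s}) :
    (murphy₃ t w : A) * (b * (↑t⁻¹ : A)) * w ∈ quadFilt k r s t w 2 := by
  have hb' := unitAdjoin_pair_le_triple (t := t) hb
  refine (h.right.right.unitCongr_inv_word.mul_mul_mem_wordFilt_iff' (by simp)
    (mem_cubicSpan w) (mul_mem hb' (by simp))).1 ?_
  have braid : (↑w⁻¹ : A) * ((↑t⁻¹ : A) * w) = t * ((↑w⁻¹ : A) * (↑t⁻¹ : A)) := by
    simpa only [Units.val_mul, mul_assoc] using
      congrArg Units.val (braid_inv_conj_inv h.right.right.braid.symm)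
  have regroup : ((w⁻¹ * t * w⁻¹ : Aˣ) : A) * (b * (↑t⁻¹ : A)) * w =
      (↑w⁻¹ : A) * (t * b * t) * ((↑w⁻¹ : A) * (↑t⁻¹ : A)) := by
    simp only [Units.val_mul, mul_assoc, ← braid,
      (h.commute_of_mem hb (inv_mem_cubicSpan w)).symm.left_comm]
  rw [regroup]
  exact mul_mul_mem_wordFilt_two (cubicSpan_le_wordFilt (inv_mem_cubicSpan w))
    (mul_mem (mul_mem (by simp) hb') (by simp))
    (right_mul_mem_wordFilt (cubicSpan_le_wordFilt (inv_mem_cubicSpan w)) (by simp))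

theorem wordFilt_le_between_murphy₃ (h : SkeinQuad q e e₁ e₂ r s t w)
    (hx : x ∈ cubicSpan k w) :
    wordFilt (unitAdjoin k {r, s}) t 1 ≤
      between (quadFilt k r s t w 2) x (murphy₃ t w : A) := fun y hy => by
  have word := h.wordFilt_le_between_of_murphy₃ hx (inv_mem_unitAdjoin (by simp))
    (fun _ => h.murphy₃_mul_inv_mul_mem) hy
  refine (h.right.right.unitCongr_murphy₃_word.mul_mul_mem_wordFilt_iff (by simp) hx
    (wordFilt_le_unitAdjoin hy)).2 ?_
  simpa only [mem_between, Units.val_mul] using word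

theorem wordFilt_le_between_murphy₃' (h : SkeinQuad q e e₁ e₂ r s t w)
    (hx : x ∈ cubicSpan k w) :
    wordFilt (unitAdjoin k {r, s}) t 1 ≤
      between (quadFilt k r s t w 2) (murphy₃ t w : A) x := by
  rw [← opSubmodule_le_between, opSubmodule_wordFilt, op_unitAdjoin_pair, opSubmodule_quadFilt,
    ← val_opUnit, ← murphy₃_op]
  exact h.op.wordFilt_le_between_murphy₃ (by rwa [← opSubmodule_cubicSpan, op_mem_opSubmodule])

/-- The elements `z` for which `w t⁻¹ z w (t s² t) w` is a combination of words having at most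
two letters `w` or `w⁻¹`. -/
def murphyConductor (k : Type*) {A : Type*} [CommRing k] [Ring A] [Algebra k A]
    (r s t w : Aˣ) : Submodule k A :=
  between (quadFilt k r s t w 2) (w * (↑t⁻¹ : A)) (murphy₄ s t w : A)

theorem mem_murphyConductor : z ∈ murphyConductor k r s t w ↔
    w * (↑t⁻¹ : A) * z * murphy₄ s t w ∈ quadFilt k r s t w 2 := Iff.rfl

theorem mem_murphyConductor_iff (h : SkeinQuad q e e₁ e₂ r s t w)
    (hz : z ∈ unitAdjoin k {r, s}) : z ∈ murphyConductor k r s t w ↔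
      (murphy₃ t w : A) * (z * murphy₃ s t) * w ∈ quadFilt k r s t w 2 := by
  have regroup : w * (↑t⁻¹ : A) * z * murphy₄ s t w =
      ((w * t⁻¹ * w : Aˣ) : A) * (z * murphy₃ s t) * w := by
    simp only [murphy₄, Units.val_mul, mul_assoc,
      (h.commute_of_mem hz (mem_cubicSpan w)).left_comm]
  rw [mem_murphyConductor, regroup]
  exact h.right.right.unitCongr_murphy₃_word.symm.mul_mul_mem_wordFilt_iff' (by simp)
    (mem_cubicSpan w) (mul_mem (unitAdjoin_pair_le_triple hz)
      (murphy₃_mem_unitAdjoin (by simp) (by simp)))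

theorem mul_mem_murphyConductor (h : SkeinQuad q e e₁ e₂ r s t w) (hx : x ∈ cubicSpan k r)
    (hz : z ∈ murphyConductor k r s t w) : x * z ∈ murphyConductor k r s t w := by
  have comm : Commute x (w * (↑t⁻¹ : A)) :=
    commute_of_mem_cubicSpan (h.comm.units_val.mul_right h.left.comm.inv_right.units_val) hx
  exact left_mul_mem_between comm (fun _ => left_mul_mem_wordFilt
    (cubicSpan_le_unitAdjoin (by simp) hx)) hz

theorem murphyConductor_mul_mem (h : SkeinQuad q e e₁ e₂ r s t w)
    (hz : z ∈ murphyConductor k r s t w) (hx : x ∈ cubicSpan k s) :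
    z * x ∈ murphyConductor k r s t w := by
  have comm := h.right.commute_murphy₄ (cubicSpan_le_unitAdjoin (by simp) hx)
  have stable := right_mul_mem_wordFilt (mem_murphyConductor.1 hz)
    (cubicSpan_le_unitAdjoin (S := {r, s, t}) (by simp) hx)
  rwa [mul_assoc, ← comm.eq, ← mul_assoc, mul_assoc _ z] at stable

theorem cubicSpan_le_murphyConductor (h : SkeinQuad q e e₁ e₂ r s t w) :
    cubicSpan k r ≤ murphyConductor k r s t w := by
  suffices 1 ∈ murphyConductor k r s t w from fun x hx => by
    simpa only [mul_one] using h.mul_mem_murphyConductor hx this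
  refine (h.mem_murphyConductor_iff (one_mem _)).2 ?_
  have factor : (s * s * t : A) ∈ wordFilt (unitAdjoin k {r, s}) t 1 :=
    left_mul_mem_wordFilt (mul_mem (by simp) (by simp)) (cubicSpan_le_wordFilt (mem_cubicSpan t))
  have regroup : (murphy₃ t w : A) * (1 * murphy₃ s t) * w =
      murphy₃ t w * t * (s * s * t) * w := by
    simp only [one_mul, mul_assoc, murphy₃.eq_1 s t, Units.val_mul]
  rw [regroup, h.right.right.unitCongr_murphy₃_mul.mul_mul_mem_wordFilt_iff' (by simp)
    (mem_cubicSpan w) (wordFilt_le_unitAdjoin factor)]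
  exact h.wordFilt_le_between_murphy₃' (mem_cubicSpan w) factor

theorem gen_mul_mem_murphyConductor (h : SkeinQuad q e e₁ e₂ r s t w) (hz : z ∈ cubicSpan k r) :
    s * z ∈ murphyConductor k r s t w := by
  have hsz : s * z ∈ unitAdjoin k {r, s} :=
    mul_mem (by simp) (cubicSpan_le_unitAdjoin (by simp) hz)
  refine (h.mem_murphyConductor_iff hsz).2 ?_
  refine (h.right.right.unitCongr_inv_word.mul_mul_mem_wordFilt_iff' (by simp)
    (mem_cubicSpan w) (mul_mem (unitAdjoin_pair_le_triple hsz) (by simp))).1 ?_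
  have conj : (↑w⁻¹ : A) * (murphy₃ s t * w) =
      t * (s * (murphy₃ t w * ((↑s⁻¹ : A) * (↑t⁻¹ : A)))) := by
    simpa only [Units.val_mul, mul_assoc] using congrArg Units.val
      (murphy₃_conj_inv h.right.left.braid h.right.right.braid h.right.comm)
  have braid : (t * (s * t) : A) = s * (t * s) := by
    simpa only [Units.val_mul, mul_assoc] using congrArg Units.val h.left.right.braid.symm
  have comm := (h.commute_of_mem hsz (inv_mem_cubicSpan w)).symm.left_comm (murphy₃ s t * w)
  simp only [mul_assoc] at comm
  have regroup : ((w⁻¹ * t * w⁻¹ : Aˣ) : A) * (s * z * murphy₃ s t) * w =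
      s * ((↑w⁻¹ : A) * (t * (s * z * s)) * murphy₃ t w) * ((↑s⁻¹ : A) * (↑t⁻¹ : A)) := by
    calc _ = (↑w⁻¹ : A) * t * (s * z) * ((↑w⁻¹ : A) * (murphy₃ s t * w)) := by
          simp only [Units.val_mul, mul_assoc, comm]
      _ = (↑w⁻¹ : A) * (t * (s * t)) * z * s * murphy₃ t w * ((↑s⁻¹ : A) * (↑t⁻¹ : A)) := by
          simp only [conj, mul_assoc, (h.left.commute_of_mem hz (mem_cubicSpan t)).left_comm]
      _ = _ := by
          simp only [braid, mul_assoc, h.right.comm.inv_right.units_val.symm.left_comm]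
  rw [regroup]
  refine right_mul_mem_wordFilt (left_mul_mem_wordFilt (by simp) ?_) (mul_mem (by simp) (by simp))
  exact h.wordFilt_le_between_murphy₃ (inv_mem_cubicSpan w) (right_mul_mem_wordFilt
    (cubicSpan_le_wordFilt (mem_cubicSpan t)) (mul_mem hsz (by simp)))

theorem murphy₄_mem_quadFilt : (murphy₄ s t w : A) ∈ quadFilt k r s t w 2 := by
  simp only [murphy₄, Units.val_mul]
  exact mul_mul_mem_wordFilt_two (cubicSpan_le_wordFilt (mem_cubicSpan w))
    (murphy₃_mem_unitAdjoin (by simp) (by simp)) (cubicSpan_le_wordFilt (mem_cubicSpan w))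

theorem inv_mul_inv_mul_inv_mul_murphy₄ (h : SkeinQuad q e e₁ e₂ r s t w) :
    t⁻¹ * s⁻¹ * r⁻¹ * murphy₄ s t w = w * murphy₄ r s t * w⁻¹ * (t⁻¹ * s⁻¹ * r⁻¹) := by
  rw [murphy₄_conj h.left.left.braid h.left.right.braid h.right.right.braid h.left.comm h.comm
    h.right.comm]
  group

/-- The words `z`, `w⁻¹ z` and `w⁻² z` with `z = t⁻¹ s⁻¹ r⁻¹ w (t s² t) w` have degree at most two,
hence so does `w z` by the cubic relation. -/
theorem inv_mul_inv_mem_murphyConductor (h : SkeinQuad q e e₁ e₂ r s t w) :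
    (↑s⁻¹ : A) * (↑r⁻¹ : A) ∈ murphyConductor k r s t w := by
  set z : A := ((t⁻¹ * s⁻¹ * r⁻¹ * murphy₄ s t w : Aˣ) : A) with z_def
  have hsr : (↑s⁻¹ : A) * (↑r⁻¹ : A) ∈ unitAdjoin k {r, s} := mul_mem (by simp) (by simp)
  have mem : z ∈ quadFilt k r s t w 2 := by
    simp only [z_def, Units.val_mul]
    exact left_mul_mem_wordFilt (mul_mem (mul_mem (by simp) (by simp)) (by simp))
      murphy₄_mem_quadFilt
  have inv_mul_mem : (↑w⁻¹ : A) * z ∈ quadFilt k r s t w 2 := by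
    have regroup : (↑w⁻¹ : A) * z = (↑(w⁻¹ * t⁻¹ * w) : A) *
        ((↑s⁻¹ : A) * (↑r⁻¹ : A) * murphy₃ s t) * w := by
      simp only [z_def, murphy₄, Units.val_mul, mul_assoc]
      rw [← mul_assoc (↑s⁻¹ : A), ← mul_assoc (↑s⁻¹ : A),
        (h.commute_of_mem hsr (mem_cubicSpan w)).left_comm]
    rw [regroup]
    refine mul_mul_mem_wordFilt_two ?_ (mul_mem (unitAdjoin_pair_le_triple hsr) (by simp))
      (cubicSpan_le_wordFilt (mem_cubicSpan w))
    rw [braid_inv_conj_inv h.right.right.braid.symm, Units.val_mul, Units.val_mul]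
    exact right_mul_mem_wordFilt (left_mul_mem_wordFilt (by simp)
      (cubicSpan_le_wordFilt (inv_mem_cubicSpan w))) (by simp)
  have inv_mul_inv_mul_mem : (↑w⁻¹ : A) * ((↑w⁻¹ : A) * z) ∈ quadFilt k r s t w 2 := by
    rw [z_def, h.inv_mul_inv_mul_inv_mul_murphy₄]
    simp only [Units.val_mul, mul_assoc, Units.inv_mul_cancel_left]
    rw [← mul_assoc, ← mul_assoc]
    exact right_mul_mem_wordFilt (mul_mul_mem_wordFilt_two
      (cubicSpan_le_wordFilt (inv_mem_cubicSpan w))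
      (murphy₄_mem_unitAdjoin (by simp) (by simp) (by simp))
      (cubicSpan_le_wordFilt (inv_mem_cubicSpan w)))
      (mul_mem (by simp) (mul_mem (by simp) (by simp)))
  have gen_mul_mem := h.right.right.cubic_right.mul_mem_of_inv_mul_mem mem inv_mul_mem
    inv_mul_inv_mul_mem
  simpa only [z_def, mem_murphyConductor, Units.val_mul, mul_assoc] using gen_mul_mem

theorem cubicSpan_mul_cubicSpan_le_murphyConductor (h : SkeinQuad q e e₁ e₂ r s t w) :
    cubicSpan k s * cubicSpan k r ≤ murphyConductor k r s t w := by
  have inv_mul : cubicSpan k r ≤ between (murphyConductor k r s t w) (↑s⁻¹ : A) 1 := by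
    refine cubicSpan_le.2 ⟨?_, ?_, ?_⟩ <;> rw [mem_between_one_right]
    · rw [mul_one, ← one_mul (↑s⁻¹ : A)]
      exact h.murphyConductor_mul_mem (h.cubicSpan_le_murphyConductor (one_mem_cubicSpan r))
        (inv_mem_cubicSpan s)
    · have braid : (↑s⁻¹ : A) * r = r * (s * (↑r⁻¹ : A)) * (↑s⁻¹ : A) := by
        simpa only [Units.val_mul, mul_assoc] using congrArg Units.val
          (eq_mul_inv_of_mul_eq (braid_inv_conj h.left.left.braid.symm))
      rw [braid]
      exact h.murphyConductor_mul_mem (h.mul_mem_murphyConductor (mem_cubicSpan r)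
        (h.gen_mul_mem_murphyConductor (inv_mem_cubicSpan r))) (inv_mem_cubicSpan s)
    · exact h.inv_mul_inv_mem_murphyConductor
  refine mul_le.2 fun x hx y hy => ?_
  suffices cubicSpan k s ≤ between (murphyConductor k r s t w) 1 y from
    mem_between_one_left.1 (this hx)
  refine cubicSpan_le.2 ⟨?_, ?_, ?_⟩ <;> rw [mem_between_one_left]
  · simpa only [one_mul] using h.cubicSpan_le_murphyConductor hy
  · exact h.gen_mul_mem_murphyConductor hy
  · exact mem_between_one_right.1 (inv_mul hy)

theorem unitAdjoin_le_murphyConductor (h : SkeinQuad q e e₁ e₂ r s t w) :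
    (unitAdjoin k {r, s}).toSubmodule ≤ murphyConductor k r s t w := by
  have words : wordSpan k s r ≤ murphyConductor k r s t w := mul_mul_le.2 fun x hx y hy z hz =>
    h.murphyConductor_mul_mem (h.cubicSpan_mul_cubicSpan_le_murphyConductor (mul_mem_mul hx hy)) hz
  rw [Set.pair_comm]
  refine h.left.left.symm.unitAdjoin_le_pairSpan.trans (pairSpan_le words ?_)
  rw [h.left.left.symm.unitCongr_murphy₃_word.mem_iff words]
  simp only [Units.val_mul, mul_assoc]
  exact h.mul_mem_murphyConductor (mem_cubicSpan r)
    (h.cubicSpan_mul_cubicSpan_le_murphyConductor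
      (mul_mem_mul (inv_mem_cubicSpan s) (mem_cubicSpan r)))

theorem wordFilt_le_between_murphy₄ (h : SkeinQuad q e e₁ e₂ r s t w) (hx : x ∈ cubicSpan k w) :
    wordFilt (unitAdjoin k {r, s}) t 1 ≤
      between (quadFilt k r s t w 2) x (murphy₄ s t w : A) := by
  simpa only [murphy₄, Units.val_mul] using h.wordFilt_le_between_of_murphy₃ hx
    (murphy₃_mem_unitAdjoin (by simp) (by simp))
    fun _ hb => (h.mem_murphyConductor_iff hb).1 (h.unitAdjoin_le_murphyConductor hb)

theorem wordFilt_le_between_murphy₄' (h : SkeinQuad q e e₁ e₂ r s t w)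
    (hx : x ∈ cubicSpan k w) :
    wordFilt (unitAdjoin k {r, s}) t 1 ≤
      between (quadFilt k r s t w 2) (murphy₄ s t w : A) x := by
  rw [← opSubmodule_le_between, opSubmodule_wordFilt, op_unitAdjoin_pair, opSubmodule_quadFilt,
    ← val_opUnit, ← murphy₄_op]
  exact h.op.wordFilt_le_between_murphy₄ (by rwa [← opSubmodule_cubicSpan, op_mem_opSubmodule])

theorem pairSpan_le_between (h : SkeinQuad q e e₁ e₂ r s t w) (hz : z ∈ unitAdjoin k {r, s}) :
    pairSpan k s t ≤ between (quadFilt k r s t w 2) (murphy₃ t w * z) w := by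
  refine pairSpan_le (fun n hn => ?_) ?_ <;> rw [mem_between, mul_assoc (murphy₃ t w : A)]
  · exact h.wordFilt_le_between_murphy₃' (mem_cubicSpan w)
      (left_mul_mem_wordFilt hz (wordSpan_le_wordFilt (by simp) hn))
  · exact (h.mem_murphyConductor_iff hz).1 (h.unitAdjoin_le_murphyConductor hz)

theorem murphy₃_mul_conj_mem_of_mem_wordSpan (h : SkeinQuad q e e₁ e₂ r s t w)
    (hb : b ∈ wordSpan k r s) :
    (murphy₃ t w : A) * ((↑s⁻¹ : A) * ((↑t⁻¹ : A) * b * (↑t⁻¹ : A))) * w ∈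
      quadFilt k r s t w 2 := by
  suffices wordSpan k r s ≤ between (quadFilt k r s t w 2)
      (murphy₃ t w * ((↑s⁻¹ : A) * (↑t⁻¹ : A))) ((↑t⁻¹ : A) * w) by
    simpa only [mem_between, mul_assoc] using this hb
  refine mul_mul_le.2 fun x hx y hy z hz => ?_
  have hx' : x ∈ unitAdjoin k {r, s} := cubicSpan_le_unitAdjoin (by simp) hx
  have hz' : z ∈ unitAdjoin k {r, s} := cubicSpan_le_unitAdjoin (by simp) hz
  have middle := mem_between.1 (h.pairSpan_le_between (z := (↑s⁻¹ : A) * x)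
    (mul_mem (inv_mem_unitAdjoin (by simp)) hx')
    (h.left.right.alternating_le_pairSpan
      (mul_mem_mul (mul_mem_mul (inv_mem_cubicSpan t) hy) (inv_mem_cubicSpan t))))
  rw [mem_between]
  convert right_mul_mem_wordFilt middle (unitAdjoin_pair_le_triple hz') using 1
  simp only [mul_assoc, ← (h.commute_of_mem hz' (mem_cubicSpan w)).eq,
    (h.left.commute_of_mem hz (inv_mem_cubicSpan t)).left_comm,
    (h.left.commute_of_mem hx (inv_mem_cubicSpan t)).left_comm]

theorem murphy₃_mul_conj_mem (h : SkeinQuad q e e₁ e₂ r s t w) (hb : b ∈ unitAdjoin k {r, s}) :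
    (murphy₃ t w : A) * ((↑s⁻¹ : A) * ((↑t⁻¹ : A) * b * (↑t⁻¹ : A))) * w ∈
      quadFilt k r s t w 2 := by
  suffices pairSpan k r s ≤ between (quadFilt k r s t w 2)
      (murphy₃ t w * ((↑s⁻¹ : A) * (↑t⁻¹ : A))) ((↑t⁻¹ : A) * w) by
    simpa only [mem_between, mul_assoc] using this (h.left.left.unitAdjoin_le_pairSpan hb)
  have words : wordSpan k r s ≤ between (quadFilt k r s t w 2)
      (murphy₃ t w * ((↑s⁻¹ : A) * (↑t⁻¹ : A))) ((↑t⁻¹ : A) * w) := fun z hz => by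
    simpa only [mem_between, mul_assoc] using h.murphy₃_mul_conj_mem_of_mem_wordSpan hz
  refine pairSpan_le words ?_
  rw [← h.left.left.unitCongr_murphy₃_inv.mem_iff words]
  have hs : (↑s⁻¹ : A) ∈ unitAdjoin k {r, s} := by simp
  have factor : (↑(murphy₃ r s)⁻¹ : A) * (↑t⁻¹ : A) ∈ wordFilt (unitAdjoin k {r, s}) t 1 :=
    left_mul_mem_wordFilt (by simp) (cubicSpan_le_wordFilt (inv_mem_cubicSpan t))
  have low := right_mul_mem_wordFilt
    ((h.right.right.unitCongr_murphy₃_mul_inv.mul_mul_mem_wordFilt_iff' (by simp)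
      (mem_cubicSpan w) (wordFilt_le_unitAdjoin factor)).2
      (h.wordFilt_le_between_murphy₃' (mem_cubicSpan w) factor)) (unitAdjoin_pair_le_triple hs)
  have comm := (h.left.commute_murphy₄_inv hs).left_comm w
  rw [mem_between]
  convert low using 1
  simp only [murphy₄, mul_inv_rev, Units.val_mul, mul_assoc] at comm ⊢
  rw [comm, (h.commute_of_mem hs (mem_cubicSpan w)).eq]

theorem murphy₃_mul_mem_between (h : SkeinQuad q e e₁ e₂ r s t w) (hx : x ∈ cubicSpan k w)
    (hb : b ∈ unitAdjoin k {r, s}) :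
    (murphy₃ s t : A) * b ∈ between (quadFilt k r s t w 2) x (murphy₃ t w) := by
  have hb' := unitAdjoin_pair_le_triple (t := t) hb
  have mem_triple : (murphy₃ s t : A) * b ∈ unitAdjoin k {r, s, t} := mul_mem (by simp) hb'
  refine (h.right.right.unitCongr_murphy₃_word.mul_mul_mem_wordFilt_iff (by simp) hx
    mem_triple).2 ?_
  rw [mul_assoc, ← mem_between_one_left]
  have comm := (h.commute_of_mem hb (mem_cubicSpan w)).left_comm
  refine cubicSpan_le.2 ⟨?_, ?_, ?_⟩ hx <;> rw [mem_between_one_left]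
  · rw [one_mul]
    refine left_mul_mem_wordFilt mem_triple ?_
    simp only [Units.val_mul]
    exact mul_mul_mem_wordFilt_two (cubicSpan_le_wordFilt (mem_cubicSpan w)) (by simp)
      (cubicSpan_le_wordFilt (mem_cubicSpan w))
  · have dual := h.wordFilt_le_between_murphy₄' (mem_cubicSpan w)
      (left_mul_mem_wordFilt hb (cubicSpan_le_wordFilt (inv_mem_cubicSpan t)))
    simpa only [mem_between, murphy₄, Units.val_mul, mul_assoc, comm] using dual
  · have conj : (↑w⁻¹ : A) * (murphy₃ s t * (w * (b * ((↑t⁻¹ : A) * w)))) =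
        t * (s * (murphy₃ t w * ((↑s⁻¹ : A) * ((↑t⁻¹ : A) * (b * ((↑t⁻¹ : A) * w)))))) := by
      simpa only [Units.val_mul, mul_assoc] using
        congrArg (fun g : Aˣ => (g : A) * (b * ((↑t⁻¹ : A) * w)))
          (murphy₃_conj_inv h.right.left.braid h.right.right.braid h.right.comm)
    have low := left_mul_mem_wordFilt (S := unitAdjoin k {r, s, t}) (x := (t : A) * s)
      (mul_mem (by simp) (by simp)) (h.murphy₃_mul_conj_mem hb)
    simpa only [mul_assoc, Units.val_mul, comm, conj] using low

theorem unitAdjoin_le_between_murphy₃ (h : SkeinQuad q e e₁ e₂ r s t w)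
    (hx : x ∈ cubicSpan k w) :
    (unitAdjoin k {r, s, t}).toSubmodule ≤
      between (quadFilt k r s t w 2) x (murphy₃ t w : A) := by
  have stable (a : A) (ha : a ∈ unitAdjoin k {r, s}) (p : A)
      (hp : p ∈ between (quadFilt k r s t w 2) x (murphy₃ t w : A)) :
      a * p ∈ between (quadFilt k r s t w 2) x (murphy₃ t w : A) :=
    left_mul_mem_between (h.commute_of_mem ha hx)
      (fun _ => left_mul_mem_wordFilt (unitAdjoin_pair_le_triple ha)) hp
  refine h.left.unitAdjoin_le_of_left_stable stable (h.wordFilt_le_between_murphy₃ hx)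
    (fun b hb => h.murphy₃_mul_mem_between hx hb) ?_ ?_
  · have factor : (t : A) * murphy₃ r s ∈ wordFilt (unitAdjoin k {r, s}) t 1 :=
      right_mul_mem_wordFilt (cubicSpan_le_wordFilt (mem_cubicSpan t)) (by simp)
    have absorb := (h.right.right.unitCongr_mul_murphy₃.mul_mul_mem_wordFilt_iff
      (by simp) hx (wordFilt_le_unitAdjoin factor)).2 (h.wordFilt_le_between_murphy₃ hx factor)
    simpa only [mem_between, murphy₄, Units.val_mul, mul_assoc] using absorb
  · have factor : (↑t⁻¹ : A) * (↑(murphy₃ r s)⁻¹ : A) ∈ wordFilt (unitAdjoin k {r, s}) t 1 :=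
      right_mul_mem_wordFilt (cubicSpan_le_wordFilt (inv_mem_cubicSpan t)) (by simp)
    have absorb := ((h.right.right.unitCongr_mul_murphy₃.inv_mul fun y hy =>
      h.right.right.mul_mem_wordSpan (inv_mem_cubicSpan t) hy).mul_mul_mem_wordFilt_iff
      (by simp) hx (wordFilt_le_unitAdjoin factor)).2 (h.wordFilt_le_between_murphy₃ hx factor)
    simpa only [mem_between, murphy₄, mul_inv_rev, Units.val_mul, mul_assoc] using absorb

theorem unitAdjoin_le_between_murphy₃' (h : SkeinQuad q e e₁ e₂ r s t w)
    (hx : x ∈ cubicSpan k w) :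
    (unitAdjoin k {r, s, t}).toSubmodule ≤
      between (quadFilt k r s t w 2) (murphy₃ t w : A) x := by
  rw [← opSubmodule_le_between, opSubmodule_toSubmodule, op_unitAdjoin, Set.image_insert_eq,
    Set.image_pair, opSubmodule_quadFilt, ← val_opUnit, ← murphy₃_op]
  exact h.op.unitAdjoin_le_between_murphy₃ (by rwa [← opSubmodule_cubicSpan, op_mem_opSubmodule])

end SkeinQuad

section TopDegree

variable {k A : Type*} [CommRing k] [Ring A] [Algebra k A] {r s t w : Aˣ} {x y : A}

/-- The bimodule generated by the words of degree at most one in `w` and by the Jucys–Murphy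
element of `t` and `w`. It is a part of the words of degree at most two which stays of degree at
most two after multiplication by `w` or `w⁻¹`. -/
def murphySpan (k : Type*) {A : Type*} [CommRing k] [Ring A] [Algebra k A] (r s t w : Aˣ) :
    Submodule k A :=
  quadFilt k r s t w 1 ⊔ (unitAdjoin k {r, s, t}).toSubmodule * span k {(murphy₃ t w : A)} *
    (unitAdjoin k {r, s, t}).toSubmodule

theorem left_mul_mem_murphySpan (hx : x ∈ unitAdjoin k {r, s, t})
    (hy : y ∈ murphySpan k r s t w) : x * y ∈ murphySpan k r s t w := by
  have absorb := mul_mem_mul (M := (unitAdjoin k {r, s, t}).toSubmodule) hx hy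
  rwa [murphySpan, quadFilt, wordFilt_one, Submodule.mul_sup, ← mul_assoc, ← mul_assoc, ← mul_assoc,
    ← mul_assoc, (Subalgebra.isIdempotentElem_toSubmodule _).eq, ← wordFilt_one] at absorb

theorem right_mul_mem_murphySpan (hx : x ∈ murphySpan k r s t w)
    (hy : y ∈ unitAdjoin k {r, s, t}) : x * y ∈ murphySpan k r s t w := by
  have absorb := mul_mem_mul (N := (unitAdjoin k {r, s, t}).toSubmodule) hx hy
  rwa [murphySpan, Submodule.sup_mul, wordFilt_mul_toSubmodule, mul_assoc,
    (Subalgebra.isIdempotentElem_toSubmodule _).eq] at absorb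

theorem murphy₃_mem_murphySpan : (murphy₃ t w : A) ∈ murphySpan k r s t w := by
  refine mem_sup_right ?_
  simpa only [one_mul, mul_one] using mul_mem_mul
    (mul_mem_mul (M := (unitAdjoin k {r, s, t}).toSubmodule) (one_mem (unitAdjoin k {r, s, t}))
      (mem_span_singleton_self (murphy₃ t w : A)))
    (N := (unitAdjoin k {r, s, t}).toSubmodule) (one_mem (unitAdjoin k {r, s, t}))

/-- The word of degree three in `w` whose right multiples account, modulo words of smaller degree,
for the products `x * y * murphy₄ s t w` with `x` in `cubicSpan k w` and `y` in the algebra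
generated by `r`, `s` and `t`. -/
def topWord (r s t w : Aˣ) : Aˣ := w * (t⁻¹ * s * t⁻¹ * (r * s⁻¹ * r)) * murphy₄ s t w

/-- The words of degree at most two in `w` together with the right multiples of `topWord`. -/
def halfSpan (k : Type*) {A : Type*} [CommRing k] [Ring A] [Algebra k A] (r s t w : Aˣ) :
    Submodule k A :=
  quadFilt k r s t w 2 ⊔ span k {(topWord r s t w : A)} * (unitAdjoin k {r, s, t}).toSubmodule

theorem quadFilt_le_halfSpan : quadFilt k r s t w 2 ≤ halfSpan k r s t w := le_sup_left

theorem topWord_mem_halfSpan : (topWord r s t w : A) ∈ halfSpan k r s t w := by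
  refine mem_sup_right ?_
  simpa only [mul_one] using mul_mem_mul (mem_span_singleton_self (topWord r s t w : A))
    (N := (unitAdjoin k {r, s, t}).toSubmodule) (one_mem (unitAdjoin k {r, s, t}))

theorem right_mul_mem_halfSpan (hx : x ∈ halfSpan k r s t w) (hy : y ∈ unitAdjoin k {r, s, t}) :
    x * y ∈ halfSpan k r s t w := by
  have absorb := mul_mem_mul (N := (unitAdjoin k {r, s, t}).toSubmodule) hx hy
  rwa [halfSpan, Submodule.sup_mul, wordFilt_mul_toSubmodule, mul_assoc,
    (Subalgebra.isIdempotentElem_toSubmodule _).eq] at absorb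

theorem mul_inv_mul_mem_unitAdjoin : ((r * s⁻¹ * r : Aˣ) : A) ∈ unitAdjoin k {r, s} := by
  simp only [Units.val_mul]
  exact mul_mem (mul_mem (by simp) (by simp)) (by simp)

end TopDegree

namespace SkeinQuad

variable {k A : Type*} [CommRing k] [Ring A] [Algebra k A] {q e : kˣ} {e₁ e₂ : k}
  {r s t w : Aˣ} {x y z : A}

theorem murphySpan_le_between (h : SkeinQuad q e e₁ e₂ r s t w) (hx : x ∈ cubicSpan k w)
    (hy : y ∈ unitAdjoin k {r, s, t}) :
    murphySpan k r s t w ≤ between (quadFilt k r s t w 2) (x * y) 1 := by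
  refine sup_le (fun z hz => mem_between_one_right.2 (mul_mul_mem_wordFilt_two
    (cubicSpan_le_wordFilt hx) hy hz))
    (mul_mul_le.2 fun a ha p hp b hb => ?_)
  obtain ⟨c, rfl⟩ := mem_span_singleton.1 hp
  have low := smul_mem _ c (right_mul_mem_wordFilt
    (mem_between.1 <| h.unitAdjoin_le_between_murphy₃ hx (Subalgebra.mul_mem _ hy ha)) hb)
  simpa only [mem_between_one_right, mul_smul_comm, smul_mul_assoc, mul_assoc] using low

theorem murphySpan_le_between' (h : SkeinQuad q e e₁ e₂ r s t w) (hx : x ∈ cubicSpan k w)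
    (hy : y ∈ unitAdjoin k {r, s, t}) :
    murphySpan k r s t w ≤ between (quadFilt k r s t w 2) 1 (y * x) := by
  refine sup_le (fun z hz => ?_)
    (mul_mul_le.2 fun a ha p hp b hb => ?_)
  · rw [mem_between_one_left, ← mul_assoc]
    exact mul_mul_mem_wordFilt_two hz hy (cubicSpan_le_wordFilt hx)
  obtain ⟨c, rfl⟩ := mem_span_singleton.1 hp
  have low := smul_mem _ c (left_mul_mem_wordFilt ha
    (mem_between.1 <| h.unitAdjoin_le_between_murphy₃' hx (Subalgebra.mul_mem _ hb hy)))
  simpa only [mem_between_one_left, mul_smul_comm, smul_mul_assoc, mul_assoc] using low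

theorem alternatingSpan_le_murphySpan (h : SkeinQuad q e e₁ e₂ r s t w) :
    alternatingSpan k s t w ≤ murphySpan k r s t w := by
  have pair : pairSpan k t w ≤ murphySpan k r s t w :=
    pairSpan_le ((wordSpan_le_wordFilt (by simp)).trans le_sup_left) murphy₃_mem_murphySpan
  refine mul_mul_le.2 fun x hx y hy z hz => right_mul_mem_murphySpan (left_mul_mem_murphySpan ?_
    (pair (h.right.right.alternating_le_pairSpan hy))) ?_
  exacts [unitAdjoin_mono (Set.subset_insert _ _) hx, unitAdjoin_mono (Set.subset_insert _ _) hz]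

theorem unitCongr_left_mul_murphy₄ (h : SkeinQuad q e e₁ e₂ r s t w) :
    UnitCongr (murphySpan k r s t w) ((s : A) * murphy₄ s t w) (murphy₄ s t w) := by
  have absorb := (h.left.right.unitCongr_mul_murphy₃ (k := k)).mul_mul
    fun _ hz => mem_between.2 (h.alternatingSpan_le_murphySpan
      (h.right.wordSpan_le_between (mem_cubicSpan w) (mem_cubicSpan w) hz))
  simpa only [murphy₄, Units.val_mul, mul_assoc, h.right.comm.symm.units_val.left_comm] using absorb

/-- Conjugation by `s t` takes `s` to `t` and fixes `murphy₄ s t w`. -/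
theorem unitCongr_middle_mul_murphy₄ (h : SkeinQuad q e e₁ e₂ r s t w) :
    UnitCongr (murphySpan k r s t w) ((t : A) * murphy₄ s t w) (murphy₄ s t w) := by
  have conj : s * t * s * (s * t)⁻¹ = t := by
    rw [h.left.right.braid]
    group
  have mem : ((s * t : Aˣ) : A) ∈ unitAdjoin k {s, t} := by
    rw [Units.val_mul]
    exact mul_mem (by simp) (by simp)
  have mem_inv : (↑(s * t)⁻¹ : A) ∈ unitAdjoin k {s, t} := by
    rw [mul_inv_rev, Units.val_mul]
    exact mul_mem (by simp) (by simp)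
  have conjugate := h.unitCongr_left_mul_murphy₄.mul_mul (a := ((s * t : Aˣ) : A))
    (b := (↑(s * t)⁻¹ : A)) fun z hz => mem_between.2 <| right_mul_mem_murphySpan
      (left_mul_mem_murphySpan (unitAdjoin_mono (Set.subset_insert _ _) mem) hz)
      (unitAdjoin_mono (Set.subset_insert _ _) mem_inv)
  simp only [mul_assoc, ← (h.right.commute_murphy₄ mem_inv).eq] at conjugate
  simpa only [← mul_assoc, ← Units.val_mul, conj, mul_inv_cancel, one_mul] using conjugate

theorem mul_murphy₄_mem (h : SkeinQuad q e e₁ e₂ r s t w) (hx : x ∈ unitAdjoin k {s, t}) :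
    x * murphy₄ s t w ∈ murphySpan k r s t w ⊔ span k {(murphy₄ s t w : A)} := by
  refine mul_mem_sup_span_of_unitCongr (fun y hy _ => left_mul_mem_murphySpan
    (unitAdjoin_mono (Set.subset_insert _ _) hy)) ?_ hx
    (mem_sup_right (mem_span_singleton_self _))
  rintro g (rfl | rfl)
  exacts [h.unitCongr_left_mul_murphy₄, h.unitCongr_middle_mul_murphy₄]

theorem wordFilt_mul_unitAdjoin_le_between_murphy₄ (h : SkeinQuad q e e₁ e₂ r s t w)
    (hx : x ∈ cubicSpan k w) :
    wordFilt (unitAdjoin k {r, s}) t 1 * (unitAdjoin k {s, t}).toSubmodule ≤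
      between (quadFilt k r s t w 2) x (murphy₄ s t w : A) := by
  refine mul_le.2 fun y hy z hz => ?_
  have absorb : murphySpan k r s t w ⊔ span k {(murphy₄ s t w : A)} ≤
      between (quadFilt k r s t w 2) (x * y) 1 := by
    refine sup_le (h.murphySpan_le_between hx (wordFilt_le_unitAdjoin hy)) ?_
    rw [span_singleton_le_iff_mem, mem_between_one_right]
    exact h.wordFilt_le_between_murphy₄ hx hy
  simpa only [mem_between, mul_one, mul_assoc] using absorb (h.mul_murphy₄_mem hz)

theorem left_mul_topWord (h : SkeinQuad q e e₁ e₂ r s t w) :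
    r * topWord r s t w = topWord r s t w * t := by
  have comm : t * murphy₄ s t w = murphy₄ s t w * t := by
    simpa only [← Units.val_mul, Units.val_inj] using
      (h.right.commute_murphy₄ (k := k) (coe_mem_unitAdjoin (g := t) (by simp))).eq
  have comm_inv : r * t⁻¹ = t⁻¹ * r := h.left.comm.inv_right.eq
  calc r * topWord r s t w = r * w * t⁻¹ * s * (t⁻¹ * r) * s⁻¹ * r * murphy₄ s t w := by
        simp only [topWord, mul_assoc]
    _ = w * (r * t⁻¹) * s * r * t⁻¹ * s⁻¹ * r * murphy₄ s t w := by
        rw [← comm_inv, h.comm.eq]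
        simp only [mul_assoc]
    _ = w * t⁻¹ * (r * s * r) * t⁻¹ * s⁻¹ * r * murphy₄ s t w := by
        rw [comm_inv]
        simp only [mul_assoc]
    _ = w * t⁻¹ * s * r * (s * t⁻¹ * s⁻¹) * r * murphy₄ s t w := by
        rw [h.left.left.braid]
        simp only [mul_assoc]
    _ = w * t⁻¹ * s * (r * t⁻¹) * s⁻¹ * (t * r) * murphy₄ s t w := by
        rw [braid_conj_inv h.left.right.braid]
        simp only [mul_assoc]
    _ = w * t⁻¹ * s * t⁻¹ * r * s⁻¹ * r * (t * murphy₄ s t w) := by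
        rw [comm_inv, ← h.left.comm.eq]
        simp only [mul_assoc]
    _ = topWord r s t w * t := by
        rw [comm]
        simp only [topWord, mul_assoc]

theorem wordSpan_le_between_word_mul_murphy₄ (h : SkeinQuad q e e₁ e₂ r s t w) :
    wordSpan k s t ≤ between (quadFilt k r s t w 2) w
      (((r * s⁻¹ * r : Aˣ) : A) * murphy₄ s t w) := fun z hz => by
  simpa only [mem_between, mul_assoc] using h.wordFilt_le_between_murphy₄ (mem_cubicSpan w)
    (right_mul_mem_wordFilt (wordSpan_le_wordFilt (by simp) hz) mul_inv_mul_mem_unitAdjoin)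

theorem pairSpan_le_between_word_mul_murphy₄ (h : SkeinQuad q e e₁ e₂ r s t w) :
    pairSpan k s t ≤ between (halfSpan k r s t w) w
      (((r * s⁻¹ * r : Aˣ) : A) * murphy₄ s t w) := by
  have words := h.wordSpan_le_between_word_mul_murphy₄.trans (between_mono quadFilt_le_halfSpan)
  refine pairSpan_le words ((h.left.right.unitCongr_inv_word.mem_iff words).1 ?_)
  simpa only [mem_between, topWord, Units.val_mul, mul_assoc] using
    topWord_mem_halfSpan (k := k) (r := r) (s := s) (t := t) (w := w)

theorem unitCongr_topWord (h : SkeinQuad q e e₁ e₂ r s t w) :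
    UnitCongr (quadFilt k r s t w 2) (topWord r s t w : A)
      (murphy₄ s t w * (((r * s⁻¹ * r : Aˣ) : A) * murphy₃ s t) * w) := by
  have congr := h.left.right.unitCongr_inv_word.mul_mul h.wordSpan_le_between_word_mul_murphy₄
  have comm := (h.commute_of_mem mul_inv_mul_mem_unitAdjoin (mem_cubicSpan w)).left_comm
  simp only [topWord, murphy₄, Units.val_mul, mul_assoc] at congr comm ⊢
  simpa only [comm] using congr

theorem middle_mul_topWord_mem (h : SkeinQuad q e e₁ e₂ r s t w) (hx : x ∈ cubicSpan k t) :
    x * topWord r s t w ∈ halfSpan k r s t w := by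
  have hx' : x ∈ unitAdjoin k {r, s, t} := cubicSpan_le_unitAdjoin (by simp) hx
  rw [(h.unitCongr_topWord.mul_left fun _ => left_mul_mem_wordFilt hx').mem_iff
    quadFilt_le_halfSpan]
  suffices murphySpan k r s t w ⊔ span k {(murphy₄ s t w : A)} ≤ between (halfSpan k r s t w) 1
      ((((r * s⁻¹ * r : Aˣ) : A) * murphy₃ s t) * w) by
    simpa only [mem_between_one_left, mul_assoc] using
      this (h.mul_murphy₄_mem (cubicSpan_le_unitAdjoin (by simp) hx))
  refine sup_le (fun z hz => quadFilt_le_halfSpan (h.murphySpan_le_between' (mem_cubicSpan w)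
    (mul_mem (unitAdjoin_pair_le_triple mul_inv_mul_mem_unitAdjoin) (by simp)) hz)) ?_
  rw [span_singleton_le_iff_mem, mem_between_one_left, ← mul_assoc,
    ← h.unitCongr_topWord.mem_iff quadFilt_le_halfSpan]
  exact topWord_mem_halfSpan

theorem left_mul_mem_halfSpan (h : SkeinQuad q e e₁ e₂ r s t w) (hx : x ∈ unitAdjoin k {r, s, t})
    (hy : y ∈ halfSpan k r s t w) : x * y ∈ halfSpan k r s t w := by
  refine mul_mem_sup_span_mul (fun _ ha _ => left_mul_mem_wordFilt ha)
    (fun _ hb _ => right_mul_mem_wordFilt hb) ?_ hx hy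
  have middle (z : A) (hz : z ∈ cubicSpan k s) :
      z * topWord r s t w ∈ halfSpan k r s t w := by
    have comm := (h.commute_of_mem (cubicSpan_le_unitAdjoin (by simp) hz)
      (mem_cubicSpan w)).left_comm
    have high := h.pairSpan_le_between_word_mul_murphy₄ (h.left.right.mul_mem_pairSpan hz
      (h.left.right.alternating_le_pairSpan (mul_mem_mul (mul_mem_mul (inv_mem_cubicSpan t)
        (mem_cubicSpan s)) (inv_mem_cubicSpan t))))
    simpa only [mem_between, topWord, Units.val_mul, mul_assoc, comm] using high
  rintro g (rfl | rfl | rfl)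
  · have conj_inv : g⁻¹ * topWord g s t w = topWord g s t w * t⁻¹ := by
      rw [inv_mul_eq_iff_eq_mul, ← mul_assoc, h.left_mul_topWord, mul_inv_cancel_right]
    rw [← Units.val_mul, ← Units.val_mul, h.left_mul_topWord, conj_inv, Units.val_mul,
      Units.val_mul]
    exact ⟨right_mul_mem_halfSpan topWord_mem_halfSpan (by simp),
      right_mul_mem_halfSpan topWord_mem_halfSpan (by simp)⟩
  · exact ⟨middle _ (mem_cubicSpan g), middle _ (inv_mem_cubicSpan g)⟩
  · exact ⟨h.middle_mul_topWord_mem (mem_cubicSpan g),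
      h.middle_mul_topWord_mem (inv_mem_cubicSpan g)⟩

end SkeinQuad

namespace SkeinQuad

variable {k A : Type*} [CommRing k] [Ring A] [Algebra k A] {q e : kˣ} {e₁ e₂ : k}
  {r s t w : Aˣ} {x y b : A}

theorem cubicSpan_le_between_murphy₃_mul_word (h : SkeinQuad q e e₁ e₂ r s t w) :
    cubicSpan k w ≤ between (halfSpan k r s t w) 1
      ((murphy₃ s t : A) * ((r * s⁻¹ * r : Aˣ) : A) * murphy₄ s t w) := by
  have word_mem := unitAdjoin_pair_le_triple (t := t)
    (mul_inv_mul_mem_unitAdjoin (k := k) (r := r) (s := s))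
  refine cubicSpan_le.2 ⟨?_, ?_, ?_⟩ <;> rw [mem_between_one_left]
  · rw [one_mul]
    exact quadFilt_le_halfSpan
      (left_mul_mem_wordFilt (mul_mem (by simp) word_mem) murphy₄_mem_quadFilt)
  · simpa only [mem_between, mul_assoc] using
      h.pairSpan_le_between_word_mul_murphy₄ (murphy₃_mem_pairSpan (k := k) (s := s) (t := t))
  · have comm := (h.commute_of_mem mul_inv_mul_mem_unitAdjoin (mem_cubicSpan w)).left_comm
    have conj (z : A) : (↑w⁻¹ : A) * (murphy₃ s t * (w * z)) =
        t * (s * (murphy₃ t w * ((↑s⁻¹ : A) * ((↑t⁻¹ : A) * z)))) := by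
      simpa only [Units.val_mul, mul_assoc] using congrArg (fun g : Aˣ => (g : A) * z)
        (murphy₃_conj_inv h.right.left.braid h.right.right.braid h.right.comm)
    have low := left_mul_mem_wordFilt (S := unitAdjoin k {r, s, t}) (x := (t : A) * s)
      (mul_mem (by simp) (by simp)) (mem_between.1 (h.unitAdjoin_le_between_murphy₃'
        (mem_cubicSpan w) (Subalgebra.mul_mem _ (x := (↑s⁻¹ : A) * (↑t⁻¹ : A))
          (mul_mem (by simp) (by simp))
          (Subalgebra.mul_mem _ word_mem (y := (murphy₃ s t : A)) (by simp)))))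
    refine quadFilt_le_halfSpan ?_
    simp only [murphy₄, Units.val_mul, mul_assoc] at comm ⊢
    simpa only [comm, conj, Units.val_mul, mul_assoc] using low

theorem pairSpan_le_between_mul_murphy₄ (h : SkeinQuad q e e₁ e₂ r s t w)
    (hx : x ∈ cubicSpan k w) (hy : y ∈ cubicSpan k r) :
    pairSpan k s t ≤ between (halfSpan k r s t w) x (y * murphy₄ s t w) := by
  have hy' : y ∈ unitAdjoin k {r, s} := cubicSpan_le_unitAdjoin (by simp) hy
  refine pairSpan_le (fun n hn => mem_between.2 (quadFilt_le_halfSpan ?_))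
    (mem_between.2 (quadFilt_le_halfSpan ?_))
  · simpa only [mem_between, mul_assoc] using h.wordFilt_le_between_murphy₄ hx
      (right_mul_mem_wordFilt (wordSpan_le_wordFilt (by simp) hn) hy')
  · have factor : (t : A) * (s * s * y) ∈ wordFilt (unitAdjoin k {r, s}) t 1 :=
      right_mul_mem_wordFilt (cubicSpan_le_wordFilt (mem_cubicSpan t))
        (mul_mem (mul_mem (by simp) (by simp)) hy')
    have low := mem_between.1 (h.wordFilt_mul_unitAdjoin_le_between_murphy₄ hx
      (mul_mem_mul factor (coe_mem_unitAdjoin (k := k) (S := {s, t}) (g := t) (by simp))))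
    simpa only [murphy₃, Units.val_mul, mul_assoc, mem_between,
      (h.left.commute_of_mem hy (mem_cubicSpan t)).left_comm] using low

theorem murphy₃_mul_mem_between_murphy₄ (h : SkeinQuad q e e₁ e₂ r s t w)
    (hx : x ∈ cubicSpan k w) (hb : b ∈ unitAdjoin k {r, s}) :
    (murphy₃ s t : A) * b ∈ between (halfSpan k r s t w) x (murphy₄ s t w) := by
  have words : wordSpan k s r ≤
      between (halfSpan k r s t w) (x * murphy₃ s t) (murphy₄ s t w) := by
    refine mul_mul_le.2 fun x₁ hx₁ x₂ hx₂ x₃ hx₃ => ?_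
    have comm := (h.right.commute_murphy₄ (cubicSpan_le_unitAdjoin (by simp) hx₃)).eq
    have mem := right_mul_mem_halfSpan (mem_between.1 (h.pairSpan_le_between_mul_murphy₄ hx hx₂
      (h.left.right.pairSpan_mul_mem murphy₃_mem_pairSpan hx₁)))
      (cubicSpan_le_unitAdjoin (S := {r, s, t}) (by simp) hx₃)
    simpa only [mem_between, mul_assoc, comm] using mem
  rw [Set.pair_comm] at hb
  have mem := pairSpan_le words
    ((h.left.left.symm.unitCongr_murphy₃_word.mem_iff words).2 (by
      simpa only [mem_between, one_mul, mul_assoc] using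
        h.cubicSpan_le_between_murphy₃_mul_word hx)) (h.left.left.symm.unitAdjoin_le_pairSpan hb)
  simpa only [mem_between, mul_assoc] using mem

theorem unitAdjoin_le_between_murphy₄ (h : SkeinQuad q e e₁ e₂ r s t w) (hx : x ∈ cubicSpan k w) :
    (unitAdjoin k {r, s, t}).toSubmodule ≤
      between (halfSpan k r s t w) x (murphy₄ s t w) := by
  have low := (h.wordFilt_mul_unitAdjoin_le_between_murphy₄ hx).trans
    (between_mono quadFilt_le_halfSpan)
  refine h.left.unitAdjoin_le_of_left_stable
    (fun a ha _ => left_mul_mem_between (h.commute_of_mem ha hx)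
      fun _ => h.left_mul_mem_halfSpan (unitAdjoin_pair_le_triple ha))
    ((h.wordFilt_le_between_murphy₄ hx).trans (between_mono quadFilt_le_halfSpan))
    (fun b hb => h.murphy₃_mul_mem_between_murphy₄ hx hb) ?_ ?_
  · have factor : (t : A) * (s * r * r) ∈ wordFilt (unitAdjoin k {r, s}) t 1 :=
      right_mul_mem_wordFilt (cubicSpan_le_wordFilt (mem_cubicSpan t))
        (mul_mem (mul_mem (by simp) (by simp)) (by simp))
    have tail : (s : A) * t ∈ unitAdjoin k {s, t} := mul_mem (by simp) (by simp)
    simpa only [murphy₄, murphy₃, Units.val_mul, mul_assoc] using low (mul_mem_mul factor tail)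
  · have factor : (↑t⁻¹ : A) * ((↑s⁻¹ : A) * (↑r⁻¹ : A) * (↑r⁻¹ : A)) ∈
        wordFilt (unitAdjoin k {r, s}) t 1 :=
      right_mul_mem_wordFilt (cubicSpan_le_wordFilt (inv_mem_cubicSpan t))
        (mul_mem (mul_mem (by simp) (by simp)) (by simp))
    have tail : (↑s⁻¹ : A) * (↑t⁻¹ : A) ∈ unitAdjoin k {s, t} := mul_mem (by simp) (by simp)
    simpa only [murphy₄, murphy₃, mul_inv_rev, Units.val_mul, mul_assoc] using
      low (mul_mem_mul factor tail)

end SkeinQuad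

section Conductor

variable {k A : Type*} [CommRing k] [Ring A] [Algebra k A] {P : Submodule k A} {r s t w : Aˣ}
  {x y z : A}

theorem SkeinPair.unitCongr_gen_mul {q e : kˣ} {e₁ e₂ : k} (h : SkeinPair q e e₁ e₂ s t)
    (hs : ∀ y ∈ P, s * y ∈ P) (hs' : ∀ y ∈ P, (↑s⁻¹ : A) * y ∈ P)
    (h₁ : ∀ y ∈ cubicSpan k t, y * z ∈ P) (h₂ : ∀ y ∈ cubicSpan k t, y * (s * z) ∈ P)
    (h₃ : (↑t⁻¹ : A) * ((↑s⁻¹ : A) * z) ∈ P) :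
    UnitCongr P (s * (t * ((↑s⁻¹ : A) * z))) (t * ((↑s⁻¹ : A) * z)) := by
  have skein := congrArg (· * z) h.skein
  simp only [Units.val_mul, add_mul, sub_mul, smul_mul_assoc, mul_assoc] at skein
  have lower := add_mem (sub_mem (sub_mem (add_mem (sub_mem (add_mem (sub_mem (sub_mem (add_mem
    (hs' _ (h₂ _ (mem_cubicSpan t)))
    (smul_mem P (↑q⁻¹ : k) (hs _ (h₁ _ (mem_cubicSpan t)))))
    (smul_mem P (q : k) (hs _ (h₁ _ (inv_mem_cubicSpan t)))))
    (smul_mem P (q : k) (hs' _ (h₁ _ (mem_cubicSpan t)))))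
    (smul_mem P ((q : k) ^ 3) (hs' _ (h₁ _ (inv_mem_cubicSpan t)))))
    (smul_mem P (↑q⁻¹ : k) (h₂ _ (mem_cubicSpan t))))
    (smul_mem P (q : k) (h₂ _ (inv_mem_cubicSpan t))))
    (smul_mem P ((q : k) ^ 3) h₃))
    (smul_mem P ((q : k) ^ 2) (hs' _ (h₂ _ (inv_mem_cubicSpan t)))))
    (smul_mem P ((q : k) ^ 2) (hs _ h₃))
  refine ⟨q, ?_⟩
  convert lower using 1
  rw [skein]
  abel

/-- The sum of `halfSpan` for the given generators and for their inverses. It turns out to contain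
the whole algebra generated by `r`, `s`, `t` and `w`. -/
def quadSpan (k : Type*) {A : Type*} [CommRing k] [Ring A] [Algebra k A] (r s t w : Aˣ) :
    Submodule k A :=
  halfSpan k r s t w ⊔ halfSpan k r⁻¹ s⁻¹ t⁻¹ w⁻¹

/-- The elements which `quadSpan` absorbs after left multiplication by an element of the algebra
generated by `r`, `s`, `t` and then by an element of `cubicSpan k w`. -/
def quadConductor (k : Type*) {A : Type*} [CommRing k] [Ring A] [Algebra k A] (r s t w : Aˣ) :
    Submodule k A :=
  ⨅ (x ∈ cubicSpan k w) (y ∈ unitAdjoin k {r, s, t}), between (quadSpan k r s t w) (x * y) 1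

theorem mem_quadConductor : z ∈ quadConductor k r s t w ↔
    ∀ x ∈ cubicSpan k w, ∀ y ∈ unitAdjoin k {r, s, t}, x * y * z ∈ quadSpan k r s t w := by
  simp only [quadConductor, mem_iInf, mem_between_one_right]

theorem quadSpan_inv (r s t w : Aˣ) :
    quadSpan k r⁻¹ s⁻¹ t⁻¹ w⁻¹ = quadSpan k r s t w := by
  simp only [quadSpan, inv_inv, sup_comm]

theorem quadConductor_inv (r s t w : Aˣ) :
    quadConductor k r⁻¹ s⁻¹ t⁻¹ w⁻¹ = quadConductor k r s t w := by
  simp only [quadConductor, cubicSpan_inv, unitAdjoin_triple_inv, quadSpan_inv]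

theorem quadFilt_le_quadSpan : quadFilt k r s t w 2 ≤ quadSpan k r s t w :=
  quadFilt_le_halfSpan.trans le_sup_left

theorem right_mul_mem_quadSpan (hx : x ∈ quadSpan k r s t w) (hy : y ∈ unitAdjoin k {r, s, t}) :
    x * y ∈ quadSpan k r s t w := by
  obtain ⟨u, hu, v, hv, rfl⟩ := mem_sup.1 hx
  rw [add_mul]
  exact add_mem (mem_sup_left (right_mul_mem_halfSpan hu hy))
    (mem_sup_right (right_mul_mem_halfSpan hv (by rwa [unitAdjoin_triple_inv])))

theorem right_mul_mem_quadConductor (hz : z ∈ quadConductor k r s t w)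
    (hy : y ∈ unitAdjoin k {r, s, t}) : z * y ∈ quadConductor k r s t w := by
  rw [mem_quadConductor] at hz ⊢
  intro u hu v hv
  rw [← mul_assoc]
  exact right_mul_mem_quadSpan (hz u hu v hv) hy

theorem left_mul_mem_quadConductor (hx : x ∈ unitAdjoin k {r, s, t})
    (hz : z ∈ quadConductor k r s t w) : x * z ∈ quadConductor k r s t w := by
  rw [mem_quadConductor] at hz ⊢
  intro u hu v hv
  rw [← mul_assoc, mul_assoc u]
  exact hz u hu _ (mul_mem hv hx)

theorem gen_mul_mem_quadSpan (hx : x ∈ cubicSpan k w) (hz : z ∈ quadConductor k r s t w) :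
    x * z ∈ quadSpan k r s t w := by
  simpa only [mul_one] using mem_quadConductor.1 hz x hx 1 (one_mem _)

end Conductor

namespace SkeinQuad

variable {k A : Type*} [CommRing k] [Ring A] [Algebra k A] {q e : kˣ} {e₁ e₂ : k}
  {r s t w : Aˣ} {x y z : A}

theorem left_mul_mem_quadSpan (h : SkeinQuad q e e₁ e₂ r s t w) (hx : x ∈ unitAdjoin k {r, s, t})
    (hy : y ∈ quadSpan k r s t w) : x * y ∈ quadSpan k r s t w := by
  obtain ⟨u, hu, v, hv, rfl⟩ := mem_sup.1 hy
  rw [mul_add]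
  exact add_mem (mem_sup_left (h.left_mul_mem_halfSpan hx hu))
    (mem_sup_right (h.inv.left_mul_mem_halfSpan (by rwa [unitAdjoin_triple_inv]) hv))

theorem murphySpan_le_quadConductor (h : SkeinQuad q e e₁ e₂ r s t w) :
    murphySpan k r s t w ≤ quadConductor k r s t w := fun _ hz =>
  mem_quadConductor.2 fun _ hx _ hy => quadFilt_le_quadSpan
    (mem_between_one_right.1 (h.murphySpan_le_between hx hy hz))

theorem murphy₄_mem_quadConductor (h : SkeinQuad q e e₁ e₂ r s t w) :
    (murphy₄ s t w : A) ∈ quadConductor k r s t w :=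
  mem_quadConductor.2 fun _ hx _ hy =>
    mem_sup_left (mem_between.1 (h.unitAdjoin_le_between_murphy₄ hx hy))

theorem tripleSpan_le_quadConductor (h : SkeinQuad q e e₁ e₂ r s t w) :
    tripleSpan k s t w ≤ quadConductor k r s t w := by
  refine sup_le (h.alternatingSpan_le_murphySpan.trans h.murphySpan_le_quadConductor)
    (mul_le.2 fun x hx y hy => right_mul_mem_quadConductor
      (span_le.2 ?_ hx) (unitAdjoin_mono (Set.subset_insert _ _) hy))
  rintro _ (rfl | rfl)
  · exact h.murphy₄_mem_quadConductor
  · simpa only [murphy₄_inv, quadConductor_inv, SetLike.mem_coe] using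
      h.inv.murphy₄_mem_quadConductor

theorem alternatingSpan_le_between (h : SkeinQuad q e e₁ e₂ r s t w) (hx : x ∈ cubicSpan k w)
    (hz : z ∈ cubicSpan k w) :
    alternatingSpan k r s t ≤ between (quadConductor k r s t w) x z := by
  refine mul_mul_le.2 fun a ha m hm b hb => ?_
  have hm' : m ∈ unitAdjoin k {s, t} := cubicSpan_mul_mul_le_unitAdjoin (by simp) (by simp) hm
  have inner : x * m * z ∈ quadConductor k r s t w := h.tripleSpan_le_quadConductor
    (h.right.cubicSpan_mul_mul_cubicSpan_le_tripleSpan (mul_mem_mul (mul_mem_mul hx hm') hz))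
  have comm : x * (a * m * b) * z = a * (x * m * z) * b := by
    simp only [mul_assoc, (h.commute_of_mem hb hz).eq, (h.commute_of_mem ha hx).left_comm]
  rw [mem_between, comm]
  exact right_mul_mem_quadConductor (left_mul_mem_quadConductor (unitAdjoin_pair_le_triple ha)
    inner) (unitAdjoin_pair_le_triple hb)

theorem gen_mul_murphy₄_mul_inv_mem (h : SkeinQuad q e e₁ e₂ r s t w) :
    (w : A) * murphy₄ r s t * (↑w⁻¹ : A) ∈ quadConductor k r s t w := by
  rw [← Units.val_mul, ← Units.val_mul, murphy₄_conj h.left.left.braid h.left.right.braid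
    h.right.right.braid h.left.comm h.comm h.right.comm]
  simp only [Units.val_mul]
  exact right_mul_mem_quadConductor (left_mul_mem_quadConductor
    (mul_mem (mul_mem (by simp) (by simp)) (by simp)) h.murphy₄_mem_quadConductor)
    (mul_mem (mul_mem (by simp) (by simp)) (by simp))

theorem inv_mul_murphy₄_mul_gen_mem (h : SkeinQuad q e e₁ e₂ r s t w) :
    (↑w⁻¹ : A) * murphy₄ r s t * w ∈ quadConductor k r s t w := by
  rw [← Units.val_mul, ← Units.val_mul, murphy₄_conj_inv h.left.left.braid h.left.right.braid
    h.right.right.braid h.left.comm h.comm h.right.comm]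
  simp only [Units.val_mul]
  exact right_mul_mem_quadConductor (left_mul_mem_quadConductor
    (mul_mem (mul_mem (by simp) (by simp)) (by simp)) h.murphy₄_mem_quadConductor)
    (mul_mem (mul_mem (by simp) (by simp)) (by simp))

theorem gen_mul_murphy₄_mul_gen_mem (h : SkeinQuad q e e₁ e₂ r s t w) :
    (w : A) * murphy₄ r s t * w ∈ quadConductor k r s t w := by
  have commute_murphy₃ : Commute w (murphy₃ r s) :=
    (((h.right.comm.mul_left h.comm).mul_left h.comm).mul_left h.right.comm).symm
  have comm : ∀ g ∈ ({r, s, t} : Set Aˣ), Commute (g : A) (w * murphy₄ r s t * w) := by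
    suffices ∀ g ∈ ({r, s, t} : Set Aˣ), Commute g (w * murphy₄ r s t * w) from
      fun g hg => by simpa only [Units.val_mul] using (this g hg).units_val
    rintro g (rfl | rfl | rfl)
    · exact (h.comm.mul_right (commute_left_murphy₄ h.left.left.braid h.left.comm)).mul_right h.comm
    · exact (h.right.comm.mul_right
        (commute_middle_murphy₄ h.left.right.braid h.left.comm)).mul_right h.right.comm
    · exact commute_sandwich_sandwich h.right.right.braid commute_murphy₃.symm
  refine mem_quadConductor.2 fun x hx y hy => quadFilt_le_quadSpan ?_
  rw [mul_assoc x, (commute_of_mem_unitAdjoin comm hy).eq, ← mul_assoc]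
  exact h.right.right.cubic_right.mul_gen_mul_gen_mul_mem_wordFilt hx
    (murphy₄_mem_unitAdjoin (by simp) (by simp) (by simp)) hy

theorem unitCongr_mul_gen_mul_murphy₄_inv (h : SkeinQuad q e e₁ e₂ r s t w) :
    UnitCongr (quadConductor k r s t w) (t * (w * (murphy₄ r s t)⁻¹ * w : Aˣ))
      (w * (murphy₄ r s t)⁻¹ * w : Aˣ) := by
  set c : A := ↑(murphy₃ r s)⁻¹ with c_def
  have hc : c ∈ unitAdjoin k {r, s} := by simp [c_def]
  have low {m : A} (hm : m ∈ alternatingSpan k r s t) (y : A) (hy : y ∈ cubicSpan k w) :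
      y * (m * w) ∈ quadConductor k r s t w := by
    rw [← mul_assoc]
    exact h.alternatingSpan_le_between hy (mem_cubicSpan w) hm
  have mixed := h.inv.gen_mul_murphy₄_mul_inv_mem
  rw [murphy₄_inv, quadConductor_inv, inv_inv] at mixed
  have congr := h.right.right.unitCongr_gen_mul (P := quadConductor k r s t w)
    (z := c * (↑t⁻¹ : A) * w)
    (fun _ => left_mul_mem_quadConductor (by simp))
    (fun _ => left_mul_mem_quadConductor (by simp))
    (low (left_mul_mem_alternatingSpan hc (wordFilt_le_alternatingSpan
      (cubicSpan_le_wordFilt (inv_mem_cubicSpan t)))))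
    (by simpa only [mul_assoc] using
      low (mem_between.1 (h.left.unitAdjoin_pair_le_between_inv hc)))
    (by simpa only [murphy₄, mul_inv_rev, Units.val_mul, mul_assoc, c_def] using mixed)
  simpa only [murphy₄, mul_inv_rev, Units.val_mul, mul_assoc, c_def] using congr

theorem unitAdjoin_mul_gen_mul_murphy₄_inv_mem (h : SkeinQuad q e e₁ e₂ r s t w)
    (hy : y ∈ unitAdjoin k {r, s, t}) :
    y * (w * (murphy₄ r s t)⁻¹ * w : Aˣ) ∈ quadConductor k r s t w ⊔
      span k {((w * (murphy₄ r s t)⁻¹ * w : Aˣ) : A)} * (unitAdjoin k {r, s, t}).toSubmodule := by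
  set v : Aˣ := w * (murphy₄ r s t)⁻¹ * w with v_def
  set D := span k {(v : A)} * (unitAdjoin k {r, s, t}).toSubmodule with D_def
  have mul_mem_D {x : A} (hx : x ∈ unitAdjoin k {r, s, t}) : (v : A) * x ∈ D :=
    mul_mem_mul (mem_span_singleton_self (v : A)) hx
  have v_mem : (v : A) ∈ D := by simpa only [mul_one] using mul_mem_D (one_mem _)
  have pair_mem {x : A} (hx : x ∈ unitAdjoin k {r, s}) : x * v ∈ D := by
    have comm : Commute x (v : A) := by
      have cw := h.commute_of_mem hx (mem_cubicSpan w)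
      simpa only [v_def, Units.val_mul] using
        (cw.mul_right (h.left.commute_murphy₄_inv hx)).mul_right cw
    rw [comm.eq]
    exact mul_mem_D (unitAdjoin_pair_le_triple hx)
  have congr := h.unitCongr_mul_gen_mul_murphy₄_inv
  have congr' := congr.inv_mul fun y => left_mul_mem_quadConductor (inv_mem_unitAdjoin (by simp))
  refine mul_mem_sup_span_mul (fun x hx b => left_mul_mem_quadConductor hx)
    (fun b hb x => right_mul_mem_quadConductor hb) ?_ hy (mem_sup_right v_mem)
  rintro g (rfl | rfl | rfl)
  · exact ⟨mem_sup_right (pair_mem (by simp)), mem_sup_right (pair_mem (by simp))⟩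
  · exact ⟨mem_sup_right (pair_mem (by simp)), mem_sup_right (pair_mem (by simp))⟩
  · exact ⟨(congr.mem_iff le_sup_left).2 (mem_sup_right v_mem),
      (congr'.mem_iff le_sup_left).2 (mem_sup_right v_mem)⟩

theorem gen_mul_murphy₄_inv_mul_gen_mem (h : SkeinQuad q e e₁ e₂ r s t w) :
    (w : A) * (↑(murphy₄ r s t)⁻¹ : A) * w ∈ quadConductor k r s t w := by
  refine mem_quadConductor.2 fun x hx y hy => ?_
  have sup := h.unitAdjoin_mul_gen_mul_murphy₄_inv_mem hy
  simp only [Units.val_mul] at sup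
  obtain ⟨u, hu, v, hv, huv⟩ := mem_sup.1 sup
  obtain ⟨c, hc, rfl⟩ := mem_span_singleton_mul.1 hv
  rw [mul_assoc, ← huv, mul_add]
  refine add_mem (gen_mul_mem_quadSpan hx hu) (quadFilt_le_quadSpan ?_)
  rw [← mul_assoc]
  exact h.right.right.cubic_right.mul_gen_mul_gen_mul_mem_wordFilt hx
    (murphy₄_inv_mem_unitAdjoin (by simp) (by simp) (by simp)) hc

theorem cubicSpan_mul_murphy₄_mul_cubicSpan_le (h : SkeinQuad q e e₁ e₂ r s t w) :
    cubicSpan k w * span k {(murphy₄ r s t : A)} * cubicSpan k w ≤ quadConductor k r s t w := by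
  have low : quadFilt k r s t w 1 ≤ quadConductor k r s t w :=
    le_sup_left.trans h.murphySpan_le_quadConductor
  have murphy_mem : (murphy₄ r s t : A) ∈ unitAdjoin k {r, s, t} :=
    murphy₄_mem_unitAdjoin (by simp) (by simp) (by simp)
  have right {x : A} (hx : x ∈ cubicSpan k w) :
      (murphy₄ r s t : A) * x ∈ quadConductor k r s t w :=
    low (left_mul_mem_wordFilt murphy_mem (cubicSpan_le_wordFilt hx))
  have left {x : A} (hx : x ∈ cubicSpan k w) :
      x * (murphy₄ r s t : A) ∈ quadConductor k r s t w :=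
    low (right_mul_mem_wordFilt (cubicSpan_le_wordFilt hx) murphy_mem)
  have extend {a b : A} (hab : a * murphy₄ r s t * b ∈ quadConductor k r s t w) :
      span k {(murphy₄ r s t : A)} ≤ between (quadConductor k r s t w) a b :=
    (span_singleton_le_iff_mem _ _).2 hab
  have inv_inv_mem := h.inv.gen_mul_murphy₄_inv_mul_gen_mem
  rw [murphy₄_inv, inv_inv, quadConductor_inv] at inv_inv_mem
  refine cubicSpan_mul_mul_cubicSpan_le ?_ ?_ ?_ ?_ ?_
    (extend h.gen_mul_murphy₄_mul_gen_mem) (extend h.gen_mul_murphy₄_mul_inv_mem)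
    (extend h.inv_mul_murphy₄_mul_gen_mem) (extend inv_inv_mem)
  · exact (span_singleton_le_iff_mem _ _).2 (by
      simpa only [mul_one] using right (one_mem_cubicSpan w))
  · exact fun y hy => mem_between_one_left.1
      (extend (by simpa only [one_mul] using right (mem_cubicSpan w)) hy)
  · exact fun y hy => mem_between_one_left.1
      (extend (by simpa only [one_mul] using right (inv_mem_cubicSpan w)) hy)
  · exact fun y hy => mem_between_one_right.1
      (extend (by simpa only [mul_one] using left (mem_cubicSpan w)) hy)
  · exact fun y hy => mem_between_one_right.1
      (extend (by simpa only [mul_one] using left (inv_mem_cubicSpan w)) hy)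

theorem unitAdjoin_le_between (h : SkeinQuad q e e₁ e₂ r s t w) (hx : x ∈ cubicSpan k w)
    (hz : z ∈ cubicSpan k w) :
    (unitAdjoin k {r, s, t}).toSubmodule ≤ between (quadConductor k r s t w) x z := by
  refine h.left.unitAdjoin_le_tripleSpan.trans (sup_le (h.alternatingSpan_le_between hx hz)
    (mul_le.2 fun m hm b hb => ?_))
  have inv_mem := h.inv.cubicSpan_mul_murphy₄_mul_cubicSpan_le
  rw [quadConductor_inv, murphy₄_inv, cubicSpan_inv] at inv_mem
  have mem : m ∈ between (quadConductor k r s t w) x z := by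
    refine span_le.2 ?_ hm
    rintro _ (rfl | rfl)
    · exact h.cubicSpan_mul_murphy₄_mul_cubicSpan_le
        (mul_mem_mul (mul_mem_mul hx (mem_span_singleton_self _)) hz)
    · exact inv_mem (mul_mem_mul (mul_mem_mul hx (mem_span_singleton_self _)) hz)
  have mem' := right_mul_mem_quadConductor (mem_between.1 mem) (unitAdjoin_pair_le_triple hb)
  simpa only [mem_between, mul_assoc, (h.commute_of_mem hb hz).eq] using mem'

theorem gen_mul_mem_quadSpan_of_mem_quadFilt (h : SkeinQuad q e e₁ e₂ r s t w)
    (hx : x ∈ cubicSpan k w) (hy : y ∈ quadFilt k r s t w 2) : x * y ∈ quadSpan k r s t w := by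
  rw [quadFilt, wordFilt_succ] at hy
  refine mem_between_one_right.1 ((mul_mul_le.2 fun a ha v hv c hc => ?_ :
    _ ≤ between (quadSpan k r s t w) x 1) hy)
  rw [wordFilt_one] at ha
  have words : (unitAdjoin k {r, s, t}).toSubmodule * cubicSpan k w *
      (unitAdjoin k {r, s, t}).toSubmodule ≤ between (quadSpan k r s t w) x (v * c) := by
    refine mul_mul_le.2 fun b hb u hu d hd => ?_
    have mem := right_mul_mem_quadSpan (mem_quadConductor.1
      (mem_between.1 (h.unitAdjoin_le_between hu hv hd)) x hx b hb) hc
    simpa only [mem_between, mul_assoc] using mem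
  simpa only [mem_between, mul_assoc, mul_one] using words ha

theorem topWord_factor_mem_unitAdjoin :
    ((t⁻¹ * s * t⁻¹ * (r * s⁻¹ * r) : Aˣ) : A) ∈ unitAdjoin k {r, s, t} := by
  rw [Units.val_mul]
  refine mul_mem ?_ (unitAdjoin_pair_le_triple mul_inv_mul_mem_unitAdjoin)
  simp only [Units.val_mul]
  exact mul_mem (mul_mem (by simp) (by simp)) (by simp)

theorem gen_mul_mem_quadSpan_of_mem_halfSpan (h : SkeinQuad q e e₁ e₂ r s t w)
    (hx : x ∈ cubicSpan k w) (hy : y ∈ halfSpan k r s t w) : x * y ∈ quadSpan k r s t w := by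
  obtain ⟨u, hu, v, hv, rfl⟩ := mem_sup.1 hy
  obtain ⟨c, hc, rfl⟩ := mem_span_singleton_mul.1 hv
  rw [mul_add]
  refine add_mem (h.gen_mul_mem_quadSpan_of_mem_quadFilt hx hu) (mem_sup_left ?_)
  have mem := right_mul_mem_halfSpan (mem_between.1 (h.unitAdjoin_le_between_murphy₄
    (h.right.right.cubic_right.mul_mem_cubicSpan hx (mem_cubicSpan w))
    topWord_factor_mem_unitAdjoin)) hc
  simpa only [topWord, Units.val_mul, mul_assoc] using mem

theorem cubicSpan_mul_mem_quadSpan (h : SkeinQuad q e e₁ e₂ r s t w) (hx : x ∈ cubicSpan k w)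
    (hy : y ∈ quadSpan k r s t w) : x * y ∈ quadSpan k r s t w := by
  obtain ⟨u, hu, v, hv, rfl⟩ := mem_sup.1 hy
  have inv_mem := h.inv.gen_mul_mem_quadSpan_of_mem_halfSpan (by rwa [cubicSpan_inv]) hv
  rw [quadSpan_inv] at inv_mem
  rw [mul_add]
  exact add_mem (h.gen_mul_mem_quadSpan_of_mem_halfSpan hx hu) inv_mem

theorem unitAdjoin_le_quadSpan (h : SkeinQuad q e e₁ e₂ r s t w) :
    (unitAdjoin k {r, s, t, w}).toSubmodule ≤ quadSpan k r s t w := by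
  intro y hy
  have one_mem_quadSpan : (1 : A) ∈ quadSpan k r s t w :=
    quadFilt_le_quadSpan (wordFilt_le_succ (cubicSpan_le_wordFilt (one_mem_cubicSpan w)))
  rw [← mul_one y]
  refine mul_mem_of_left_stable (fun g hg x hx => ?_) hy one_mem_quadSpan
  have triple (hg : g ∈ ({r, s, t} : Set Aˣ)) :
      (g : A) * x ∈ quadSpan k r s t w ∧ (↑g⁻¹ : A) * x ∈ quadSpan k r s t w :=
    ⟨h.left_mul_mem_quadSpan (coe_mem_unitAdjoin hg) hx,
      h.left_mul_mem_quadSpan (inv_mem_unitAdjoin hg) hx⟩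
  obtain rfl | rfl | rfl | rfl := hg
  · exact triple (by simp)
  · exact triple (by simp)
  · exact triple (by simp)
  · exact ⟨h.cubicSpan_mul_mem_quadSpan (mem_cubicSpan _) hx,
      h.cubicSpan_mul_mem_quadSpan (inv_mem_cubicSpan _) hx⟩

theorem halfSpan_le_quadFilt : halfSpan k r s t w ≤ quadFilt k r s t w 3 := by
  refine sup_le wordFilt_le_succ fun y hy => ?_
  obtain ⟨c, hc, rfl⟩ := mem_span_singleton_mul.1 hy
  have gen_mem : (w : A) ∈ quadFilt k r s t w 1 := cubicSpan_le_wordFilt (mem_cubicSpan w)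
  have mem := mul_mem_wordFilt (right_mul_mem_wordFilt gen_mem
    (topWord_factor_mem_unitAdjoin (k := k) (r := r) (s := s) (t := t)))
    (murphy₄_mem_quadFilt (k := k) (r := r) (s := s) (t := t) (w := w))
  simpa only [topWord, Units.val_mul] using right_mul_mem_wordFilt mem hc

theorem unitAdjoin_le_quadFilt (h : SkeinQuad q e e₁ e₂ r s t w) :
    (unitAdjoin k {r, s, t, w}).toSubmodule ≤ quadFilt k r s t w 3 := by
  refine h.unitAdjoin_le_quadSpan.trans (sup_le halfSpan_le_quadFilt ?_)
  rw [← quadFilt_inv]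
  exact halfSpan_le_quadFilt

end SkeinQuad

end SkeinAlgebra

namespace CubicQuotient

open SkeinAlgebra

theorem artin_braid {n : ℕ} (i j : Index n) (h : i.1 + 1 = j.1) :
    artin i * artin j * artin i = artin j * artin i * artin j := by
  rw [← mul_inv_eq_one]
  simpa [artin, PresentedGroup.of] using
    PresentedGroup.one_of_mem (rels := {r | ArtinRel n r}) (ArtinRel.braid i j h)

theorem commute_artin {n : ℕ} (i j : Index n) (h : i.1 + 2 ≤ j.1) :
    Commute (artin i) (artin j) := by
  rw [commute_iff_eq, ← mul_inv_eq_one]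
  simpa [artin, PresentedGroup.of] using
    PresentedGroup.one_of_mem (rels := {r | ArtinRel n r}) (ArtinRel.comm i j h)

/-- The group homomorphism from the braid group to the units of `Q n` induced by `toQ n`. -/
noncomputable def braidUnit (n : ℕ) : BraidGroup n →* (Q n)ˣ :=
  (Units.map ((toQ n : BraidAlgebra n →ₐ[R] Q n) : BraidAlgebra n →* Q n)).comp
    (MonoidAlgebra.of R (BraidGroup n)).toHomUnits

theorem val_braidUnit {n : ℕ} (g : BraidGroup n) :
    ((braidUnit n g : (Q n)ˣ) : Q n) = toQ n (br g) := rfl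

/-- The image of the Artin generator `s i` in the group of units of `Q n`. -/
noncomputable def artinUnit {n : ℕ} (i : Index n) : (Q n)ˣ := braidUnit n (artin i)

theorem artinUnit_braid {n : ℕ} (i j : Index n) (h : i.1 + 1 = j.1) :
    artinUnit i * artinUnit j * artinUnit i = artinUnit j * artinUnit i * artinUnit j := by
  simp only [artinUnit, ← map_mul, artin_braid i j h]

theorem commute_artinUnit {n : ℕ} (i j : Index n) (h : i.1 + 2 ≤ j.1) :
    Commute (artinUnit i) (artinUnit j) :=
  (commute_artin i j h).map (braidUnit n)

theorem isCubic_artinUnit {n : ℕ} (i : Index n) :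
    IsCubic (A := Q n) (a * b * c) (a + b + c : R) (a * b + a * c + b * c : R) (artinUnit i) := by
  apply isCubic_of_mul_eq_zero
  have cubic := RingQuot.mkAlgHom_rel R (QRel.cubic i)
  simp only [map_mul, map_sub, map_zero, AlgHom.commutes] at cubic
  exact cubic

theorem skeinPair_artinUnit_one_two {n : ℕ} (hn : 3 ≤ n) :
    SkeinPair (A := Q n) a (a * b * c) (a + b + c : R) (a * b + a * c + b * c : R)
      (artinUnit (n := n) ⟨1, by lia⟩) (artinUnit (n := n) ⟨2, by lia⟩) := by
  refine ⟨artinUnit_braid _ _ rfl, isCubic_artinUnit _, isCubic_artinUnit _, ?_⟩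
  have skein := RingQuot.mkAlgHom_rel R (QRel.skein (n := n) (artin ⟨1, by lia⟩)
    (artin ⟨2, by lia⟩) ⟨_, rfl⟩ ⟨_, rfl⟩)
  simp only [map_sub, map_add, map_smul] at skein
  simp only [artinUnit, ← map_inv, ← map_mul, val_braidUnit]
  exact skein

theorem skeinPair_artinUnit {n i : ℕ} (hi : 1 ≤ i) (hn : i + 2 ≤ n) :
    SkeinPair (A := Q n) a (a * b * c) (a + b + c : R) (a * b + a * c + b * c : R)
      (artinUnit (n := n) ⟨i, by lia⟩) (artinUnit (n := n) ⟨i + 1, by lia⟩) := by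
  induction i, hi using Nat.le_induction with
  | base => exact skeinPair_artinUnit_one_two hn
  | succ i hi ih =>
    exact (ih (by lia)).shift (artinUnit_braid _ ⟨i + 1 + 1, by lia⟩ rfl)
      (commute_artinUnit _ _ le_rfl)

theorem skeinTriple_artinUnit {n i : ℕ} (hi : 1 ≤ i) (hn : i + 3 ≤ n) :
    SkeinTriple (A := Q n) a (a * b * c) (a + b + c : R) (a * b + a * c + b * c : R)
      (artinUnit (n := n) ⟨i, by lia⟩) (artinUnit (n := n) ⟨i + 1, by lia⟩)
      (artinUnit (n := n) ⟨i + 2, by lia⟩) :=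
  ⟨skeinPair_artinUnit hi (by lia), skeinPair_artinUnit (by lia) hn,
    commute_artinUnit _ _ le_rfl⟩

theorem skeinQuad_artinUnit {n i : ℕ} (hi : 1 ≤ i) (hn : i + 4 ≤ n) :
    SkeinQuad (A := Q n) a (a * b * c) (a + b + c : R) (a * b + a * c + b * c : R)
      (artinUnit (n := n) ⟨i, by lia⟩) (artinUnit (n := n) ⟨i + 1, by lia⟩)
      (artinUnit (n := n) ⟨i + 2, by lia⟩)
      (artinUnit (n := n) ⟨i + 3, by lia⟩) :=
  ⟨skeinTriple_artinUnit hi (by lia), skeinTriple_artinUnit (by lia) hn,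
    commute_artinUnit _ _ (Nat.le_succ _)⟩

theorem unitAdjoin_range_artinUnit (n : ℕ) :
    unitAdjoin (A := Q n) R (Set.range artinUnit) = ⊤ := by
  have mem_closure (g : BraidGroup n) :
      braidUnit n g ∈ Subgroup.closure (Set.range (artinUnit (n := n))) :=
    PresentedGroup.generated_by _ ((Subgroup.closure (Set.range artinUnit)).comap (braidUnit n))
      (fun i => Subgroup.subset_closure ⟨i, rfl⟩) g
  rw [eq_top_iff]
  rintro x -
  obtain ⟨x, rfl⟩ := RingQuot.mkAlgHom_surjective R (QRel n) x
  induction x using MonoidAlgebra.induction_on with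
  | of g => exact coe_mem_unitAdjoin_of_mem_closure (A := Q n) (k := R) (mem_closure g)
  | add x y hx hy => rw [map_add]; exact add_mem hx hy
  | smul c x hx => rw [map_smul]; exact Subalgebra.smul_mem _ hx c

theorem range_artinUnit_five : Set.range (artinUnit (n := 5)) =
    {artinUnit ⟨1, by norm_num⟩, artinUnit ⟨2, by norm_num⟩, artinUnit ⟨3, by norm_num⟩,
      artinUnit ⟨4, by norm_num⟩} := by
  ext x
  simp only [Set.mem_range, Set.mem_insert_iff, Set.mem_singleton_iff]
  constructor
  · rintro ⟨⟨i, h1, h2⟩, rfl⟩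
    interval_cases i <;> simp
  · rintro (rfl | rfl | rfl | rfl) <;> exact ⟨_, rfl⟩

theorem unitAdjoin_le_sub {n : ℕ} {S : Set (Q (n + 1))ˣ}
    (h : ∀ g ∈ S, ∃ i : Index n, g = artinUnit ⟨i.1, i.2.1, Nat.lt_succ_of_lt i.2.2⟩) :
    (unitAdjoin (A := Q (n + 1)) R S).toSubmodule ≤ sub n := by
  suffices unitAdjoin (A := Q (n + 1)) R S ≤ (incl n).range from this
  refine Algebra.adjoin_le ?_
  have coe_mem {g : (Q (n + 1))ˣ} (hg : g ∈ S) : ∃ v : (Q n)ˣ, Units.map (incl n) v = g := by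
    obtain ⟨i, rfl⟩ := h g hg
    exact ⟨artinUnit i, Units.ext (incl_s i)⟩
  rintro _ ⟨g, hg | hg, rfl⟩
  · obtain ⟨v, rfl⟩ := coe_mem hg
    exact ⟨v, rfl⟩
  · obtain ⟨v, hv⟩ := coe_mem hg
    exact ⟨(v⁻¹ : (Q n)ˣ), by rw [← inv_inv g, ← hv]; rfl⟩

theorem cubicSpan_artinUnit_le_u {n : ℕ} (i : Index n) :
    cubicSpan (A := Q n) R (artinUnit i) ≤ u i :=
  (isCubic_artinUnit i).cubicSpan_le_span_pow

theorem wordFilt_le_filt {n : ℕ} (hn : 1 ≤ n) {S : Subalgebra R (Q (n + 1))}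
    (h : S.toSubmodule ≤ sub n) (k : ℕ) :
    wordFilt (A := Q (n + 1)) S (artinUnit ⟨n, hn, Nat.lt_succ_self n⟩) k ≤ filt n hn k := by
  induction k with
  | zero => rwa [wordFilt_zero]
  | succ k ih =>
    rw [wordFilt_succ]
    exact mul_le_mul' (mul_le_mul' ih (cubicSpan_artinUnit_le_u _)) h

theorem top_le_quadFilt : (⊤ : Submodule R (Q 5)) ≤
    quadFilt (A := Q 5) R (artinUnit ⟨1, by norm_num⟩) (artinUnit ⟨2, by norm_num⟩)
      (artinUnit ⟨3, by norm_num⟩) (artinUnit ⟨4, by norm_num⟩) 3 := by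
  rw [← Algebra.top_toSubmodule, ← unitAdjoin_range_artinUnit, range_artinUnit_five]
  exact (skeinQuad_artinUnit le_rfl le_rfl).unitAdjoin_le_quadFilt

end CubicQuotient

theorem mainTheorem3 :
    Module.Finite CubicQuotient.R (CubicQuotient.Q 5) ∧
    (⊤ : Submodule CubicQuotient.R (CubicQuotient.Q 5)) =
      CubicQuotient.filt 4 (by norm_num) 3 ∧
    CubicQuotient.filt 4 (by norm_num) 3 =
      CubicQuotient.sub 4 * CubicQuotient.u ⟨4, by norm_num⟩ *
      CubicQuotient.sub 4 * CubicQuotient.u ⟨4, by norm_num⟩ *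
      CubicQuotient.sub 4 * CubicQuotient.u ⟨4, by norm_num⟩ *
      CubicQuotient.sub 4 := by
  have top_le := CubicQuotient.top_le_quadFilt
  refine ⟨⟨?_⟩, top_le_iff.1 (top_le.trans ?_) |>.symm, rfl⟩
  · rw [← top_le_iff.1 top_le]
    exact SkeinAlgebra.fg_wordFilt
      (CubicQuotient.skeinTriple_artinUnit le_rfl (by norm_num)).fg_unitAdjoin 3
  · refine CubicQuotient.wordFilt_le_filt _ (CubicQuotient.unitAdjoin_le_sub ?_) 3
    rintro g (rfl | rfl | rfl)
    exacts [⟨⟨1, by norm_num⟩, rfl⟩, ⟨⟨2, by norm_num⟩, rfl⟩, ⟨⟨3, by norm_num⟩, rfl⟩]
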